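/- Let $J\ge 1$ and let $L_1,\dots,L_J$ be meromorphic functions of finite order on $\mathbb C$, each with finitely many poles, satisfying the following assumptions. 1. (Euler product) For $\mathrm{Re}(s)>1$ and each $j$, $L_j(s)=\prod_p\prod_{i=1}^d\bigl(1-\alpha_{j,i}(p)p^{-s}\bigr)^{-1}$, where $|\alpha_{j,i}(p)|\le p^{\theta}$ for all $i,j,p$ and some fixed $0\le\theta<1/2$. Put $\beta_{L_j}(p^k)=\frac1k\sum_{i=1}^d\alpha_{j,i}(p)^k$ for $k\ge1$. 2. (Functional equation) There are $\omega\in\mathbb C$ with $|\omega|=1$, $Q>0$, $m\geq 0$, and $\lambda_\ell>0$, $\mu_\ell\in\mathbb C$ with $\mathrm{Re}(\mu_\ell)\ge 0$ $(1\le \ell\le m)$, the same for all $j$, such that $\Lambda_j(s):=L_j(s)Q^s\prod_{\ell=1}^m\Gamma(\lambda_\ell s+\mu_\ell)$ satisfies $\Lambda_j(s)=\omega\,\overline{\Lambda_j(1-\bar s)}$. 3. (Ramanujan hypothesis on average) For all $j$ and $\varepsilon>0$, $\sum_{p\le x}\sum_{i=1}^d|\alpha_{j,i}(p)|^2=O(x^{1+\varepsilon})$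 as $x\to\infty$. 4. (Zero density hypothesis) Let $N_{L_j}(\sigma,T)$ be the number of zeros of $L_j$, counted with multiplicity, with $\mathrm{Re}(s)\ge\sigma$ and $T\le \mathrm{Im}(s)\le 2T$. There are constants $a,b>0$ such that $N_{L_j}(\sigma,T)\ll T^{1-a(\sigma-1/2)}(\log T)^{b}$ for all $j$ and all large $T$, uniformly for $\sigma\ge1/2$. 5. (Selberg orthonormality) There are constants $\xi_j>0$ and $c_{j,k}\in\mathbb C$ such that for all $1\le j,k\le J$, as $x\to\infty$, $\sum_{p\le x}\beta_{L_j}(p)\overline{\beta_{L_k}(p)}/p=\delta_{j,k}\,\xi_j\log\log x+c_{j,k}+O(1/\log x)$. For $s=\sigma+it$, let $\log L_j(s)$ be the branch given by $\sum_p\sum_{k\ge1}\beta_{L_j}(p^k)p^{-ks}$ for $\mathrm{Re}(s)>1$, continued continuously along the horizontal ray $\{u+it:u\ge\sigma\}$; it is defined whenever $L_j$ has neither a zero nor a pole on this ray. Let $(\mathbb X(p))_p$ be independent random variables, indexed by the primes and uniformly distributed on the unit circle, and let $$\log L_j(\sigma,\mathbb X)=\lim_{q\to\infty}\sum_{p\le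 q}\sum_{k\ge1}\frac{\beta_{L_j}(p^k)\mathbb X(p)^k}{p^{k\sigma}},$$ a limit which exists almost surely for $\sigma>1/2$. **Lemma.** Let $1\le j\le J$. There are positive constants $c_0,c_1,C$ and a number $T_0$, depending only on the family (and on $j$), such that for all real $T\ge T_0$, all $G$ with $\log\log T\le G\le c_0\sqrt{\log T/\log\log T}$, and all $\tau$ with $\sqrt{\log G}\le\tau\le(\log\log T)^2$, putting $\sigma=\frac12+\frac1G$ and $G_0=\max\{\sqrt{\log G},\ \log\log\log T\}$, one has $$\frac1T\,\mathrm{meas}\{t\in[T,2T]:|\log L_j(\sigma+it)|\ge\tau\}\le C\,\frac{\tau}{\sqrt{\log G}}\exp\left(-\frac{\tau^2}{\xi_j\log G+c_1G_0}\right)$$ and $$\mathbb P\bigl(|\log L_j(\sigma,\mathbb X)|>\tau\bigr)\le C\,\frac{\tau}{\sqrt{\log G}}\exp\left(-\frac{\tau^2}{\xi_j\log G+c_1G_0}\right).$$ In both estimates the points at which the logarithm is not defined may be included in the set on the left. -/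

import Mathlib

open Filter Topology MeasureTheory ProbabilityTheory Asymptotics
open scoped ENNReal ComplexConjugate

noncomputable section

/-- The finite set of primes `p ≤ x`. -/
def primesUpTo (x : ℝ) : Finset Nat.Primes :=
  (Finset.range (⌊x⌋₊ + 1)).subtype Nat.Prime

/-- The coefficient `β(p^k) = (1/k) ∑ᵢ αᵢ(p)^k` (for `k ≥ 1`) of the Dirichlet series of the
logarithm of the Euler product `∏_p ∏ᵢ (1 - αᵢ(p) p^{-s})⁻¹`. -/
def primePowerCoeff {d : ℕ} (α : Fin d → Nat.Primes → ℂ) (p : Nat.Primes) (k : ℕ) : ℂ :=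
  (1 / (k : ℂ)) * ∑ i, α i p ^ k

/-- `∑_p ∑_{k ≥ 1} β(p^k) p^{-ks}`. -/
def logDirichletSeries {d : ℕ} (α : Fin d → Nat.Primes → ℂ) (s : ℂ) : ℂ :=
  ∑' p : Nat.Primes, ∑' k : ℕ,
    primePowerCoeff α p (k + 1) / ((p : ℕ) : ℂ) ^ (((k : ℂ) + 1) * s)

/-- `L` is a meromorphic function of finite order on `ℂ` with finitely many poles: `L = f / P` with
`f` entire of finite order and `P` a nonzero polynomial without common zeros with `f`, so that the
poles of `L` are the zeros of `P`. The value of `L` at a pole is irrelevant. -/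
def IsMeromorphicOfFiniteOrder (L : ℂ → ℂ) : Prop :=
  ∃ (P : Polynomial ℂ) (f : ℂ → ℂ), P ≠ 0 ∧ Differentiable ℂ f ∧
    (∃ (A : ℕ) (C : ℝ), ∀ s, ‖f s‖ ≤ C * Real.exp (‖s‖ ^ A)) ∧
    (∀ s, P.eval s = 0 → f s ≠ 0) ∧
    (∀ s, P.eval s ≠ 0 → L s = f s / P.eval s)

/-- `N_L(σ, T)`: the number of zeros of `L`, with multiplicity, in the region `Re s ≥ σ`,
`T ≤ Im s ≤ 2T`. (`analyticOrderAt` is `0` at the points that are not zeros, poles included.) -/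
def zeroCount (L : ℂ → ℂ) (σ T : ℝ) : ℝ≥0∞ :=
  ∑' z : {z : ℂ | σ ≤ z.re ∧ T ≤ z.im ∧ z.im ≤ 2 * T}, ((analyticOrderAt L (z : ℂ) : ℕ∞) : ℝ≥0∞)

/-- `Λ(s) = L(s) Q^s ∏_ℓ Γ(λ_ℓ s + μ_ℓ)`. -/
def completed (L : ℂ → ℂ) (Q : ℝ) {m : ℕ} (lam : Fin m → ℝ) (mu : Fin m → ℂ) (s : ℂ) : ℂ :=
  L s * (Q : ℂ) ^ s * ∏ ℓ, Complex.Gamma ((lam ℓ : ℂ) * s + mu ℓ)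

/-- A family `L_1, …, L_J` of `L`-functions with a common functional equation that satisfies the
zero density hypothesis and the Selberg orthonormality conjecture. -/
structure LFunctionFamily (J : ℕ) where
  /-- the `L`-functions, as functions on `ℂ` -/
  L : Fin J → ℂ → ℂ
  /-- the number of local roots at each prime -/
  d : ℕ
  /-- the local roots `α_{j,i}(p)` -/
  α : Fin J → Fin d → Nat.Primes → ℂ
  /-- the conductor factor of the functional equation -/
  Q : ℝ
  /-- the number of gamma factors -/
  m : ℕ
  /-- the scaling parameters of the gamma factors -/
  lam : Fin m → ℝ
  /-- the shifts of the gamma factors -/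
  mu : Fin m → ℂ
  /-- the root number -/
  rootNumber : ℂ
  /-- the constants of the orthonormality relations -/
  ξ : Fin J → ℝ
  meromorphic : ∀ j, IsMeromorphicOfFiniteOrder (L j)
  /-- Euler product -/
  euler_product : ∀ j (s : ℂ), 1 < s.re →
    HasProd (fun p : Nat.Primes => ∏ i, (1 - α j i p / ((p : ℕ) : ℂ) ^ s)⁻¹) (L j s)
  root_bound : ∃ θ : ℝ, 0 ≤ θ ∧ θ < 1 / 2 ∧ ∀ j i p, ‖α j i p‖ ≤ ((p : ℕ) : ℝ) ^ θ
  Q_pos : 0 < Q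
  lam_pos : ∀ ℓ, 0 < lam ℓ
  mu_re_nonneg : ∀ ℓ, 0 ≤ (mu ℓ).re
  norm_rootNumber : ‖rootNumber‖ = 1
  /-- The functional equation, as an identity of meromorphic functions: it is stated at the points
  `s` where no factor on either side has a pole. -/
  functional_equation : ∀ j (s : ℂ),
    AnalyticAt ℂ (L j) s → AnalyticAt ℂ (L j) (1 - conj s) →
    (∀ ℓ (n : ℕ), (lam ℓ : ℂ) * s + mu ℓ ≠ -(n : ℂ)) →
    (∀ ℓ (n : ℕ), (lam ℓ : ℂ) * (1 - conj s) + mu ℓ ≠ -(n : ℂ)) →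
    completed (L j) Q lam mu s = rootNumber * conj (completed (L j) Q lam mu (1 - conj s))
  /-- Ramanujan hypothesis on average -/
  ramanujan_on_average : ∀ j, ∀ ε : ℝ, 0 < ε →
    (fun x : ℝ => ∑ p ∈ primesUpTo x, ∑ i, ‖α j i p‖ ^ 2) =O[atTop] fun x : ℝ => x ^ (1 + ε)
  /-- Zero density hypothesis -/
  zero_density : ∃ a b : ℝ, 0 < a ∧ 0 < b ∧ ∃ C T₀ : ℝ, ∀ j, ∀ σ T : ℝ, 1 / 2 ≤ σ → T₀ ≤ T →
    zeroCount (L j) σ T ≤ ENNReal.ofReal (C * T ^ (1 - a * (σ - 1 / 2)) * Real.log T ^ b)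
  ξ_pos : ∀ j, 0 < ξ j
  /-- Selberg orthonormality conjecture -/
  orthonormality : ∀ j k, ∃ c : ℂ,
    (fun x : ℝ => ∑ p ∈ primesUpTo x,
        primePowerCoeff (α j) p 1 * conj (primePowerCoeff (α k) p 1) / ((p : ℕ) : ℂ)
      - (if j = k then ((ξ j * Real.log (Real.log x) : ℝ) : ℂ) else 0) - c)
    =O[atTop] fun x : ℝ => 1 / Real.log x

/-- `w` is the value of `log L` at `s`: the branch that is given by the Dirichlet series
`∑_p ∑_k β(p^k) p^{-ks}` for `Re s > 1` is continued continuously along the horizontal ray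
`{u + i Im s : u ≥ Re s}`, on which `L` has to be finite and nonzero. There is at most one such
`w`, and none if `L` has a zero on the ray. -/
def HasLogValue (L : ℂ → ℂ) {d : ℕ} (α : Fin d → Nat.Primes → ℂ) (s w : ℂ) : Prop :=
  ∃ g : ℝ → ℂ, ContinuousOn g (Set.Ici s.re) ∧
    (∀ u : ℝ, s.re ≤ u → Complex.exp (g u) = L ((u : ℂ) + (s.im : ℂ) * Complex.I)) ∧
    (∀ u : ℝ, s.re ≤ u → 1 < u →
      g u = logDirichletSeries α ((u : ℂ) + (s.im : ℂ) * Complex.I)) ∧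
    g s.re = w

/-- The uniform distribution on the unit circle of `ℂ`. -/
def uniformOnCircle : Measure ℂ :=
  (volume.restrict (Set.Ioc (0 : ℝ) 1)).map
    (fun x : ℝ => Complex.exp (2 * Real.pi * x * Complex.I))

/-- `X(p)`, for `p` prime, are independent random variables that are uniformly distributed on the
unit circle. -/
structure IsUniformCircleSequence {Ω : Type*} [MeasurableSpace Ω] (X : Nat.Primes → Ω → ℂ)
    (Pr : Measure Ω) : Prop where
  measurable : ∀ p, Measurable (X p)
  indep : iIndepFun X Pr
  law : ∀ p, Pr.map (X p) = uniformOnCircle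

/-- The partial sum over the primes `p ≤ q` of the series
`log L(σ, x) = ∑_p ∑_{k ≥ 1} β(p^k) x(p)^k p^{-kσ}`. -/
def randomLogPartial {d : ℕ} (α : Fin d → Nat.Primes → ℂ) (σ : ℝ) (x : Nat.Primes → ℂ) (q : ℕ) :
    ℂ :=
  ∑ p ∈ primesUpTo q, ∑' k : ℕ,
    primePowerCoeff α p (k + 1) * x p ^ (k + 1) / ((p : ℕ) : ℂ) ^ (((k : ℂ) + 1) * (σ : ℂ))

/-- `w` is the value of `log L(σ, x) = ∑_p ∑_{k ≥ 1} β(p^k) x(p)^k p^{-kσ}`, where the sum over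
the primes is taken in increasing order (in general it does not converge absolutely). -/
def HasRandomLogValue {d : ℕ} (α : Fin d → Nat.Primes → ℂ) (σ : ℝ) (x : Nat.Primes → ℂ) (w : ℂ) :
    Prop :=
  Tendsto (randomLogPartial α σ x) atTop (𝓝 w)

/-- The function `(τ / √(log G)) exp(-τ² / (ξ log G + c₁ G₀(T)))`, where
`G₀(T) = max (√(log G)) (log log log T)`. -/
def largeDeviationBound (ξ c₁ T G τ : ℝ) : ℝ :=
  τ / √(Real.log G) * Real.exp (-τ ^ 2 /
    (ξ * Real.log G + c₁ * max (√(Real.log G)) (Real.log (Real.log (Real.log T)))))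

end

/-!
Both distributions are compared with a complex Gaussian of variance `ξ log G + O(G₀)` by means of
high moments. A sum over primes `∑ a(p) p^{-it}`, as well as its random model `∑ a(p) X(p)`, has
moments of order `2k` that are at most a constant times `k! (∑ |a(p)|²)^k`: for the random model
for all `k` (`IsUniformCircleSequence.integral_norm_sum_pow_le`), and for the Dirichlet polynomial
as long as its `k`-th power is shorter than `√T` (`integral_norm_pow_primePolynomial_le`). Markov's
inequality with `k ≈ τ² / W`, and Stirling's formula for `k!`, then give the tail
`(τ / √(log G)) exp (-τ² / W)` (`tail_le_of_moments`). The orthonormality relation shows that the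
variance at `σ = 1/2 + 1/G` is `ξ log G + O(1)` for the random sum, and that it is
`ξ (log G + log log log T) + O(1)` for a Dirichlet polynomial over the primes up to a power of
`exp (G log log T)`. The squares of the primes have bounded variance, the higher powers have a
bounded sum, and the shift by a bounded amount costs `O(√(log G))` in `W`; this is how
`c₁ max (√(log G)) (log log log T)` arises.

It remains to pass from `log L` to such sums over primes.

* For the random variable, the partial sums over the primes `p ≤ q` satisfy the tail bound uniformly
  in `q`, and they converge almost surely by the martingale convergence theorem.

* For `log L(σ + it)`, suppose that `L` has no zero to the right of `1/2 + 1/(2G)` at height within a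
  power of `log T` from `t`. Then `log L` is holomorphic in a disc that reaches to the left of
  `σ + it`, where it is at most a power of `log T` by the Borel–Carathéodory theorem and the
  polynomial growth of `L` (functional equation and Phragmén–Lindelöf). Shifting the contour in a
  smoothed Perron formula by `1/(4G)` to the left of `σ + it` expresses `log L(σ + it)` as a smoothed
  Dirichlet polynomial up to a bounded error (`LFunctionFamily.exists_hasLogValue`). By the zero
  density hypothesis, the excluded `t` have measure at most `T exp (-c √(log T))` up to powers of
  `log T`, which is smaller than `T exp (-(log log T)⁴ / ξ)`, and so than `T` times the Gaussian in
  the whole range of `τ`.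
-/

/-! ### From moments to tails -/

/-- Stirling's upper bound. The factor `√k` is the source of the prefactor `τ / √v` in the tail
bounds. -/
theorem factorial_le_exp_mul_sqrt {k : ℕ} (hk : k ≠ 0) :
    (k.factorial : ℝ) ≤ Real.exp 1 * √k * (k / Real.exp 1) ^ k := by
  obtain ⟨m, rfl⟩ := Nat.exists_eq_succ_of_ne_zero hk
  have h := Stirling.stirlingSeq'_antitone (Nat.zero_le m)
  simp only [Function.comp, Nat.succ_eq_add_one, zero_add, Stirling.stirlingSeq_one] at h
  rw [Stirling.stirlingSeq, div_le_iff₀ (by positivity)] at h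
  refine h.trans (le_of_eq ?_)
  have h2 : √(2 * ((m + 1 : ℕ) : ℝ)) = √2 * √((m + 1 : ℕ) : ℝ) := Real.sqrt_mul (by norm_num) _
  have h3 : √(2 : ℝ) ≠ 0 := by positivity
  rw [Nat.succ_eq_add_one, h2]
  field_simp

/-- Markov's inequality for the moment of order `2k`, with `k = ⌊τ² / W⌋`, turns factorial moment
bounds into a Gaussian tail with the prefactor `τ / √v`. -/
theorem tail_le_of_moments {m A B W v τ : ℝ} (hv : 0 < v) (hA : 0 < A) (hB : 1 ≤ B)
    (hvW : v ≤ B * W) (hτ : √v ≤ τ) (hmA : m ≤ A)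
    (h : ∀ k : ℕ, k ≠ 0 → k * W ≤ τ ^ 2 → m ≤ A * k.factorial * (W / τ ^ 2) ^ k) :
    m ≤ A * Real.exp 2 * B * (τ / √v) * Real.exp (-τ ^ 2 / W) := by
  have hW : 0 < W := by nlinarith
  have hsv : 0 < √v := Real.sqrt_pos.2 hv
  have hτ0 : 0 < τ := hsv.trans_le hτ
  have h1 : 1 ≤ τ / √v := (one_le_div hsv).2 hτ
  set k := ⌊τ ^ 2 / W⌋₊ with hk
  have hlt : τ ^ 2 / W < k + 1 := Nat.lt_floor_add_one _
  have hexp : Real.exp (-(k : ℝ)) ≤ Real.exp 1 * Real.exp (-τ ^ 2 / W) := by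
    rw [← Real.exp_add, neg_div]
    exact Real.exp_le_exp.2 (by linarith)
  have he : Real.exp 2 = Real.exp 1 * Real.exp 1 := by rw [← Real.exp_add]; norm_num
  rcases eq_or_ne k 0 with hk0 | hk0
  -- here `τ² < W`, and the right-hand side is at least `A`
  · rw [hk0] at hexp
    simp only [Nat.cast_zero, neg_zero, Real.exp_zero] at hexp
    have h2 : 1 ≤ Real.exp 2 * Real.exp (-τ ^ 2 / W) := by
      rw [he]
      nlinarith [Real.add_one_le_exp (1 : ℝ)]
    calc m ≤ A * (1 * 1 * 1) := by linarith
      _ ≤ A * (B * (τ / √v) * (Real.exp 2 * Real.exp (-τ ^ 2 / W))) := by gcongr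
      _ = _ := by ring
  · have hkW : k * W ≤ τ ^ 2 := by
      rw [← le_div_iff₀ hW]
      exact Nat.floor_le (by positivity)
    have hk1 : (1 : ℝ) ≤ k := by exact_mod_cast Nat.one_le_iff_ne_zero.2 hk0
    have hsqrt : √k ≤ B * (τ / √v) := by
      rw [Real.sqrt_le_left (by positivity), mul_pow, div_pow, Real.sq_sqrt hv.le]
      have : (k : ℝ) * v ≤ B ^ 2 * τ ^ 2 := by
        calc (k : ℝ) * v ≤ k * (B * W) := by gcongr
          _ = B * (k * W) := by ring
          _ ≤ B * τ ^ 2 := by gcongr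
          _ ≤ B ^ 2 * τ ^ 2 := by gcongr; nlinarith
      rw [← mul_div_assoc, le_div_iff₀ hv]
      exact this
    calc m ≤ A * k.factorial * (W / τ ^ 2) ^ k := h k hk0 hkW
      _ ≤ A * (Real.exp 1 * √k * (k / Real.exp 1) ^ k) * (W / τ ^ 2) ^ k := by
          gcongr
          exact factorial_le_exp_mul_sqrt hk0
      _ = A * Real.exp 1 * √k * Real.exp (-(k : ℝ)) * (k * W / τ ^ 2) ^ k := by
          have : Real.exp (-(k : ℝ)) = (1 / Real.exp 1) ^ k := by
            rw [one_div, ← Real.exp_neg, ← Real.exp_nat_mul]; congr 1; ring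
          rw [this]
          simp only [div_pow, mul_pow, one_pow]
          ring
      _ ≤ A * Real.exp 1 * (B * (τ / √v)) * (Real.exp 1 * Real.exp (-τ ^ 2 / W)) * 1 ^ k := by
          gcongr
          rw [div_le_one (by positivity)]
          exact hkW
      _ = _ := by rw [he]; ring

/-- A weighted power mean inequality that replaces Minkowski's inequality: after integration it
bounds the `n`-th moment of a sum by the `n`-th power of the sum of the `L^n` norms. -/
theorem add_three_pow_le {x y z A B D : ℝ} (hx : 0 ≤ x) (hy : 0 ≤ y) (hz : 0 ≤ z) (hA : 0 < A)
    (hB : 0 < B) (hD : 0 < D) (n : ℕ) :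
    (x + y + z) ^ n ≤ (A + B + D) ^ n * (A / (A + B + D) * (x / A) ^ n
      + B / (A + B + D) * (y / B) ^ n + D / (A + B + D) * (z / D) ^ n) := by
  have hS : 0 < A + B + D := by positivity
  have h := Real.pow_arith_mean_le_arith_mean_pow (Finset.univ : Finset (Fin 3))
    ![A / (A + B + D), B / (A + B + D), D / (A + B + D)] ![x / A, y / B, z / D]
    (by intro i _; fin_cases i <;> simp <;> positivity)
    (by simp [Fin.sum_univ_three]; field_simp)
    (by intro i _; fin_cases i <;> simp <;> positivity) n
  simp only [Fin.sum_univ_three, Matrix.cons_val_zero, Matrix.cons_val_one, Matrix.cons_val] at h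
  calc (x + y + z) ^ n = (A + B + D) ^ n * (A / (A + B + D) * (x / A) + B / (A + B + D) * (y / B)
        + D / (A + B + D) * (z / D)) ^ n := by
        rw [← mul_pow]; congr 1; field_simp
    _ ≤ _ := by gcongr

/-- The measure of the set where `τ ≤ x + y + z`, for functions with factorial moments of order `2k`
of sizes `A^{2k}`, `B^{2k}` and a function bounded by `D`. -/
theorem measureReal_le_of_moments {α : Type*} [MeasurableSpace α] {μ : Measure α}
    [IsFiniteMeasure μ] {x y z : α → ℝ} {A B D K τ : ℝ} {k : ℕ} (hτ : 0 < τ)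
    (hx : ∀ a, 0 ≤ x a) (hy : ∀ a, 0 ≤ y a) (hz : ∀ a, 0 ≤ z a) (hzD : ∀ a, z a ≤ D)
    (hA : 0 < A) (hB : 0 < B) (hD : 0 < D) (hμ : μ.real Set.univ ≤ K)
    (hxi : Integrable (fun a => x a ^ (2 * k)) μ) (hyi : Integrable (fun a => y a ^ (2 * k)) μ)
    (hxm : ∫ a, x a ^ (2 * k) ∂μ ≤ K * k.factorial * (A ^ 2) ^ k)
    (hym : ∫ a, y a ^ (2 * k) ∂μ ≤ K * k.factorial * (B ^ 2) ^ k) :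
    μ.real {a | τ ≤ x a + y a + z a} ≤ K * k.factorial * ((A + B + D) ^ 2 / τ ^ 2) ^ k := by
  set S := A + B + D with hSdef
  have hS : 0 < S := by positivity
  set g : α → ℝ := fun a => S ^ (2 * k) * (A / S * (x a / A) ^ (2 * k)
      + B / S * (y a / B) ^ (2 * k) + D / S) with hg
  have hgi : Integrable g μ := by
    refine Integrable.const_mul (Integrable.add (Integrable.add ?_ ?_) (integrable_const _)) _
    · simp only [div_pow]; exact (hxi.div_const _).const_mul _
    · simp only [div_pow]; exact (hyi.div_const _).const_mul _
  have hg0 : ∀ a, 0 ≤ g a := fun a => by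
    have := hx a; have := hy a
    simp only [hg]; positivity
  have hsub : {a | τ ≤ x a + y a + z a} ⊆ {a | τ ^ (2 * k) ≤ g a} := by
    intro a ha
    simp only [Set.mem_ofPred_eq] at ha ⊢
    have h1 := add_three_pow_le (hx a) (hy a) (hz a) hA hB hD (2 * k)
    have h2 : (z a / D) ^ (2 * k) ≤ 1 :=
      pow_le_one₀ (div_nonneg (hz a) hD.le) ((div_le_one hD).2 (hzD a))
    calc τ ^ (2 * k) ≤ (x a + y a + z a) ^ (2 * k) := by gcongr
      _ ≤ _ := h1
      _ ≤ S ^ (2 * k) * (A / S * (x a / A) ^ (2 * k)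
            + B / S * (y a / B) ^ (2 * k) + D / S * 1) := by gcongr
      _ = g a := by simp only [hg, mul_one]
  have hmark := mul_meas_ge_le_integral_of_nonneg (ae_of_all μ hg0) hgi (τ ^ (2 * k))
  have hint : ∫ a, g a ∂μ ≤ S ^ (2 * k) * (K * k.factorial) := by
    have e1 : Integrable (fun a => A / S * (x a / A) ^ (2 * k)) μ := by
      simp only [div_pow]; exact (hxi.div_const _).const_mul _
    have e2 : Integrable (fun a => B / S * (y a / B) ^ (2 * k)) μ := by
      simp only [div_pow]; exact (hyi.div_const _).const_mul _
    have e12 : Integrable (fun a => A / S * (x a / A) ^ (2 * k) + B / S * (y a / B) ^ (2 * k)) μ :=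
      e1.add e2
    have hK : 0 ≤ K := measureReal_nonneg.trans hμ
    simp only [hg]
    rw [integral_const_mul, integral_add e12 (integrable_const _), integral_add e1 e2,
      integral_const_mul, integral_const_mul, integral_const]
    simp only [div_pow, integral_div, smul_eq_mul]
    gcongr
    have h1 : (1 : ℝ) ≤ k.factorial := by exact_mod_cast Nat.one_le_iff_ne_zero.2 (Nat.factorial_ne_zero k)
    have hx' : (∫ a, x a ^ (2 * k) ∂μ) / A ^ (2 * k) ≤ K * k.factorial := by
      rw [div_le_iff₀ (by positivity), pow_mul A]; exact hxm
    have hy' : (∫ a, y a ^ (2 * k) ∂μ) / B ^ (2 * k) ≤ K * k.factorial := by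
      rw [div_le_iff₀ (by positivity), pow_mul B]; exact hym
    calc A / S * ((∫ a, x a ^ (2 * k) ∂μ) / A ^ (2 * k))
          + B / S * ((∫ a, y a ^ (2 * k) ∂μ) / B ^ (2 * k)) + μ.real Set.univ * (D / S)
        ≤ A / S * (K * k.factorial) + B / S * (K * k.factorial) + K * k.factorial * (D / S) := by
          gcongr
          nlinarith
      _ = K * k.factorial * (S / S) := by rw [hSdef]; ring
      _ = K * k.factorial := by rw [div_self hS.ne', mul_one]
  have hτk : 0 < τ ^ (2 * k) := by positivity
  calc μ.real {a | τ ≤ x a + y a + z a} ≤ μ.real {a | τ ^ (2 * k) ≤ g a} := measureReal_mono hsub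
    _ ≤ (∫ a, g a ∂μ) / τ ^ (2 * k) := by rw [le_div_iff₀ hτk, mul_comm]; exact hmark
    _ ≤ S ^ (2 * k) * (K * k.factorial) / τ ^ (2 * k) := by gcongr
    _ = _ := by rw [div_pow, pow_mul, pow_mul]; ring

/-! ### Mean values of Dirichlet polynomials -/

theorem norm_integral_cexp_le {T c : ℝ} (hc : c ≠ 0) :
    ‖∫ t in T..2 * T, Complex.exp (((c * t : ℝ) : ℂ) * Complex.I)‖ ≤ 2 / |c| := by
  have hc' : (c : ℂ) * Complex.I ≠ 0 := by simp [hc]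
  have h : ∀ t : ℝ, Complex.exp (((c * t : ℝ) : ℂ) * Complex.I)
      = Complex.exp ((c : ℂ) * Complex.I * t) := fun t => by push_cast; congr 1; ring
  simp_rw [h]
  rw [integral_exp_mul_complex hc', norm_div, norm_mul, Complex.norm_I, mul_one, Complex.norm_real,
    Real.norm_eq_abs]
  gcongr
  refine (norm_sub_le _ _).trans ?_
  rw [← h, ← h, Complex.norm_exp_ofReal_mul_I, Complex.norm_exp_ofReal_mul_I]
  norm_num

theorem one_div_le_abs_log_sub_log {m n : ℕ} {M : ℝ} (hm : 1 ≤ m) (hn : 1 ≤ n) (hmM : m ≤ M)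
    (hnM : n ≤ M) (hmn : m ≠ n) : 1 / M ≤ |Real.log n - Real.log m| := by
  wlog h : m < n generalizing m n
  · rw [abs_sub_comm]
    exact this hn hm hnM hmM hmn.symm (by omega)
  have hm0 : (0 : ℝ) < m := by exact_mod_cast hm
  have hn0 : (0 : ℝ) < n := by exact_mod_cast hn
  rw [← Real.log_div hn0.ne' hm0.ne']
  have h1 := Real.one_sub_inv_le_log_of_pos (div_pos hn0 hm0)
  have h2 : (m : ℝ) + 1 ≤ n := by exact_mod_cast h
  calc 1 / M ≤ 1 / n := by gcongr
    _ ≤ 1 - (n / m : ℝ)⁻¹ := by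
        rw [inv_div, one_sub_div hn0.ne']
        gcongr
        linarith
    _ ≤ Real.log (n / m) := h1
    _ ≤ _ := le_abs_self _

/-- The mean square of a Dirichlet polynomial of length `M ≤ √T`. The frequencies are separated by
`1/M`, so that each off-diagonal term is at most `2M`, which already suffices. -/
theorem integral_norm_sq_dirichletPolynomial_le (S : Finset ℕ) (b : ℕ → ℂ) {M T r : ℝ}
    (hr : 1 ≤ r) (hS : ∀ n ∈ S, 1 ≤ n ∧ (n : ℝ) ≤ M) (hM : 1 ≤ M) (hMT : M ^ 2 ≤ T) :
    ∫ t in T..2 * T, ‖∑ n ∈ S, b n * Complex.exp (((-(r * Real.log n) * t : ℝ) : ℂ) * Complex.I)‖ ^ 2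
      ≤ 3 * T * ∑ n ∈ S, ‖b n‖ ^ 2 := by
  have hT : 0 ≤ T := (sq_nonneg M).trans hMT
  set F : ℝ → ℂ := fun t =>
    ∑ n ∈ S, b n * Complex.exp (((-(r * Real.log n) * t : ℝ) : ℂ) * Complex.I) with hF
  have hexp : ∀ t, ((‖F t‖ ^ 2 : ℝ) : ℂ) = ∑ m ∈ S, ∑ n ∈ S, b m * conj (b n) *
      Complex.exp (((r * (Real.log n - Real.log m) * t : ℝ) : ℂ) * Complex.I) := by
    intro t
    rw [← Complex.normSq_eq_norm_sq, ← Complex.mul_conj]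
    simp only [hF, map_sum, map_mul, Finset.sum_mul_sum]
    refine Finset.sum_congr rfl fun m _ => Finset.sum_congr rfl fun n _ => ?_
    rw [← Complex.exp_conj, map_mul, Complex.conj_I, Complex.conj_ofReal, mul_mul_mul_comm,
      ← Complex.exp_add]
    congr 2
    push_cast
    ring
  have hint : ((∫ t in T..2 * T, ‖F t‖ ^ 2 : ℝ) : ℂ) = ∑ m ∈ S, ∑ n ∈ S, b m * conj (b n) *
      ∫ t in T..2 * T,
        Complex.exp (((r * (Real.log n - Real.log m) * t : ℝ) : ℂ) * Complex.I) := by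
    rw [← intervalIntegral.integral_ofReal]
    simp_rw [hexp]
    rw [intervalIntegral.integral_finsetSum]
    · refine Finset.sum_congr rfl fun m _ => ?_
      rw [intervalIntegral.integral_finsetSum]
      · refine Finset.sum_congr rfl fun n _ => ?_
        rw [intervalIntegral.integral_const_mul]
      · intro n _
        exact (by fun_prop : Continuous _).intervalIntegrable _ _
    · intro n _
      exact (by fun_prop : Continuous _).intervalIntegrable _ _
  have hbound : ∀ m ∈ S, ∀ n ∈ S, ‖b m * conj (b n) * ∫ t in T..2 * T,
        Complex.exp (((r * (Real.log n - Real.log m) * t : ℝ) : ℂ) * Complex.I)‖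
      ≤ (if m = n then T * ‖b m‖ ^ 2 else 0) + 2 * M * (‖b m‖ * ‖b n‖) := by
    intro m hm n hn
    rw [norm_mul, norm_mul, RCLike.norm_conj]
    split_ifs with h
    · subst h
      have : ‖∫ t in T..2 * T, Complex.exp
          (((r * (Real.log m - Real.log m) * t : ℝ) : ℂ) * Complex.I)‖ = T := by
        simp only [sub_self, mul_zero, zero_mul, Complex.ofReal_zero, Complex.exp_zero,
          intervalIntegral.integral_const, norm_smul, norm_one, mul_one, Real.norm_eq_abs]
        rw [abs_of_nonneg (by linarith)]; ring
      rw [this]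
      nlinarith [mul_nonneg (norm_nonneg (b m)) (norm_nonneg (b m))]
    · have h1 := one_div_le_abs_log_sub_log (hS m hm).1 (hS n hn).1 (hS m hm).2 (hS n hn).2 h
      have h0 : 0 < 1 / M := by positivity
      have hc : r * (Real.log n - Real.log m) ≠ 0 := by
        intro h2
        rcases mul_eq_zero.1 h2 with h2 | h2
        · linarith
        · rw [h2, abs_zero] at h1; linarith
      have h3 : 1 / M ≤ |r * (Real.log n - Real.log m)| := by
        rw [abs_mul, abs_of_pos (by linarith : (0 : ℝ) < r)]
        nlinarith
      have h4 := norm_integral_cexp_le (T := T) hc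
      have h5 : 2 / |r * (Real.log n - Real.log m)| ≤ 2 * M := by
        calc 2 / |r * (Real.log n - Real.log m)| ≤ 2 / (1 / M) := by gcongr
          _ = 2 * M := by field_simp
      rw [zero_add, mul_comm (2 * M)]
      gcongr
      exact h4.trans h5
  have hcard : (S.card : ℝ) ≤ M := by
    have : S ⊆ Finset.Icc 1 ⌊M⌋₊ := fun n hn =>
      Finset.mem_Icc.2 ⟨(hS n hn).1, Nat.le_floor (hS n hn).2⟩
    have h := Finset.card_le_card this
    rw [Nat.card_Icc, Nat.add_sub_cancel] at h
    exact (Nat.cast_le.2 h).trans (Nat.floor_le (by linarith))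
  have hnn : 0 ≤ ∑ n ∈ S, ‖b n‖ ^ 2 := by positivity
  calc ∫ t in T..2 * T, ‖F t‖ ^ 2
      ≤ ‖((∫ t in T..2 * T, ‖F t‖ ^ 2 : ℝ) : ℂ)‖ := by
        rw [Complex.norm_real]; exact le_abs_self _
    _ ≤ ∑ m ∈ S, ∑ n ∈ S,
          ((if m = n then T * ‖b m‖ ^ 2 else 0) + 2 * M * (‖b m‖ * ‖b n‖)) := by
        rw [hint]
        exact norm_sum_le_of_le _ fun m hm => norm_sum_le_of_le _ fun n hn => hbound m hm n hn
    _ = T * ∑ n ∈ S, ‖b n‖ ^ 2 + 2 * M * (∑ n ∈ S, ‖b n‖) ^ 2 := by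
        simp only [Finset.sum_add_distrib, Finset.sum_ite_eq, ← Finset.mul_sum]
        rw [sq (∑ n ∈ S, ‖b n‖), Finset.sum_mul_sum, Finset.mul_sum]
        simp only [Finset.mul_sum]
        congr 1
        exact Finset.sum_congr rfl fun m hm => by rw [if_pos hm]
    _ ≤ T * ∑ n ∈ S, ‖b n‖ ^ 2 + 2 * M * (M * ∑ n ∈ S, ‖b n‖ ^ 2) := by
        gcongr
        exact sq_sum_le_card_mul_sum_sq.trans (by gcongr)
    _ ≤ 3 * T * ∑ n ∈ S, ‖b n‖ ^ 2 := by nlinarith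

/-- A product of `k` primes has at most `k!` ordered factorizations. -/
theorem card_filter_prod_primes_le (s : Finset Nat.Primes) (k n : ℕ) :
    ((Fintype.piFinset fun _ : Fin k => s).filter
      fun f => ∏ i, ((f i : Nat.Primes) : ℕ) = n).card ≤ k.factorial := by
  classical
  rcases Finset.eq_empty_or_nonempty ((Fintype.piFinset fun _ : Fin k => s).filter
      fun f => ∏ i, ((f i : Nat.Primes) : ℕ) = n) with h | ⟨f₀, hf₀⟩
  · rw [h]; simp
  have hf₀' := (Finset.mem_filter.1 hf₀).2
  have hinj : Function.Injective
      (fun f : Fin k → Nat.Primes => List.ofFn fun i => ((f i : Nat.Primes) : ℕ)) := by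
    intro f g hfg
    funext i
    exact Subtype.ext (congrFun (List.ofFn_injective hfg) i)
  rw [← Finset.card_image_of_injective _ hinj]
  calc _ ≤ (List.ofFn fun i => ((f₀ i : Nat.Primes) : ℕ)).permutations.toFinset.card := by
        refine Finset.card_le_card fun l hl => ?_
        obtain ⟨f, hf, rfl⟩ := Finset.mem_image.1 hl
        rw [List.mem_toFinset, List.mem_permutations]
        refine perm_of_prod_eq_prod ?_ ?_ ?_
        · rw [List.prod_ofFn, List.prod_ofFn, (Finset.mem_filter.1 hf).2, hf₀']
        · intro p hp
          obtain ⟨i, rfl⟩ := (List.mem_ofFn' _ _).1 hp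
          exact Nat.prime_iff.1 (f i).2
        · intro p hp
          obtain ⟨i, rfl⟩ := (List.mem_ofFn' _ _).1 hp
          exact Nat.prime_iff.1 (f₀ i).2
    _ ≤ _ := List.toFinset_card_le _
    _ = k.factorial := by rw [List.length_permutations, List.length_ofFn]

/-- The moments of a short Dirichlet polynomial supported on primes are at most a constant times
those of a complex Gaussian with the same variance: the `k`-th power is a Dirichlet polynomial of
length `N^k ≤ √T`, and at most `k!` products of coefficients contribute to each of its terms. -/
theorem integral_norm_pow_primePolynomial_le (s : Finset Nat.Primes) (a : Nat.Primes → ℂ)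
    {N T r : ℝ} {k : ℕ} (hr : 1 ≤ r) (hN : 1 ≤ N) (hs : ∀ p ∈ s, ((p : ℕ) : ℝ) ≤ N)
    (hNT : N ^ (2 * k) ≤ T) :
    ∫ t in T..2 * T, ‖∑ p ∈ s, a p *
        Complex.exp (((-(r * Real.log (p : ℕ)) * t : ℝ) : ℂ) * Complex.I)‖ ^ (2 * k)
      ≤ 3 * T * k.factorial * (∑ p ∈ s, ‖a p‖ ^ 2) ^ k := by
  classical
  set P := Fintype.piFinset fun _ : Fin k => s with hP
  set ν : (Fin k → Nat.Primes) → ℕ := fun f => ∏ i, ((f i : Nat.Primes) : ℕ) with hν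
  set b : ℕ → ℂ := fun n => ∑ f ∈ P with ν f = n, ∏ i, a (f i) with hb
  have hT : 0 ≤ T := le_trans (by positivity) hNT
  have hpow : ∀ t : ℝ, (∑ p ∈ s, a p *
        Complex.exp (((-(r * Real.log (p : ℕ)) * t : ℝ) : ℂ) * Complex.I)) ^ k
      = ∑ n ∈ P.image ν, b n *
        Complex.exp (((-(r * Real.log n) * t : ℝ) : ℂ) * Complex.I) := by
    intro t
    have h1 : (∑ p ∈ s, a p *
        Complex.exp (((-(r * Real.log (p : ℕ)) * t : ℝ) : ℂ) * Complex.I)) ^ k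
        = ∑ f ∈ P, (∏ i, a (f i)) *
          Complex.exp (((-(r * Real.log (ν f)) * t : ℝ) : ℂ) * Complex.I) := by
      have h2 := Finset.prod_univ_sum (fun _ : Fin k => s) (fun _ p => a p *
        Complex.exp (((-(r * Real.log (p : ℕ)) * t : ℝ) : ℂ) * Complex.I))
      rw [Finset.prod_const, Finset.card_univ, Fintype.card_fin] at h2
      rw [h2]
      refine Finset.sum_congr rfl fun f _ => ?_
      rw [Finset.prod_mul_distrib, ← Complex.exp_sum]
      rw [← Finset.sum_mul, ← Complex.ofReal_sum]
      have : Real.log (ν f) = ∑ i, Real.log (f i : ℕ) := by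
        simp only [hν, Nat.cast_prod]
        exact Real.log_prod fun i _ => by exact_mod_cast (f i).2.ne_zero
      rw [this, Finset.mul_sum, ← Finset.sum_neg_distrib, Finset.sum_mul]
    rw [h1, ← Finset.sum_fiberwise_of_maps_to (fun f hf => Finset.mem_image_of_mem ν hf)]
    refine Finset.sum_congr rfl fun n _ => ?_
    rw [hb, Finset.sum_mul]
    exact Finset.sum_congr rfl fun f hf => by rw [(Finset.mem_filter.1 hf).2]
  have hsq : ∀ t : ℝ, ‖∑ p ∈ s, a p *
        Complex.exp (((-(r * Real.log (p : ℕ)) * t : ℝ) : ℂ) * Complex.I)‖ ^ (2 * k)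
      = ‖∑ n ∈ P.image ν, b n *
        Complex.exp (((-(r * Real.log n) * t : ℝ) : ℂ) * Complex.I)‖ ^ 2 := fun t => by
    rw [← hpow t, norm_pow, mul_comm 2 k, pow_mul]
  simp_rw [hsq]
  refine (integral_norm_sq_dirichletPolynomial_le (M := N ^ k) (T := T) _ b hr ?_
    (one_le_pow₀ hN) (by rwa [← pow_mul, mul_comm])).trans ?_
  · intro n hn
    obtain ⟨f, hf, rfl⟩ := Finset.mem_image.1 hn
    refine ⟨Finset.one_le_prod' fun i _ => (f i).2.one_lt.le, ?_⟩
    simp only [hν]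
    push_cast
    calc ∏ i, ((f i : ℕ) : ℝ) ≤ ∏ i : Fin k, N :=
          Finset.prod_le_prod (fun i _ => by positivity)
            fun i _ => hs _ (Fintype.mem_piFinset.1 hf i)
      _ = N ^ k := by simp
  · rw [mul_assoc (3 * T)]
    refine mul_le_mul_of_nonneg_left ?_ (by positivity)
    calc ∑ n ∈ P.image ν, ‖b n‖ ^ 2
        ≤ ∑ n ∈ P.image ν, k.factorial * ∑ f ∈ P with ν f = n, ∏ i, ‖a (f i)‖ ^ 2 := by
          refine Finset.sum_le_sum fun n _ => ?_
          calc ‖b n‖ ^ 2 ≤ (∑ f ∈ P with ν f = n, ‖∏ i, a (f i)‖) ^ 2 := by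
                gcongr; exact norm_sum_le _ _
            _ ≤ ((P.filter fun f => ν f = n).card : ℝ) *
                  ∑ f ∈ P with ν f = n, ‖∏ i, a (f i)‖ ^ 2 := sq_sum_le_card_mul_sum_sq
            _ ≤ _ := by
                gcongr with f hf
                · exact card_filter_prod_primes_le s k n
                · rw [norm_prod, Finset.prod_pow]
      _ = k.factorial * (∑ p ∈ s, ‖a p‖ ^ 2) ^ k := by
          rw [← Finset.mul_sum, Finset.sum_fiberwise_of_maps_to
            (fun f hf => Finset.mem_image_of_mem ν hf)]
          congr 1
          have h2 := Finset.prod_univ_sum (fun _ : Fin k => s) (fun _ p => ‖a p‖ ^ 2)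
          rw [Finset.prod_const, Finset.card_univ, Fintype.card_fin] at h2
          exact h2.symm

/-! ### Moments of sums of independent uniform variables on the circle -/

namespace IsUniformCircleSequence

variable {Ω : Type*} [MeasurableSpace Ω] {Pr : Measure Ω} {X : Nat.Primes → Ω → ℂ}

theorem measurable_circleMap :
    Measurable (fun x : ℝ => Complex.exp (2 * Real.pi * x * Complex.I)) := by fun_prop

theorem integral_comp (h : IsUniformCircleSequence X Pr) (p : Nat.Primes) {f : ℂ → ℂ}
    (hf : Continuous f) : ∫ ω, f (X p ω) ∂Pr
      = ∫ x in (0 : ℝ)..1, f (Complex.exp (2 * Real.pi * x * Complex.I)) := by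
  rw [← integral_map (h.measurable p).aemeasurable hf.aestronglyMeasurable, h.law p,
    uniformOnCircle, integral_map measurable_circleMap.aemeasurable hf.aestronglyMeasurable,
    intervalIntegral.integral_of_le zero_le_one]

theorem ae_norm_eq_one (h : IsUniformCircleSequence X Pr) (p : Nat.Primes) :
    ∀ᵐ ω ∂Pr, ‖X p ω‖ = 1 := by
  have h1 : ∀ᵐ z ∂(Pr.map (X p)), ‖z‖ = 1 := by
    rw [h.law p, uniformOnCircle, ae_map_iff measurable_circleMap.aemeasurable
      (measurableSet_eq_fun measurable_norm measurable_const)]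
    refine ae_of_all _ fun x => ?_
    have : (2 * Real.pi * x * Complex.I : ℂ) = ((2 * Real.pi * x : ℝ) : ℂ) * Complex.I := by
      push_cast; ring
    rw [this, Complex.norm_exp_ofReal_mul_I]
  exact ae_of_ae_map (h.measurable p).aemeasurable h1

theorem integral_cexp_two_pi_mul {n : ℤ} (hn : n ≠ 0) :
    ∫ x in (0 : ℝ)..1, Complex.exp (2 * Real.pi * n * Complex.I * x) = 0 := by
  have hc : (2 * Real.pi * n * Complex.I : ℂ) ≠ 0 := by
    simp [hn, Real.pi_ne_zero]
  rw [integral_exp_mul_complex hc]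
  have : (2 * Real.pi * n * Complex.I * (1 : ℝ) : ℂ) = n * (2 * Real.pi * Complex.I) := by
    push_cast; ring
  rw [this, Complex.exp_int_mul_two_pi_mul_I]
  simp

/-- Orthogonality of the powers of a uniform variable on the circle. -/
theorem integral_pow_mul_conj_pow (h : IsUniformCircleSequence X Pr) (p : Nat.Primes) (m n : ℕ) :
    ∫ ω, X p ω ^ m * conj (X p ω) ^ n ∂Pr = if m = n then 1 else 0 := by
  rw [h.integral_comp p (f := fun z => z ^ m * conj z ^ n) (by fun_prop)]
  have h1 : ∀ x : ℝ, Complex.exp (2 * Real.pi * x * Complex.I) ^ m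
      * conj (Complex.exp (2 * Real.pi * x * Complex.I)) ^ n
      = Complex.exp (2 * Real.pi * ((m - n : ℤ) : ℂ) * Complex.I * x) := by
    intro x
    rw [← Complex.exp_conj, ← Complex.exp_nat_mul, ← Complex.exp_nat_mul, ← Complex.exp_add]
    congr 1
    simp only [map_mul, Complex.conj_I, Complex.conj_ofReal, map_ofNat]
    push_cast
    ring
  simp_rw [h1]
  split_ifs with hmn
  · simp [hmn]
  · exact integral_cexp_two_pi_mul (by omega)

theorem integral_pow_succ (h : IsUniformCircleSequence X Pr) (p : Nat.Primes) (n : ℕ) :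
    ∫ ω, X p ω ^ (n + 1) ∂Pr = 0 := by
  simpa using h.integral_pow_mul_conj_pow p (n + 1) 0

theorem ae_norm_sum_le (h : IsUniformCircleSequence X Pr) (s : Finset Nat.Primes)
    (a : Nat.Primes → ℂ) (r : ℕ) :
    ∀ᵐ ω ∂Pr, ‖∑ p ∈ s, a p * X p ω ^ r‖ ≤ ∑ p ∈ s, ‖a p‖ := by
  filter_upwards [ae_all_iff.2 h.ae_norm_eq_one] with ω hω
  exact norm_sum_le_of_le _ fun p _ => by rw [norm_mul, norm_pow, hω p, one_pow, mul_one]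

theorem measurable_sum (h : IsUniformCircleSequence X Pr) (s : Finset Nat.Primes)
    (a : Nat.Primes → ℂ) (r : ℕ) : Measurable fun ω => ∑ p ∈ s, a p * X p ω ^ r :=
  Finset.measurable_sum _ fun p _ => ((h.measurable p).pow_const r).const_mul _

theorem integrable_norm_sum_pow [IsProbabilityMeasure Pr] (h : IsUniformCircleSequence X Pr)
    (s : Finset Nat.Primes) (a : Nat.Primes → ℂ) (r n : ℕ) :
    Integrable (fun ω => ‖∑ p ∈ s, a p * X p ω ^ r‖ ^ n) Pr := by
  refine Integrable.of_bound ((h.measurable_sum s a r).norm.pow_const n).aestronglyMeasurable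
    ((∑ p ∈ s, ‖a p‖) ^ n) ?_
  filter_upwards [h.ae_norm_sum_le s a r] with ω hω
  rw [norm_pow, norm_norm]
  gcongr

/-- The moments of a sum of independent uniform variables on the circle with coefficients `a p` are
at most those of a complex Gaussian with the same variance. When a variable is added, only the
diagonal terms of the expanded moment survive, and `k.choose i * i! ≤ k!`. -/
theorem integral_norm_sum_pow_le [IsProbabilityMeasure Pr] (h : IsUniformCircleSequence X Pr)
    (s : Finset Nat.Primes) (a : Nat.Primes → ℂ) {r : ℕ} (hr : r ≠ 0) (k : ℕ) :
    ∫ ω, ‖∑ p ∈ s, a p * X p ω ^ r‖ ^ (2 * k) ∂Pr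
      ≤ k.factorial * (∑ p ∈ s, ‖a p‖ ^ 2) ^ k := by
  classical
  induction s using Finset.induction_on generalizing k with
  | empty =>
    rcases eq_or_ne k 0 with rfl | hk
    · simp
    · simp [hk]
  | insert q s hq ih =>
    set S : Ω → ℂ := fun ω => ∑ p ∈ s, a p * X p ω ^ r with hS
    set V := ∑ p ∈ s, ‖a p‖ ^ 2 with hV
    have hSm : Measurable S := h.measurable_sum s a r
    have hind : IndepFun S (X q) Pr := by
      have h1 := h.indep.indepFun_finset s {q} (Finset.disjoint_singleton_right.2 hq) h.measurable
      have h2 := h1.comp (φ := fun x : s → ℂ => ∑ p : s, a p * x p ^ r)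
        (ψ := fun x : ({q} : Finset Nat.Primes) → ℂ => x ⟨q, Finset.mem_singleton_self q⟩)
        (by fun_prop) (measurable_pi_apply (X := fun _ : ({q} : Finset Nat.Primes) => ℂ) ⟨q, _⟩)
      convert h2 using 1
      · funext ω
        exact (Finset.sum_coe_sort s (fun p => a p * X p ω ^ r)).symm
      · rfl
    have hterm : ∀ i j m n : ℕ, ∫ ω, (S ω ^ i * conj (S ω) ^ j) * (X q ω ^ m * conj (X q ω) ^ n) ∂Pr
        = (∫ ω, S ω ^ i * conj (S ω) ^ j ∂Pr) * (if m = n then 1 else 0) := by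
      intro i j m n
      have h1 := hind.comp (φ := fun z : ℂ => z ^ i * conj z ^ j)
        (ψ := fun z : ℂ => z ^ m * conj z ^ n)
        (by fun_prop : Continuous fun z : ℂ => z ^ i * conj z ^ j).measurable
        (by fun_prop : Continuous fun z : ℂ => z ^ m * conj z ^ n).measurable
      have h2 := h1.integral_mul_eq_mul_integral
        ((by fun_prop : Continuous fun z : ℂ => z ^ i * conj z ^ j).measurable.comp
          hSm).aestronglyMeasurable
        ((by fun_prop : Continuous fun z : ℂ => z ^ m * conj z ^ n).measurable.comp
          (h.measurable q)).aestronglyMeasurable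
      simp only [Pi.mul_apply, Function.comp] at h2
      rw [← h.integral_pow_mul_conj_pow q m n]
      exact h2
    have hinteg : ∀ i j m n : ℕ,
        Integrable (fun ω => (S ω ^ i * conj (S ω) ^ j) * (X q ω ^ m * conj (X q ω) ^ n)) Pr := by
      intro i j m n
      refine Integrable.of_bound (C := (∑ p ∈ s, ‖a p‖) ^ i * (∑ p ∈ s, ‖a p‖) ^ j)
        (((by fun_prop : Continuous fun z : ℂ => z ^ i * conj z ^ j).measurable.comp
          hSm).mul ((by fun_prop : Continuous fun z : ℂ => z ^ m * conj z ^ n).measurable.comp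
          (h.measurable q))).aestronglyMeasurable ?_
      filter_upwards [h.ae_norm_sum_le s a r, h.ae_norm_eq_one q] with ω h1 h2
      simp only [norm_mul, norm_pow, RCLike.norm_conj, h2, one_pow, mul_one]
      have h1' : ‖S ω‖ ≤ ∑ p ∈ s, ‖a p‖ := h1
      gcongr
    have hsum : ∀ ω, ∑ p ∈ insert q s, a p * X p ω ^ r = S ω + a q * X q ω ^ r := fun ω => by
      rw [Finset.sum_insert hq, add_comm]
    have hexp : ∀ ω, ((‖∑ p ∈ insert q s, a p * X p ω ^ r‖ ^ (2 * k) : ℝ) : ℂ)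
        = ∑ i ∈ Finset.range (k + 1), ∑ j ∈ Finset.range (k + 1),
          ((k.choose i : ℂ) * (k.choose j) * a q ^ (k - i) * conj (a q) ^ (k - j)) *
          ((S ω ^ i * conj (S ω) ^ j) *
            (X q ω ^ (r * (k - i)) * conj (X q ω) ^ (r * (k - j)))) := by
      intro ω
      rw [pow_mul, ← Complex.normSq_eq_norm_sq, Complex.ofReal_pow, ← Complex.mul_conj, mul_pow,
        hsum, map_add, add_pow, add_pow, Finset.sum_mul_sum]
      refine Finset.sum_congr rfl fun i _ => Finset.sum_congr rfl fun j _ => ?_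
      simp only [map_mul, map_pow, mul_pow, pow_mul]
      ring
    have hnorm : ∀ i, ∫ ω, S ω ^ i * conj (S ω) ^ i ∂Pr = ((∫ ω, ‖S ω‖ ^ (2 * i) ∂Pr : ℝ) : ℂ) := by
      intro i
      rw [← integral_complex_ofReal]
      refine integral_congr_ae (ae_of_all _ fun ω => ?_)
      simp only
      rw [← mul_pow, Complex.mul_conj, Complex.normSq_eq_norm_sq, ← Complex.ofReal_pow, ← pow_mul]
    have hkey : ∫ ω, ‖∑ p ∈ insert q s, a p * X p ω ^ r‖ ^ (2 * k) ∂Pr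
        = ∑ i ∈ Finset.range (k + 1), (k.choose i : ℝ) ^ 2 * (‖a q‖ ^ 2) ^ (k - i) *
          ∫ ω, ‖S ω‖ ^ (2 * i) ∂Pr := by
      rw [← Complex.ofReal_inj, ← integral_complex_ofReal]
      simp_rw [hexp]
      rw [integral_finsetSum _ fun i _ => integrable_finsetSum _ fun j _ =>
        (hinteg _ _ _ _).const_mul _]
      push_cast
      refine Finset.sum_congr rfl fun i hi => ?_
      rw [integral_finsetSum _ fun j _ => (hinteg _ _ _ _).const_mul _]
      simp_rw [integral_const_mul, hterm]
      rw [Finset.sum_eq_single i]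
      · rw [if_pos rfl, hnorm, mul_one, mul_assoc ((k.choose i : ℂ) * _), ← mul_pow,
          Complex.mul_conj, Complex.normSq_eq_norm_sq]
        push_cast
        ring
      · intro j hj hji
        rw [if_neg, mul_zero, mul_zero]
        intro h3
        have := Nat.eq_of_mul_eq_mul_left (Nat.pos_of_ne_zero hr) h3
        rw [Finset.mem_range] at hi hj
        omega
      · intro h3; exact absurd hi h3
    rw [hkey, Finset.sum_insert hq, add_comm (‖a q‖ ^ 2), add_pow, Finset.mul_sum]
    refine Finset.sum_le_sum fun i hi => ?_
    have hfac : (k.choose i : ℝ) * i.factorial ≤ k.factorial := by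
      have h1 := Nat.choose_mul_factorial_mul_factorial (Nat.lt_succ_iff.1 (Finset.mem_range.1 hi))
      have h2 : k.choose i * i.factorial ≤ k.factorial := by
        rw [← h1]
        exact Nat.le_mul_of_pos_right _ (Nat.factorial_pos _)
      exact_mod_cast h2
    calc (k.choose i : ℝ) ^ 2 * (‖a q‖ ^ 2) ^ (k - i) * ∫ ω, ‖S ω‖ ^ (2 * i) ∂Pr
        ≤ (k.choose i : ℝ) ^ 2 * (‖a q‖ ^ 2) ^ (k - i) * (i.factorial * V ^ i) := by
          gcongr
          exact ih i
      _ = (k.choose i * i.factorial) * (V ^ i * (‖a q‖ ^ 2) ^ (k - i) * k.choose i) := by ring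
      _ ≤ k.factorial * (V ^ i * (‖a q‖ ^ 2) ^ (k - i) * k.choose i) := by gcongr

end IsUniformCircleSequence

/-! ### Sums over primes and prime powers of the coefficients -/

theorem mem_primesUpTo {x : ℝ} {p : Nat.Primes} (hx : 0 ≤ x) :
    p ∈ primesUpTo x ↔ ((p : ℕ) : ℝ) ≤ x := by
  exact Finset.mem_subtype.trans (by rw [Finset.mem_range, Nat.lt_succ_iff, Nat.le_floor_iff hx])

theorem Nat.Primes.cast_pos (p : Nat.Primes) : (0 : ℝ) < ((p : ℕ) : ℝ) := by
  exact_mod_cast p.2.pos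

theorem Nat.Primes.two_le_cast (p : Nat.Primes) : (2 : ℝ) ≤ ((p : ℕ) : ℝ) := by
  exact_mod_cast p.2.two_le

/-- Partial summation: an averaged bound `O(x^r)` makes the Dirichlet series absolutely convergent
beyond `r`. -/
theorem summable_mul_rpow_of_isBigO {b : Nat.Primes → ℝ} (hb : ∀ p, 0 ≤ b p) {r c : ℝ} (hr : 0 ≤ r)
    (hrc : r < c) (hO : (fun x : ℝ => ∑ p ∈ primesUpTo x, b p) =O[atTop] fun x : ℝ => x ^ r) :
    Summable fun p : Nat.Primes => b p * ((p : ℕ) : ℝ) ^ (-c) := by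
  classical
  set f : ℕ → ℝ := fun n => if h : n.Prime then b ⟨n, h⟩ else 0 with hf
  have hfp : ∀ p : Nat.Primes, f p = b p := fun p => dif_pos p.2
  have hfn : ∀ n, ¬ n.Prime → f n = 0 := fun n hn => dif_neg hn
  have hf0 : ∀ n, 0 ≤ f n := by
    intro n
    by_cases hn : n.Prime
    · exact (hfp ⟨n, hn⟩).symm ▸ hb _
    · exact (hfn n hn).ge
  have hsum : ∀ n : ℕ, ∑ k ∈ Finset.Icc 1 n, f k = ∑ p ∈ primesUpTo (n : ℝ), b p := by
    intro n
    rw [← Finset.sum_congr rfl fun p _ => hfp p, ← Finset.sum_image (f := f)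
      (g := fun p : Nat.Primes => (p : ℕ)) (fun p _ q _ h => Nat.Primes.coe_nat_injective h)]
    symm
    refine Finset.sum_subset (fun k hk => ?_) fun k hk hk' => hfn k fun hp => hk' ?_
    · obtain ⟨p, hp, rfl⟩ := Finset.mem_image.1 hk
      rw [mem_primesUpTo n.cast_nonneg] at hp
      exact Finset.mem_Icc.2 ⟨p.2.one_lt.le, by exact_mod_cast hp⟩
    · refine Finset.mem_image.2 ⟨⟨k, hp⟩, (mem_primesUpTo n.cast_nonneg).2 ?_, rfl⟩
      exact Nat.cast_le.2 (Finset.mem_Icc.1 hk).2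
  have hL := LSeriesSummable_of_sum_norm_bigO_and_nonneg (f := f) (r := r) (s := (c : ℂ))
    (by simp_rw [hsum]; exact hO.comp_tendsto tendsto_natCast_atTop_atTop) hf0 hr
    (by simpa using hrc)
  have h2 := hL.norm.comp_injective (i := fun p : Nat.Primes => (p : ℕ))
    Nat.Primes.coe_nat_injective
  refine h2.congr fun p : Nat.Primes => ?_
  simp only [Function.comp, LSeries.norm_term_eq, p.2.ne_zero, if_false, Complex.norm_real,
    Complex.ofReal_re, hfp, Real.norm_eq_abs, abs_of_nonneg (hb p)]
  rw [Real.rpow_neg p.cast_pos.le, div_eq_mul_inv]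

namespace LFunctionFamily

variable {J : ℕ} (F : LFunctionFamily J) (j : Fin J)

theorem summable_norm_sq_root {c : ℝ} (hc : 1 < c) :
    Summable fun p : Nat.Primes => (∑ i, ‖F.α j i p‖ ^ 2) * ((p : ℕ) : ℝ) ^ (-c) :=
  summable_mul_rpow_of_isBigO (fun p => by positivity) (by linarith) (by linarith)
    (F.ramanujan_on_average j ((c - 1) / 2) (by linarith))

theorem summable_norm_root {c : ℝ} (hc : 1 < c) :
    Summable fun p : Nat.Primes => (∑ i, ‖F.α j i p‖) * ((p : ℕ) : ℝ) ^ (-c) := by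
  have h1 : Summable fun p : Nat.Primes => ((p : ℕ) : ℝ) ^ (-c) :=
    Nat.Primes.summable_rpow.2 (by linarith)
  refine Summable.of_nonneg_of_le (fun p => by positivity) (fun p => ?_)
    ((h1.mul_left (F.d : ℝ)).add (F.summable_norm_sq_root j hc))
  rw [← add_mul]
  gcongr
  calc ∑ i, ‖F.α j i p‖ ≤ ∑ i, (1 + ‖F.α j i p‖ ^ 2) := by
        gcongr with i
        nlinarith [norm_nonneg (F.α j i p)]
    _ = _ := by rw [Finset.sum_add_distrib]; simp

theorem norm_primePowerCoeff_le (p : Nat.Primes) (k : ℕ) :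
    ‖primePowerCoeff (F.α j) p (k + 1)‖ ≤ ∑ i, ‖F.α j i p‖ ^ (k + 1) := by
  rw [primePowerCoeff, norm_mul]
  have h1 : ‖(1 / ((k + 1 : ℕ) : ℂ))‖ ≤ 1 := by
    rw [norm_div, norm_one, Complex.norm_natCast]
    exact (div_le_one (by positivity)).2 (by norm_cast; omega)
  calc _ ≤ 1 * ∑ i, ‖F.α j i p‖ ^ (k + 1) := by
        gcongr
        exact norm_sum_le_of_le _ fun i _ => by rw [norm_pow]
    _ = _ := one_mul _

theorem norm_primePowerCoeff_one_le (p : Nat.Primes) :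
    ‖primePowerCoeff (F.α j) p 1‖ ≤ ∑ i, ‖F.α j i p‖ := by
  simpa using F.norm_primePowerCoeff_le j p 0

/-- Two of the `k + 2` factors are kept for the Ramanujan hypothesis on average, the others are
estimated by the bound for the roots. -/
theorem norm_primePowerCoeff_add_two_le {θ : ℝ}
    (hθ : ∀ j i p, ‖F.α j i p‖ ≤ ((p : ℕ) : ℝ) ^ θ) (p : Nat.Primes) (k : ℕ) :
    ‖primePowerCoeff (F.α j) p (k + 2)‖
      ≤ (∑ i, ‖F.α j i p‖ ^ 2) * ((p : ℕ) : ℝ) ^ (θ * k) := by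
  refine (F.norm_primePowerCoeff_le j p (k + 1)).trans ?_
  rw [Finset.sum_mul]
  refine Finset.sum_le_sum fun i _ => ?_
  rw [add_assoc, add_comm k, pow_add, Real.rpow_mul_natCast p.cast_pos.le]
  gcongr
  exact hθ j i p

theorem summable_primePowerCoeff {c : ℝ} (hc : 1 < c) :
    Summable fun x : Nat.Primes × ℕ => ‖primePowerCoeff (F.α j) x.1 (x.2 + 1)‖ *
      ((x.1 : ℕ) : ℝ) ^ (-((x.2 + 1) * c)) := by
  obtain ⟨θ, hθ0, hθ, hα⟩ := F.root_bound
  set η : ℝ := (2 : ℝ) ^ (-(1 / 2 : ℝ)) with hη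
  have hη1 : η < 1 := Real.rpow_lt_one_of_one_lt_of_neg (by norm_num) (by norm_num)
  have hη0 : 0 < η := by positivity
  have hsum := ((F.summable_norm_root j hc).add
    ((F.summable_norm_sq_root j hc).mul_left η⁻¹)).mul_of_nonneg
    (summable_geometric_of_lt_one hη0.le hη1)
    (fun p => by positivity) (fun k => by positivity)
  refine Summable.of_nonneg_of_le (fun x => by positivity) (fun x => ?_) hsum
  obtain ⟨p, k⟩ := x
  simp only
  have hp := p.two_le_cast
  have hp0 := p.cast_pos
  rcases k with _ | k
  · simp only [Nat.cast_zero, zero_add, one_mul, pow_zero, mul_one]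
    have := F.norm_primePowerCoeff_one_le j p
    have h2 : 0 ≤ η⁻¹ * ((∑ i, ‖F.α j i p‖ ^ 2) * ((p : ℕ) : ℝ) ^ (-c)) := by positivity
    calc _ ≤ (∑ i, ‖F.α j i p‖) * ((p : ℕ) : ℝ) ^ (-c) := by gcongr
      _ ≤ _ := by linarith
  · have h1 := F.norm_primePowerCoeff_add_two_le j hα p k
    have h3 : ((p : ℕ) : ℝ) ^ (θ * k) * ((p : ℕ) : ℝ) ^ (-(((k + 1 : ℕ) + 1) * c))
        ≤ η⁻¹ * ((p : ℕ) : ℝ) ^ (-c) * η ^ (k + 1) := by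
      rw [← Real.rpow_add hp0]
      have e1 : θ * k + -(((k + 1 : ℕ) + 1) * c) ≤ -c + -(1 / 2) * k := by
        push_cast
        have : (k : ℝ) ≥ 0 := by positivity
        nlinarith
      calc _ ≤ ((p : ℕ) : ℝ) ^ (-c + -(1 / 2) * (k : ℝ)) :=
            Real.rpow_le_rpow_of_exponent_le (by linarith) e1
        _ = ((p : ℕ) : ℝ) ^ (-c) * (((p : ℕ) : ℝ) ^ (-(1 / 2 : ℝ))) ^ k := by
            rw [Real.rpow_add hp0, Real.rpow_mul_natCast hp0.le]
        _ ≤ ((p : ℕ) : ℝ) ^ (-c) * η ^ k := by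
            gcongr ?_ * ?_ ^ _
            exact Real.rpow_le_rpow_of_nonpos (by norm_num) hp (by norm_num)
        _ = _ := by rw [pow_succ]; field_simp
    calc _ ≤ ((∑ i, ‖F.α j i p‖ ^ 2) * ((p : ℕ) : ℝ) ^ (θ * k)) *
            ((p : ℕ) : ℝ) ^ (-(((k + 1 : ℕ) + 1) * c)) := by gcongr
      _ = (∑ i, ‖F.α j i p‖ ^ 2) * (((p : ℕ) : ℝ) ^ (θ * k) *
            ((p : ℕ) : ℝ) ^ (-(((k + 1 : ℕ) + 1) * c))) := by ring
      _ ≤ (∑ i, ‖F.α j i p‖ ^ 2) * (η⁻¹ * ((p : ℕ) : ℝ) ^ (-c) * η ^ (k + 1)) := by gcongr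
      _ = η⁻¹ * ((∑ i, ‖F.α j i p‖ ^ 2) * ((p : ℕ) : ℝ) ^ (-c)) * η ^ (k + 1) := by ring
      _ ≤ _ := by
        gcongr
        have : 0 ≤ (∑ i, ‖F.α j i p‖) * ((p : ℕ) : ℝ) ^ (-c) := by positivity
        linarith

/-- The cubes and higher powers of the primes contribute an absolutely convergent series on the
critical line. -/
theorem summable_primePowerCoeff_add_three :
    Summable fun x : Nat.Primes × ℕ => ‖primePowerCoeff (F.α j) x.1 (x.2 + 3)‖ *
      ((x.1 : ℕ) : ℝ) ^ (-((x.2 + 3) * (1 / 2 : ℝ))) := by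
  obtain ⟨θ, hθ0, hθ, hα⟩ := F.root_bound
  set δ : ℝ := 1 / 2 - θ with hδ
  have hδ0 : 0 < δ := by linarith
  set η : ℝ := (2 : ℝ) ^ (-δ) with hη
  have hη1 : η < 1 := Real.rpow_lt_one_of_one_lt_of_neg (by norm_num) (by linarith)
  have hη0 : 0 < η := by positivity
  have hsum := (F.summable_norm_sq_root j (c := 1 + δ) (by linarith)).mul_of_nonneg
    (summable_geometric_of_lt_one hη0.le hη1)
    (fun p => by positivity) (fun k => by positivity)
  refine Summable.of_nonneg_of_le (fun x => by positivity) (fun x => ?_) hsum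
  obtain ⟨p, k⟩ := x
  simp only
  have hp := p.two_le_cast
  have hp0 := p.cast_pos
  have h1 := F.norm_primePowerCoeff_add_two_le j hα p (k + 1)
  have h3 : ((p : ℕ) : ℝ) ^ (θ * (k + 1 : ℕ)) * ((p : ℕ) : ℝ) ^ (-((k + 3) * (1 / 2 : ℝ)))
      ≤ ((p : ℕ) : ℝ) ^ (-(1 + δ)) * η ^ k := by
    rw [← Real.rpow_add hp0]
    have e1 : θ * (k + 1 : ℕ) + -((k + 3) * (1 / 2 : ℝ)) = -(1 + δ) + -δ * k := by
      push_cast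
      rw [hδ]; ring
    rw [e1, Real.rpow_add hp0, Real.rpow_mul_natCast hp0.le]
    gcongr ?_ * ?_ ^ _
    exact Real.rpow_le_rpow_of_nonpos (by norm_num) hp (by linarith)
  calc _ ≤ ((∑ i, ‖F.α j i p‖ ^ 2) * ((p : ℕ) : ℝ) ^ (θ * (k + 1 : ℕ))) *
          ((p : ℕ) : ℝ) ^ (-((k + 3) * (1 / 2 : ℝ))) := by gcongr
    _ = (∑ i, ‖F.α j i p‖ ^ 2) * (((p : ℕ) : ℝ) ^ (θ * (k + 1 : ℕ)) *
          ((p : ℕ) : ℝ) ^ (-((k + 3) * (1 / 2 : ℝ)))) := by ring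
    _ ≤ (∑ i, ‖F.α j i p‖ ^ 2) * (((p : ℕ) : ℝ) ^ (-(1 + δ)) * η ^ k) := by gcongr
    _ = _ := by ring

/-- The variance of the contribution of the squares of the primes converges on the critical
line. -/
theorem summable_sq_primePowerCoeff_two :
    Summable fun p : Nat.Primes =>
      ‖primePowerCoeff (F.α j) p 2‖ ^ 2 * ((p : ℕ) : ℝ) ^ (-2 : ℝ) := by
  obtain ⟨θ, hθ0, hθ, hα⟩ := F.root_bound
  refine Summable.of_nonneg_of_le (fun x => by positivity) (fun p => ?_)
    ((F.summable_norm_sq_root j (c := 2 - 2 * θ) (by linarith)).mul_left (F.d : ℝ))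
  have h1 : ‖primePowerCoeff (F.α j) p 2‖ ≤ ∑ i, ‖F.α j i p‖ ^ 2 := by
    simpa using F.norm_primePowerCoeff_add_two_le j hα p 0
  have h2 : ∑ i, ‖F.α j i p‖ ^ 2 ≤ F.d * ((p : ℕ) : ℝ) ^ (2 * θ) := by
    calc ∑ i, ‖F.α j i p‖ ^ 2 ≤ ∑ i : Fin F.d, (((p : ℕ) : ℝ) ^ θ) ^ 2 := by
          gcongr with i; exact hα j i p
      _ = _ := by
          rw [mul_comm 2 θ, Real.rpow_mul p.cast_pos.le]
          simp
  have h3 : ((p : ℕ) : ℝ) ^ (-(2 - 2 * θ)) = ((p : ℕ) : ℝ) ^ (2 * θ) * ((p : ℕ) : ℝ) ^ (-2 : ℝ) := by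
    rw [← Real.rpow_add p.cast_pos]; congr 1; ring
  rw [h3]
  calc _ ≤ (∑ i, ‖F.α j i p‖ ^ 2) * (F.d * ((p : ℕ) : ℝ) ^ (2 * θ)) * ((p : ℕ) : ℝ) ^ (-2 : ℝ) := by
        rw [sq]; gcongr; exact h1.trans h2
    _ = _ := by ring

/-- The sum `∑_{p ≤ x} |β(p)|² / p` of the orthonormality relation. -/
noncomputable def coeffVariance (x : ℝ) : ℝ :=
  ∑ p ∈ primesUpTo x, ‖primePowerCoeff (F.α j) p 1‖ ^ 2 / ((p : ℕ) : ℝ)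

/-- The orthonormality relation for `j = k`, with the error term weakened to `O(1)`. -/
theorem exists_abs_coeffVariance_sub_le : ∃ K x₀ : ℝ, 0 ≤ K ∧ 1 ≤ x₀ ∧ ∀ x, x₀ ≤ x →
    |F.coeffVariance j x - F.ξ j * Real.log (Real.log x)| ≤ K := by
  obtain ⟨c, hc⟩ := F.orthonormality j j
  obtain ⟨A, hA⟩ := hc.bound
  obtain ⟨x₁, hx₁⟩ := eventually_atTop.1 hA
  refine ⟨|A| + ‖c‖, max (Real.exp 1) x₁, by positivity, ?_, fun x hx => ?_⟩
  · exact le_max_of_le_left (Real.one_le_exp (by norm_num))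
  have h1 := hx₁ x (le_trans (le_max_right _ _) hx)
  have hlog : 1 ≤ Real.log x := by
    rw [Real.le_log_iff_exp_le ((Real.exp_pos 1).trans_le (le_trans (le_max_left _ _) hx))]
    exact le_trans (le_max_left _ _) hx
  have h2 : ∑ p ∈ primesUpTo x, primePowerCoeff (F.α j) p 1 * conj (primePowerCoeff (F.α j) p 1) /
      ((p : ℕ) : ℂ) = ((F.coeffVariance j x : ℝ) : ℂ) := by
    rw [coeffVariance]
    push_cast
    refine Finset.sum_congr rfl fun p _ => ?_
    rw [Complex.mul_conj, Complex.normSq_eq_norm_sq]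
    push_cast
    rfl
  simp only [if_true, h2] at h1
  have h3 : A * ‖1 / Real.log x‖ ≤ |A| := by
    rw [norm_div, norm_one, Real.norm_eq_abs, abs_of_pos (by linarith)]
    calc A * (1 / Real.log x) ≤ |A| * (1 / Real.log x) := by gcongr; exact le_abs_self A
      _ ≤ |A| * 1 := by
        gcongr
        exact (div_le_one (by linarith)).2 hlog
      _ = _ := mul_one _
  rw [← Complex.ofReal_sub] at h1
  calc |F.coeffVariance j x - F.ξ j * Real.log (Real.log x)|
      = ‖((F.coeffVariance j x - F.ξ j * Real.log (Real.log x) : ℝ) : ℂ)‖ := by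
        rw [Complex.norm_real, Real.norm_eq_abs]
    _ ≤ ‖((F.coeffVariance j x - F.ξ j * Real.log (Real.log x) : ℝ) : ℂ) - c‖ + ‖c‖ :=
        norm_le_norm_sub_add _ _
    _ ≤ |A| + ‖c‖ := by linarith

theorem coeffVariance_sub {x y : ℝ} (hx : 0 ≤ x) (hxy : x ≤ y) :
    ∑ p ∈ primesUpTo y \ primesUpTo x, ‖primePowerCoeff (F.α j) p 1‖ ^ 2 / ((p : ℕ) : ℝ)
      = F.coeffVariance j y - F.coeffVariance j x := by
  rw [coeffVariance, coeffVariance, ← Finset.sum_sdiff_eq_sub]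
  intro p hp
  rw [mem_primesUpTo hx] at hp
  rw [mem_primesUpTo (hx.trans hxy)]
  exact hp.trans hxy

/-- The variance of `∑_p β(p) X(p) p^{-σ}` at `σ = 1/2 + 1/G`. The primes up to `e^G` contribute
`ξ log G + O(1)`, and those between `e^{iG}` and `e^{(i+1)G}` contribute `O(2^{-i})`. -/
theorem exists_sum_sq_primePowerCoeff_le : ∃ C G₀ : ℝ, 1 ≤ G₀ ∧ ∀ G, G₀ ≤ G →
    ∀ s : Finset Nat.Primes, ∑ p ∈ s, ‖primePowerCoeff (F.α j) p 1‖ ^ 2 *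
      ((p : ℕ) : ℝ) ^ (-(1 + 2 / G)) ≤ F.ξ j * Real.log G + C := by
  classical
  obtain ⟨K, x₀, hK, hx₀, h⟩ := F.exists_abs_coeffVariance_sub_le j
  have hξ := F.ξ_pos j
  set C₁ := F.ξ j * Real.log 4 + 2 * K with hC₁
  have hC₁0 : 0 ≤ C₁ := by have := Real.log_nonneg (by norm_num : (1 : ℝ) ≤ 4); positivity
  refine ⟨K + 2 * C₁, 1 + 2 * Real.log x₀, by linarith [Real.log_nonneg hx₀], fun G hG s => ?_⟩
  have hlx := Real.log_nonneg hx₀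
  have hG0 : 0 < G := by linarith
  have hexp : ∀ u : ℝ, 1 / 2 ≤ u → x₀ ≤ Real.exp (u * G) := fun u hu => by
    rw [← Real.log_le_iff_le_exp (by linarith)]
    nlinarith
  set ι : Nat.Primes → ℕ := fun p => ⌊Real.log (p : ℕ) / G⌋₊ with hι
  set a : Nat.Primes → ℝ := fun p => ‖primePowerCoeff (F.α j) p 1‖ ^ 2 / ((p : ℕ) : ℝ) with ha
  have ha0 : ∀ p, 0 ≤ a p := fun p => by positivity
  have hlogp : ∀ p : Nat.Primes, 0 ≤ Real.log (p : ℕ) := fun p =>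
    Real.log_nonneg (by linarith [p.two_le_cast])
  have hfib : ∀ i : ℕ, ∑ p ∈ s with ι p = i, a p ≤ if i = 0 then F.ξ j * Real.log G + K else C₁ := by
    intro i
    have hup : ∀ p, ι p = i → ((p : ℕ) : ℝ) ≤ Real.exp ((i + 1) * G) := by
      intro p hp
      rw [← Real.log_le_iff_le_exp p.cast_pos, ← div_le_iff₀ hG0, ← hp]
      exact (Nat.lt_floor_add_one _).le
    have hdiff : ∀ u : ℝ, 1 / 2 ≤ u → |F.coeffVariance j (Real.exp (u * G))
        - F.ξ j * (Real.log u + Real.log G)| ≤ K := fun u hu => by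
      have := h _ (hexp u hu)
      rwa [Real.log_exp, Real.log_mul (by linarith) hG0.ne'] at this
    split_ifs with hi
    · subst hi
      have h1 := hdiff 1 (by norm_num)
      rw [Real.log_one, zero_add, abs_le] at h1
      calc ∑ p ∈ s with ι p = 0, a p ≤ F.coeffVariance j (Real.exp (1 * G)) := by
            refine Finset.sum_le_sum_of_subset_of_nonneg (fun p hp => ?_) fun p _ _ => ha0 p
            rw [mem_primesUpTo (Real.exp_pos _).le]
            simpa using hup p (Finset.mem_filter.1 hp).2
        _ ≤ _ := by linarith [h1.2]
    · have hi1 : (1 : ℝ) ≤ i := by exact_mod_cast Nat.one_le_iff_ne_zero.2 hi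
      have h1 := abs_le.1 (hdiff (i + 1) (by linarith))
      have h2 := abs_le.1 (hdiff (i / 2) (by linarith))
      have h3 : Real.log (i + 1) ≤ Real.log (i / 2) + Real.log 4 := by
        rw [← Real.log_mul (by positivity) (by norm_num)]
        exact Real.log_le_log (by positivity) (by linarith)
      -- the range is extended to the left, from `e^{iG}` to `e^{iG/2}`, to make its lower end strict
      calc ∑ p ∈ s with ι p = i, a p
          ≤ ∑ p ∈ primesUpTo (Real.exp ((i + 1) * G)) \ primesUpTo (Real.exp ((i / 2 : ℝ) * G)),
              a p := by
            refine Finset.sum_le_sum_of_subset_of_nonneg (fun p hp => ?_) fun p _ _ => ha0 p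
            rw [Finset.mem_sdiff, mem_primesUpTo (Real.exp_pos _).le,
              mem_primesUpTo (Real.exp_pos _).le, not_le]
            refine ⟨hup p (Finset.mem_filter.1 hp).2, ?_⟩
            rw [← Real.lt_log_iff_exp_lt p.cast_pos]
            have h4 : (i : ℝ) ≤ Real.log (p : ℕ) / G := by
              rw [← (Finset.mem_filter.1 hp).2]
              exact Nat.floor_le (div_nonneg (hlogp p) hG0.le)
            rw [le_div_iff₀ hG0] at h4
            nlinarith
        _ = _ := F.coeffVariance_sub j (Real.exp_pos _).le (Real.exp_le_exp.2 (by nlinarith))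
        _ ≤ C₁ := by rw [hC₁]; nlinarith
  have hpw : ∀ p : Nat.Primes, ‖primePowerCoeff (F.α j) p 1‖ ^ 2 * ((p : ℕ) : ℝ) ^ (-(1 + 2 / G))
      ≤ (1 / 2 : ℝ) ^ ι p * a p := by
    intro p
    have h1 : ((p : ℕ) : ℝ) ^ (-(1 + 2 / G)) = ((p : ℕ) : ℝ)⁻¹ * ((p : ℕ) : ℝ) ^ (-(2 / G)) := by
      rw [neg_add, Real.rpow_add p.cast_pos, Real.rpow_neg_one]
    have h2 : ((p : ℕ) : ℝ) ^ (-(2 / G)) ≤ (1 / 2 : ℝ) ^ ι p := by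
      have h3 : (ι p : ℝ) ≤ Real.log (p : ℕ) / G :=
        Nat.floor_le (div_nonneg (hlogp p) hG0.le)
      have h5 : Real.log 2 ≤ 1 := by linarith [Real.log_two_lt_d9]
      rw [Real.rpow_def_of_pos p.cast_pos, one_div, inv_pow, ← Real.exp_log (by positivity :
        (0 : ℝ) < (2 ^ ι p)), ← Real.exp_neg, Real.log_pow]
      apply Real.exp_le_exp.2
      have h4 : Real.log (p : ℕ) * -(2 / G) = -(2 * (Real.log (p : ℕ) / G)) := by ring
      rw [h4]
      have : (0 : ℝ) ≤ ι p := by positivity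
      nlinarith
    rw [h1]
    calc _ ≤ ‖primePowerCoeff (F.α j) p 1‖ ^ 2 * (((p : ℕ) : ℝ)⁻¹ * (1 / 2 : ℝ) ^ ι p) := by gcongr
      _ = _ := by simp only [ha]; ring
  obtain ⟨m, hm⟩ : ∃ m, ∀ p ∈ s, ι p ∈ Finset.range (m + 1) :=
    ⟨s.sup ι, fun p hp => Finset.mem_range.2 (Nat.lt_succ_of_le (Finset.le_sup hp))⟩
  have hgeom : ∑ i ∈ Finset.range m, (1 / 2 : ℝ) ^ i ≤ 2 := by
    have := (summable_geometric_two).sum_le_tsum (Finset.range m) (fun i _ => by positivity)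
    rwa [tsum_geometric_two] at this
  calc _ ≤ ∑ p ∈ s, (1 / 2 : ℝ) ^ ι p * a p := Finset.sum_le_sum fun p _ => hpw p
    _ = ∑ i ∈ Finset.range (m + 1), ∑ p ∈ s with ι p = i, (1 / 2 : ℝ) ^ ι p * a p :=
        (Finset.sum_fiberwise_of_maps_to hm _).symm
    _ = ∑ i ∈ Finset.range (m + 1), (1 / 2 : ℝ) ^ i * ∑ p ∈ s with ι p = i, a p := by
        refine Finset.sum_congr rfl fun i _ => ?_
        rw [Finset.mul_sum]
        exact Finset.sum_congr rfl fun p hp => by rw [(Finset.mem_filter.1 hp).2]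
    _ ≤ ∑ i ∈ Finset.range (m + 1), (1 / 2 : ℝ) ^ i *
          (if i = 0 then F.ξ j * Real.log G + K else C₁) := by
        gcongr with i; exact hfib i
    _ = (∑ i ∈ Finset.range m, (1 / 2 : ℝ) ^ (i + 1) * C₁) + (F.ξ j * Real.log G + K) := by
        rw [Finset.sum_range_succ']
        simp
    _ ≤ F.ξ j * Real.log G + (K + 2 * C₁) := by
        rw [← Finset.sum_mul]
        have : ∑ i ∈ Finset.range m, (1 / 2 : ℝ) ^ (i + 1) ≤ 2 := by
          refine le_trans (Finset.sum_le_sum fun i _ => ?_) hgeom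
          rw [pow_succ]
          have : 0 ≤ (1 / 2 : ℝ) ^ i := by positivity
          linarith
        nlinarith

/-- The variance of a smoothed polynomial over the primes `p ≤ e^{4Y}`: the weights are close to `1`
for `p ≤ e^{Y/2}`, and the remaining range contributes a bounded amount. The bounds for the weights
are those of `3²` and `(1 + 2 e^{-Y/2})²`. -/
theorem exists_sum_weighted_sq_primePowerCoeff_le : ∃ C Y₀ : ℝ, ∀ Y, Y₀ ≤ Y →
    ∀ w : Nat.Primes → ℝ, (∀ p, w p ≤ 9) →
    (∀ p : Nat.Primes, Real.log (p : ℕ) ≤ Y / 2 → w p ≤ 1 + 8 * Real.exp (-(Y / 2))) →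
    ∑ p ∈ primesUpTo (Real.exp (4 * Y)), ‖primePowerCoeff (F.α j) p 1‖ ^ 2 / ((p : ℕ) : ℝ) * w p
      ≤ F.ξ j * Real.log Y + C := by
  classical
  obtain ⟨K, x₀, hK, hx₀, h⟩ := F.exists_abs_coeffVariance_sub_le j
  have hξ := F.ξ_pos j
  refine ⟨K + 16 * (F.ξ j + K) + 9 * (F.ξ j * Real.log 8 + 2 * K), 2 + 2 * Real.log x₀,
    fun Y hY w hw9 hw1 => ?_⟩
  have hlx := Real.log_nonneg hx₀
  have hY0 : 0 < Y := by linarith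
  have hdiff : ∀ u : ℝ, 1 / 2 ≤ u → |F.coeffVariance j (Real.exp (u * Y))
      - F.ξ j * (Real.log u + Real.log Y)| ≤ K := fun u hu => by
    have hx : x₀ ≤ Real.exp (u * Y) := by
      rw [← Real.log_le_iff_le_exp (by linarith)]
      nlinarith
    have := h _ hx
    rwa [Real.log_exp, Real.log_mul (by linarith) hY0.ne'] at this
  have h4 := abs_le.1 (hdiff 4 (by norm_num))
  have h2 := abs_le.1 (hdiff (1 / 2) (by norm_num))
  have hle : Real.exp (1 / 2 * Y) ≤ Real.exp (4 * Y) := Real.exp_le_exp.2 (by linarith)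
  have hsub : primesUpTo (Real.exp (1 / 2 * Y)) ⊆ primesUpTo (Real.exp (4 * Y)) := fun p hp => by
    rw [mem_primesUpTo (Real.exp_pos _).le] at hp ⊢
    exact hp.trans hle
  have hlog8 : Real.log 4 - Real.log (1 / 2) = Real.log 8 := by
    rw [← Real.log_div (by norm_num) (by norm_num)]; norm_num
  have hlogh : Real.log (1 / 2) ≤ 0 := Real.log_nonpos (by norm_num) (by norm_num)
  rw [← Finset.sum_sdiff hsub]
  have hA : ∑ p ∈ primesUpTo (Real.exp (4 * Y)) \ primesUpTo (Real.exp (1 / 2 * Y)),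
      ‖primePowerCoeff (F.α j) p 1‖ ^ 2 / ((p : ℕ) : ℝ) * w p
      ≤ 9 * (F.ξ j * Real.log 8 + 2 * K) := by
    calc _ ≤ ∑ p ∈ primesUpTo (Real.exp (4 * Y)) \ primesUpTo (Real.exp (1 / 2 * Y)),
          ‖primePowerCoeff (F.α j) p 1‖ ^ 2 / ((p : ℕ) : ℝ) * 9 := by
          gcongr with p; exact hw9 p
      _ = (F.coeffVariance j (Real.exp (4 * Y)) - F.coeffVariance j (Real.exp (1 / 2 * Y))) * 9 := by
          rw [← Finset.sum_mul, F.coeffVariance_sub j (Real.exp_pos _).le hle]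
      _ ≤ _ := by
          rw [← hlog8]
          nlinarith [h4.2, h2.1]
  have hB : ∑ p ∈ primesUpTo (Real.exp (1 / 2 * Y)),
      ‖primePowerCoeff (F.α j) p 1‖ ^ 2 / ((p : ℕ) : ℝ) * w p
      ≤ F.ξ j * Real.log Y + (K + 16 * (F.ξ j + K)) := by
    have hb0 : 0 ≤ F.ξ j * Real.log Y + K := by
      have := Real.log_nonneg (by linarith : (1 : ℝ) ≤ Y)
      positivity
    have hcv : F.coeffVariance j (Real.exp (1 / 2 * Y)) ≤ F.ξ j * Real.log Y + K := by
      nlinarith [h2.2]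
    have hYexp : (F.ξ j * Real.log Y + K) * Real.exp (-(Y / 2)) ≤ 2 * (F.ξ j + K) := by
      have e1 : Real.exp (-(Y / 2)) ≤ 2 / Y := by
        rw [Real.exp_neg, inv_le_comm₀ (Real.exp_pos _) (by positivity), inv_div]
        linarith [Real.add_one_le_exp (Y / 2)]
      have e2 : Real.log Y ≤ Y := (Real.log_le_sub_one_of_pos hY0).trans (by linarith)
      calc _ ≤ (F.ξ j * Y + K * Y) * (2 / Y) := by
            gcongr
            nlinarith
        _ = _ := by field_simp
    calc _ ≤ ∑ p ∈ primesUpTo (Real.exp (1 / 2 * Y)),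
          ‖primePowerCoeff (F.α j) p 1‖ ^ 2 / ((p : ℕ) : ℝ) * (1 + 8 * Real.exp (-(Y / 2))) := by
          refine Finset.sum_le_sum fun p hp => ?_
          rw [mem_primesUpTo (Real.exp_pos _).le, ← Real.log_le_iff_le_exp p.cast_pos] at hp
          gcongr
          exact hw1 p (by linarith)
      _ = F.coeffVariance j (Real.exp (1 / 2 * Y)) * (1 + 8 * Real.exp (-(Y / 2))) := by
          rw [← Finset.sum_mul]; rfl
      _ ≤ (F.ξ j * Real.log Y + K) * (1 + 8 * Real.exp (-(Y / 2))) := by gcongr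
      _ ≤ _ := by nlinarith
  linarith

end LFunctionFamily

/-! ### The Dirichlet series of the logarithm -/

theorem Nat.Primes.norm_cpow (p : Nat.Primes) (s : ℂ) :
    ‖((p : ℕ) : ℂ) ^ s‖ = ((p : ℕ) : ℝ) ^ s.re :=
  Complex.norm_natCast_cpow_of_pos p.2.pos s

theorem Nat.Primes.cast_ne_zero (p : Nat.Primes) : ((p : ℕ) : ℂ) ≠ 0 := by
  exact_mod_cast p.2.ne_zero

/-- The terms of the Dirichlet series of the logarithm, indexed by the pairs `(p, k)` that stand for
the prime powers `p^(k+1)`. -/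
noncomputable def logTerm {d : ℕ} (α : Fin d → Nat.Primes → ℂ) (s : ℂ) (x : Nat.Primes × ℕ) : ℂ :=
  primePowerCoeff α x.1 (x.2 + 1) / ((x.1 : ℕ) : ℂ) ^ (((x.2 : ℂ) + 1) * s)

theorem norm_logTerm {d : ℕ} (α : Fin d → Nat.Primes → ℂ) (s : ℂ) (x : Nat.Primes × ℕ) :
    ‖logTerm α s x‖ = ‖primePowerCoeff α x.1 (x.2 + 1)‖ *
      ((x.1 : ℕ) : ℝ) ^ (-((x.2 + 1) * s.re)) := by
  have h : (((x.2 : ℂ) + 1) * s).re = (x.2 + 1) * s.re := by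
    have : ((x.2 : ℂ) + 1) = ((x.2 + 1 : ℝ) : ℂ) := by push_cast; rfl
    rw [this, Complex.re_ofReal_mul]
  rw [logTerm, norm_div, x.1.norm_cpow, h, Real.rpow_neg x.1.cast_pos.le, div_eq_mul_inv]

theorem norm_logTerm_le {d : ℕ} (α : Fin d → Nat.Primes → ℂ) {s : ℂ} {c : ℝ} (hc : c ≤ s.re)
    (x : Nat.Primes × ℕ) : ‖logTerm α s x‖ ≤ ‖primePowerCoeff α x.1 (x.2 + 1)‖ *
      ((x.1 : ℕ) : ℝ) ^ (-((x.2 + 1) * c)) := by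
  rw [norm_logTerm]
  gcongr
  linarith [x.1.two_le_cast]

/-- The local factor: `∑_k β(p^k) z^k = -∑_i log (1 - α_i(p) z)`. -/
theorem hasSum_primePowerCoeff_mul_pow {d : ℕ} (α : Fin d → Nat.Primes → ℂ) (p : Nat.Primes) {z : ℂ}
    (hz : ∀ i, ‖α i p * z‖ < 1) :
    HasSum (fun k : ℕ => primePowerCoeff α p (k + 1) * z ^ (k + 1))
      (∑ i, -Complex.log (1 - α i p * z)) := by
  have h : ∀ i, HasSum (fun k : ℕ => (α i p * z) ^ (k + 1) / ((k + 1 : ℕ) : ℂ))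
      (-Complex.log (1 - α i p * z)) := fun i => by
    have := (hasSum_nat_add_iff' 1).2 (Complex.hasSum_taylorSeries_neg_log (hz i))
    simpa using this
  refine (hasSum_sum fun i _ => h i).congr_fun fun k => ?_
  rw [primePowerCoeff, mul_assoc, Finset.sum_mul, Finset.mul_sum]
  refine Finset.sum_congr rfl fun i _ => ?_
  rw [mul_pow]
  ring

namespace LFunctionFamily

variable {J : ℕ} (F : LFunctionFamily J) (j : Fin J)

theorem summable_logTerm {s : ℂ} (hs : 1 < s.re) : Summable (logTerm (F.α j) s) :=
  Summable.of_norm_bounded (F.summable_primePowerCoeff j hs) fun x => norm_logTerm_le _ le_rfl x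

theorem logDirichletSeries_eq_tsum {s : ℂ} (hs : 1 < s.re) :
    logDirichletSeries (F.α j) s = ∑' x, logTerm (F.α j) s x :=
  ((F.summable_logTerm j hs).tsum_prod).symm

/-- The constant `5/4` stands for any fixed number larger than `1`. -/
theorem exists_norm_logDirichletSeries_le : ∃ K : ℝ, 0 ≤ K ∧ ∀ s : ℂ, 5 / 4 ≤ s.re →
    ‖logDirichletSeries (F.α j) s‖ ≤ K := by
  obtain ⟨K, hK⟩ := F.summable_primePowerCoeff j (c := 5 / 4) (by norm_num)
  refine ⟨K, hK.nonneg fun x => by positivity, fun s hs => ?_⟩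
  rw [F.logDirichletSeries_eq_tsum j (by linarith)]
  exact tsum_of_norm_bounded hK fun x => norm_logTerm_le _ hs x

theorem differentiableOn_logDirichletSeries :
    DifferentiableOn ℂ (logDirichletSeries (F.α j)) {s | 1 < s.re} := by
  intro s hs
  have hs' : 1 < s.re := hs
  set c := (1 + s.re) / 2 with hc
  have ho : IsOpen {z : ℂ | c < z.re} := isOpen_lt continuous_const Complex.continuous_re
  have h := Complex.differentiableOn_tsum_of_summable_norm (F := fun x z => logTerm (F.α j) z x)
    (F.summable_primePowerCoeff j (c := c) (by linarith)) (fun x => ?_) ho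
    (fun x z (hz : c < z.re) => norm_logTerm_le _ hz.le x)
  · have hmem : {z : ℂ | c < z.re} ∈ 𝓝 s := ho.mem_nhds (show c < s.re by linarith)
    refine DifferentiableAt.differentiableWithinAt ?_
    refine (h.differentiableAt hmem).congr_of_eventuallyEq ?_
    filter_upwards [hmem] with z hz
    have hz' : c < z.re := hz
    exact F.logDirichletSeries_eq_tsum j (by linarith)
  · refine Differentiable.differentiableOn fun z => ?_
    refine (differentiableAt_const _).div ?_ ?_
    · exact (differentiableAt_id.const_mul _).const_cpow (Or.inl x.1.cast_ne_zero)
    · rw [Ne, Complex.cpow_eq_zero_iff]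
      exact fun h => x.1.cast_ne_zero h.1

theorem norm_root_mul_cpow_lt_one {s : ℂ} (hs : 1 / 2 ≤ s.re) (p : Nat.Primes) (i : Fin F.d) :
    ‖F.α j i p * (((p : ℕ) : ℂ) ^ s)⁻¹‖ < 1 := by
  obtain ⟨θ, hθ0, hθ, hα⟩ := F.root_bound
  rw [norm_mul, norm_inv, p.norm_cpow]
  calc _ ≤ ((p : ℕ) : ℝ) ^ θ * (((p : ℕ) : ℝ) ^ s.re)⁻¹ := by gcongr; exact hα j i p
    _ = ((p : ℕ) : ℝ) ^ (θ - s.re) := by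
        rw [Real.rpow_sub p.cast_pos, div_eq_mul_inv]
    _ < 1 := Real.rpow_lt_one_of_one_lt_of_neg (by linarith [p.two_le_cast]) (by linarith)

/-- The Dirichlet series of the logarithm is a logarithm of the Euler product. -/
theorem exp_logDirichletSeries {s : ℂ} (hs : 1 < s.re) :
    Complex.exp (logDirichletSeries (F.α j) s) = F.L j s := by
  have hfac : ∀ p : Nat.Primes, HasSum (fun k => logTerm (F.α j) s (p, k))
      (∑ i, -Complex.log (1 - F.α j i p * (((p : ℕ) : ℂ) ^ s)⁻¹)) := by
    intro p
    refine (hasSum_primePowerCoeff_mul_pow (F.α j) p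
      (F.norm_root_mul_cpow_lt_one j (by linarith) p)).congr_fun fun k => ?_
    simp only [logTerm]
    rw [div_eq_mul_inv, inv_pow, ← Complex.cpow_nat_mul]
    push_cast
    rfl
  have h1 := ((F.summable_logTerm j hs).hasSum.prod_fiberwise hfac).cexp
  rw [← F.logDirichletSeries_eq_tsum j hs] at h1
  refine h1.unique ((F.euler_product j s hs).congr_fun fun p => ?_)
  simp only [Function.comp]
  rw [Complex.exp_sum]
  refine Finset.prod_congr rfl fun i _ => ?_
  rw [Complex.exp_neg, Complex.exp_log, div_eq_mul_inv]
  rw [sub_ne_zero]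
  intro h
  have := F.norm_root_mul_cpow_lt_one j (s := s) (by linarith) p i
  rw [← h, norm_one] at this
  exact lt_irrefl _ this

end LFunctionFamily

/-! ### Polynomial growth in vertical strips -/

/-- The bound depends on `u` only through its real part, hence is uniform on vertical lines. -/
theorem norm_betaIntegral_le {u v : ℂ} : ‖Complex.betaIntegral u v‖
    ≤ ∫ x in (0 : ℝ)..1, ‖(x : ℂ) ^ ((u.re : ℂ) - 1) * (1 - (x : ℂ)) ^ (v - 1)‖ := by
  refine (intervalIntegral.norm_integral_le_integral_norm zero_le_one).trans (le_of_eq ?_)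
  rw [intervalIntegral.integral_of_le zero_le_one, intervalIntegral.integral_of_le zero_le_one]
  refine setIntegral_congr_fun measurableSet_Ioc fun x hx => ?_
  simp only [norm_mul]
  rw [Complex.norm_cpow_eq_rpow_re_of_pos hx.1, Complex.norm_cpow_eq_rpow_re_of_pos hx.1]
  simp

/-- On a vertical line, a real shift of the argument changes the Gamma function by a factor of at
most polynomial size. With `n > h`, the quotient `Γ(z + h) / Γ(z + n)` is a Beta integral up to a
constant, and `Γ(z + n) / Γ(z)` is a polynomial. -/
theorem exists_norm_Gamma_add_le {x h : ℝ} (hh : 0 < h) (hxh : 0 < x + h) :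
    ∃ (C : ℝ) (n : ℕ), 0 ≤ C ∧ ∀ z : ℂ, z.re = x → z.im ≠ 0 →
      ‖Complex.Gamma (z + h)‖ ≤ C * (1 + ‖z‖) ^ n * ‖Complex.Gamma z‖ := by
  obtain ⟨n, hn⟩ := exists_nat_gt h
  set B : ℝ := ∫ y in (0 : ℝ)..1, ‖(y : ℂ) ^ (((x + h : ℝ) : ℂ) - 1) *
    (1 - (y : ℂ)) ^ (((n - h : ℝ) : ℂ) - 1)‖ with hB
  have hB0 : 0 ≤ B := intervalIntegral.integral_nonneg zero_le_one fun y _ => norm_nonneg _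
  have hΓ0 : Complex.Gamma ((n - h : ℝ) : ℂ) ≠ 0 :=
    Complex.Gamma_ne_zero_of_re_pos (by simpa using hn)
  have hn1 : (1 : ℝ) ≤ n := by
    have : 0 < n := by exact_mod_cast hh.trans hn
    exact_mod_cast this
  refine ⟨B / ‖Complex.Gamma ((n - h : ℝ) : ℂ)‖ * n ^ n, n, by positivity, fun z hz hz0 => ?_⟩
  have hzn : ∀ k : ℕ, z ≠ -k := fun k hk => hz0 (by simp [hk])
  have h1 := Complex.Gamma_mul_Gamma_eq_betaIntegral (s := z + h) (t := ((n - h : ℝ) : ℂ))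
    (by simpa [hz] using hxh) (by simpa using hn)
  have h2 : z + h + ((n - h : ℝ) : ℂ) = z + n := by push_cast; ring
  have h3 := Complex.Gamma_add_nat_div_Gamma_eq (n := n) z hzn
  rw [h2] at h1
  have h4 : ‖Complex.betaIntegral (z + h) ((n - h : ℝ) : ℂ)‖ ≤ B := by
    refine norm_betaIntegral_le.trans (le_of_eq ?_)
    rw [hB]
    simp [hz]
  have h5 : ‖Complex.Gamma (z + n)‖ ≤ (n * (1 + ‖z‖)) ^ n * ‖Complex.Gamma z‖ := by
    rw [div_eq_iff (Complex.Gamma_ne_zero hzn)] at h3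
    rw [h3, norm_mul]
    gcongr
    have key : ∀ m : ℕ, m ≤ n →
        ‖Polynomial.eval z (ascPochhammer ℂ m)‖ ≤ (n * (1 + ‖z‖)) ^ m := by
      intro m
      induction m with
      | zero => simp
      | succ m ih =>
        intro hm
        have hm' : (m : ℝ) + 1 ≤ n := by exact_mod_cast hm
        rw [ascPochhammer_succ_eval, norm_mul, pow_succ]
        gcongr
        · exact ih (by omega)
        · calc ‖z + m‖ ≤ ‖z‖ + m := (norm_add_le _ _).trans (by simp)
            _ ≤ _ := by nlinarith [norm_nonneg z]
    exact key n le_rfl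
  have h6 : ‖Complex.Gamma (z + h)‖ * ‖Complex.Gamma ((n - h : ℝ) : ℂ)‖
      ≤ (n * (1 + ‖z‖)) ^ n * ‖Complex.Gamma z‖ * B := by
    rw [← norm_mul, h1, norm_mul]
    gcongr
  rw [← le_div_iff₀ (norm_pos_iff.2 hΓ0)] at h6
  refine h6.trans (le_of_eq ?_)
  rw [mul_pow]
  ring

theorem Polynomial.exists_norm_eval_le (P : Polynomial ℂ) :
    ∃ (C : ℝ) (n : ℕ), 0 ≤ C ∧ ∀ s : ℂ, ‖P.eval s‖ ≤ C * (1 + ‖s‖) ^ n := by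
  refine ⟨∑ i ∈ Finset.range (P.natDegree + 1), ‖P.coeff i‖, P.natDegree, by positivity,
    fun s => ?_⟩
  rw [Polynomial.eval_eq_sum_range, Finset.sum_mul]
  refine norm_sum_le_of_le _ fun i hi => ?_
  rw [norm_mul, norm_pow]
  gcongr
  calc ‖s‖ ^ i ≤ (1 + ‖s‖) ^ i := by gcongr; linarith
    _ ≤ _ := by
      gcongr
      · linarith [norm_nonneg s]
      · exact Nat.lt_succ_iff.1 (Finset.mem_range.1 hi)

/-- A nonzero polynomial is bounded below away from the horizontal strip that contains its roots. -/
theorem Polynomial.exists_le_norm_eval {P : Polynomial ℂ} (hP : P ≠ 0) :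
    ∃ c t : ℝ, 0 < c ∧ ∀ s : ℂ, t ≤ |s.im| → c ≤ ‖P.eval s‖ := by
  have hsplit := IsAlgClosed.splits P
  refine ⟨‖P.leadingCoeff‖, ∑ a ∈ P.roots.toFinset, |a.im| + 1, by simpa using hP, fun s hs => ?_⟩
  have hev := hsplit.eval_eq_prod_roots s
  rw [hev, norm_mul]
  refine le_mul_of_one_le_right (norm_nonneg _) ?_
  have key : ∀ m : Multiset ℂ, (∀ a ∈ m, 1 ≤ ‖s - a‖) → 1 ≤ ‖(m.map (s - ·)).prod‖ := by
    intro m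
    induction m using Multiset.induction_on with
    | empty => simp
    | cons a m ih =>
      intro h
      rw [Multiset.map_cons, Multiset.prod_cons, norm_mul]
      exact one_le_mul_of_one_le_of_one_le (h a (Multiset.mem_cons_self a m))
        (ih fun b hb => h b (Multiset.mem_cons_of_mem hb))
  refine key _ fun a ha => ?_
  have h1 : |a.im| ≤ ∑ a ∈ P.roots.toFinset, |a.im| :=
    Finset.single_le_sum (f := fun a : ℂ => |a.im|) (fun _ _ => abs_nonneg _)
      (Multiset.mem_toFinset.2 ha)
  have h2 : |s.im| - |a.im| ≤ |(s - a).im| := by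
    rw [Complex.sub_im]; exact abs_sub_abs_le_abs_sub _ _
  linarith [Complex.abs_im_le_norm (s - a)]

namespace LFunctionFamily

variable {J : ℕ} (F : LFunctionFamily J) (j : Fin J)

/-- On the line `Re s = -1` the functional equation relates `s` to `1 - s̄ = s + 3`, where the Euler
product converges, and the quotient of the Gamma factors is of polynomial size. -/
theorem exists_norm_le_of_re_eq_neg_one : ∃ (C t : ℝ) (n : ℕ), 0 ≤ C ∧ ∀ s : ℂ, s.re = -1 →
    t ≤ |s.im| → AnalyticAt ℂ (F.L j) s → AnalyticAt ℂ (F.L j) (1 - conj s) →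
    ‖F.L j s‖ ≤ C * (1 + ‖s‖) ^ n := by
  obtain ⟨K, hK0, hK⟩ := F.exists_norm_logDirichletSeries_le j
  have hG : ∀ ℓ, ∃ (C : ℝ) (n : ℕ), 0 ≤ C ∧ ∀ z : ℂ, z.re = -F.lam ℓ + (F.mu ℓ).re → z.im ≠ 0 →
      ‖Complex.Gamma (z + (3 * F.lam ℓ : ℝ))‖ ≤ C * (1 + ‖z‖) ^ n * ‖Complex.Gamma z‖ := fun ℓ =>
    exists_norm_Gamma_add_le (by have := F.lam_pos ℓ; positivity)
      (by have := F.lam_pos ℓ; have := F.mu_re_nonneg ℓ; linarith)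
  choose C n hC hCn using hG
  set D : Fin F.m → ℝ := fun ℓ => 1 + F.lam ℓ + ‖F.mu ℓ‖ with hD
  refine ⟨Real.exp K * F.Q ^ (3 : ℝ) * ∏ ℓ, (C ℓ * D ℓ ^ n ℓ), 1 + ∑ ℓ, |(F.mu ℓ).im| / F.lam ℓ,
    ∑ ℓ, n ℓ, ?_, fun s hs ht ha ha' => ?_⟩
  · have := F.Q_pos
    refine mul_nonneg (by positivity) (Finset.prod_nonneg fun ℓ _ => ?_)
    have := F.lam_pos ℓ
    have := hC ℓ
    positivity
  have hrefl : 1 - conj s = s + 3 := by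
    apply Complex.ext
    · simp [hs]; norm_num
    · simp
  have him : ∀ ℓ, ((F.lam ℓ : ℂ) * s + F.mu ℓ).im ≠ 0 := by
    intro ℓ h
    have hl := F.lam_pos ℓ
    have h1 : F.lam ℓ * s.im = -(F.mu ℓ).im := by
      have : F.lam ℓ * s.im + (F.mu ℓ).im = 0 := by simpa using h
      linarith
    have h2 : |s.im| = |(F.mu ℓ).im| / F.lam ℓ := by
      rw [eq_div_iff hl.ne', ← abs_neg (F.mu ℓ).im, ← h1, abs_mul, abs_of_pos hl, mul_comm]
    have h3 : |(F.mu ℓ).im| / F.lam ℓ ≤ ∑ ℓ, |(F.mu ℓ).im| / F.lam ℓ :=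
      Finset.single_le_sum (f := fun ℓ => |(F.mu ℓ).im| / F.lam ℓ)
        (fun i _ => div_nonneg (abs_nonneg _) (F.lam_pos i).le) (Finset.mem_univ ℓ)
    linarith
  have hshift : ∀ ℓ, (F.lam ℓ : ℂ) * (s + 3) + F.mu ℓ
      = ((F.lam ℓ : ℂ) * s + F.mu ℓ) + ((3 * F.lam ℓ : ℝ) : ℂ) := fun ℓ => by push_cast; ring
  have hfe := F.functional_equation j s ha ha'
    (fun ℓ n h => him ℓ (by rw [h]; simp))
    (fun ℓ n h => him ℓ (by
      rw [hrefl, hshift] at h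
      have := congrArg Complex.im h
      simpa using this))
  rw [hrefl] at hfe
  have hnorm := congrArg norm hfe
  rw [norm_mul, F.norm_rootNumber, one_mul, RCLike.norm_conj, completed, completed, norm_mul,
    norm_mul, norm_mul, norm_mul, norm_prod, norm_prod,
    Complex.norm_cpow_eq_rpow_re_of_pos F.Q_pos, Complex.norm_cpow_eq_rpow_re_of_pos F.Q_pos] at hnorm
  have hre3 : (s + 3).re = 2 := by simp [hs]; norm_num
  have hL2 : ‖F.L j (s + 3)‖ ≤ Real.exp K := by
    rw [← F.exp_logDirichletSeries j (by rw [hre3]; norm_num), Complex.norm_exp]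
    exact Real.exp_le_exp.2 ((Complex.re_le_norm _).trans (hK _ (by rw [hre3]; norm_num)))
  rw [hre3, hs] at hnorm
  have hgam : ∏ ℓ, ‖Complex.Gamma ((F.lam ℓ : ℂ) * (s + 3) + F.mu ℓ)‖
      ≤ (∏ ℓ, (C ℓ * D ℓ ^ n ℓ)) * (1 + ‖s‖) ^ (∑ ℓ, n ℓ) *
        ∏ ℓ, ‖Complex.Gamma ((F.lam ℓ : ℂ) * s + F.mu ℓ)‖ := by
    rw [← Finset.prod_pow_eq_pow_sum, ← Finset.prod_mul_distrib, ← Finset.prod_mul_distrib]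
    refine Finset.prod_le_prod (fun ℓ _ => norm_nonneg _) fun ℓ _ => ?_
    have hl := F.lam_pos ℓ
    rw [hshift]
    refine (hCn ℓ _ (by simp [hs]) (him ℓ)).trans ?_
    rw [mul_assoc (C ℓ) (D ℓ ^ n ℓ), ← mul_pow]
    have := hC ℓ
    gcongr
    calc 1 + ‖(F.lam ℓ : ℂ) * s + F.mu ℓ‖ ≤ 1 + (F.lam ℓ * ‖s‖ + ‖F.mu ℓ‖) := by
          gcongr
          refine (norm_add_le _ _).trans ?_
          rw [norm_mul, Complex.norm_real, Real.norm_eq_abs, abs_of_pos hl]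
      _ ≤ D ℓ * (1 + ‖s‖) := by
          rw [hD]
          nlinarith [norm_nonneg s, norm_nonneg (F.mu ℓ), mul_nonneg (norm_nonneg (F.mu ℓ))
            (norm_nonneg s)]
  set Γ₁ := ∏ ℓ, ‖Complex.Gamma ((F.lam ℓ : ℂ) * s + F.mu ℓ)‖ with hΓ₁
  have hΓpos : 0 < Γ₁ := Finset.prod_pos fun ℓ _ => norm_pos_iff.2
    (Complex.Gamma_ne_zero fun k h => him ℓ (by rw [h]; simp))
  have hQ := F.Q_pos
  have hQ1 : F.Q ^ (2 : ℝ) = F.Q ^ (3 : ℝ) * F.Q ^ (-1 : ℝ) := by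
    rw [← Real.rpow_add hQ]; norm_num
  have hpos : 0 < F.Q ^ (-1 : ℝ) * Γ₁ := by positivity
  rw [← mul_le_mul_iff_left₀ hpos]
  calc ‖F.L j s‖ * (F.Q ^ (-1 : ℝ) * Γ₁) = ‖F.L j s‖ * F.Q ^ (-1 : ℝ) * Γ₁ := by ring
    _ = _ := hnorm
    _ ≤ Real.exp K * F.Q ^ (2 : ℝ) * ((∏ ℓ, (C ℓ * D ℓ ^ n ℓ)) * (1 + ‖s‖) ^ (∑ ℓ, n ℓ) * Γ₁) := by
        gcongr
    _ = _ := by rw [hQ1]; ring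

/-- The finitely many poles lie in a bounded horizontal strip. -/
theorem exists_differentiableAt : ∃ t : ℝ, ∀ s : ℂ, t ≤ |s.im| →
    DifferentiableAt ℂ (F.L j) s ∧ AnalyticAt ℂ (F.L j) s := by
  obtain ⟨P, f, hP, hf, -, -, hL⟩ := F.meromorphic j
  obtain ⟨c, t, hc, ht⟩ := Polynomial.exists_le_norm_eval hP
  refine ⟨t, fun s hs => ?_⟩
  have hPs : P.eval s ≠ 0 := norm_pos_iff.1 (hc.trans_le (ht s hs))
  have ho : IsOpen {z : ℂ | P.eval z ≠ 0} := isOpen_ne_fun P.continuous continuous_const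
  have hd : DifferentiableOn ℂ (F.L j) {z : ℂ | P.eval z ≠ 0} := by
    refine DifferentiableOn.congr (f := fun z => f z / P.eval z) ?_ fun z hz => hL z hz
    exact hf.differentiableOn.div P.differentiable.differentiableOn fun z hz => hz
  exact ⟨hd.differentiableAt (ho.mem_nhds hPs), hd.analyticAt (ho.mem_nhds hPs)⟩

/-- An entire function that is of polynomial size on the part `t ≤ |Im s|` of a vertical line is of
polynomial size on the whole line. -/
theorem exists_norm_le_of_re_eq {f : ℂ → ℂ} (hf : Continuous f) {x t C : ℝ} {n : ℕ} (hC : 0 ≤ C)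
    (h : ∀ s : ℂ, s.re = x → t ≤ |s.im| → ‖f s‖ ≤ C * (1 + ‖s‖) ^ n) :
    ∃ C' : ℝ, 0 ≤ C' ∧ ∀ s : ℂ, s.re = x → ‖f s‖ ≤ C' * (1 + ‖s‖) ^ n := by
  obtain ⟨B, hB⟩ := (isCompact_Icc (a := -t) (b := t)).exists_bound_of_continuousOn
    (f := fun y : ℝ => f (x + y * Complex.I)) (by fun_prop)
  refine ⟨C + |B|, by positivity, fun s hs => ?_⟩
  have h1 : 1 ≤ (1 + ‖s‖) ^ n := one_le_pow₀ (by linarith [norm_nonneg s])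
  rcases le_total t |s.im| with ht | ht
  · refine (h s hs ht).trans ?_
    gcongr
    linarith [abs_nonneg B]
  · have h2 := hB s.im (abs_le.1 ht)
    have h3 : (x : ℂ) + s.im * Complex.I = s := by rw [← hs, Complex.re_add_im]
    rw [h3] at h2
    nlinarith [le_abs_self B, abs_nonneg B]

theorem one_add_norm_le {s : ℂ} (hs : -1 ≤ s.re) : 1 + ‖s‖ ≤ 4 * ‖s + 2‖ := by
  have h1 : 1 ≤ ‖s + 2‖ := by
    have := Complex.re_le_norm (s + 2)
    simp at this
    linarith
  have h2 : ‖s‖ ≤ ‖s + 2‖ + 2 := by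
    have := norm_sub_le (s + 2) 2
    simpa using this
  linarith

/-- The convexity bound: `L` grows at most polynomially in the half-plane `1/2 ≤ Re s`. -/
theorem exists_norm_le_im_pow : ∃ (C t : ℝ) (n : ℕ), 0 < C ∧ 1 ≤ t ∧ ∀ s : ℂ, 1 / 2 ≤ s.re →
    t ≤ s.im → ‖F.L j s‖ ≤ C * s.im ^ n := by
  obtain ⟨K, hK0, hK⟩ := F.exists_norm_logDirichletSeries_le j
  have hL2 : ∀ s : ℂ, 2 ≤ s.re → ‖F.L j s‖ ≤ Real.exp K := fun s hs => by
    rw [← F.exp_logDirichletSeries j (by linarith), Complex.norm_exp]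
    exact Real.exp_le_exp.2 ((Complex.re_le_norm _).trans (hK _ (by linarith)))
  obtain ⟨C₁, t₁, n₁, hC₁, h₁⟩ := F.exists_norm_le_of_re_eq_neg_one j
  obtain ⟨t₂, h₂⟩ := F.exists_differentiableAt j
  obtain ⟨P, f, hP, hf, ⟨A, Cf, hA⟩, -, hL⟩ := F.meromorphic j
  obtain ⟨c, t₃, hc, h₃⟩ := Polynomial.exists_le_norm_eval hP
  obtain ⟨CP, nP, hCP, hPn⟩ := P.exists_norm_eval_le
  have hfL : ∀ s : ℂ, t₃ ≤ |s.im| → f s = F.L j s * P.eval s := fun s hs => by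
    have hPs : P.eval s ≠ 0 := norm_pos_iff.1 (hc.trans_le (h₃ s hs))
    rw [hL s hPs, div_mul_cancel₀ _ hPs]
  set n := n₁ + nP with hn
  have hone : ∀ s : ℂ, (1 : ℝ) ≤ 1 + ‖s‖ := fun s => by linarith [norm_nonneg s]
  obtain ⟨Ca, hCa, ha⟩ := exists_norm_le_of_re_eq (f := f) hf.continuous (x := -1)
    (t := max t₁ (max t₂ t₃)) (C := C₁ * CP) (n := n) (by positivity) (fun s hs ht => by
      simp only [max_le_iff] at ht
      rw [hfL s ht.2.2, norm_mul]
      calc _ ≤ (C₁ * (1 + ‖s‖) ^ n₁) * (CP * (1 + ‖s‖) ^ nP) := by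
            gcongr
            · exact h₁ s hs ht.1 (h₂ s ht.2.1).2 (h₂ _ (by simpa using ht.2.1)).2
            · exact hPn s
        _ = _ := by rw [hn, pow_add]; ring)
  obtain ⟨Cb, hCb, hb⟩ := exists_norm_le_of_re_eq (f := f) hf.continuous (x := 2)
    (t := t₃) (C := Real.exp K * CP) (n := n) (by positivity) (fun s hs ht => by
      rw [hfL s ht, norm_mul]
      calc _ ≤ Real.exp K * (CP * (1 + ‖s‖) ^ nP) := by
            gcongr
            · exact hL2 s hs.ge
            · exact hPn s
        _ ≤ Real.exp K * (CP * (1 + ‖s‖) ^ n) := by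
            gcongr
            · exact hone s
            · omega
        _ = _ := by ring)
  set D := (Ca + Cb) * 4 ^ n with hD
  have hs2 : ∀ s : ℂ, -1 ≤ s.re → 1 ≤ ‖s + 2‖ := fun s hs => by
    have := Complex.re_le_norm (s + 2)
    simp at this
    linarith
  -- Phragmén–Lindelöf for `f(s) / (s + 2)^n` in the strip `-1 ≤ Re s ≤ 2`
  have hPL : ∀ s : ℂ, -1 ≤ s.re → s.re ≤ 2 → ‖f s / (s + 2) ^ n‖ ≤ D := by
    have hline : ∀ (x C' : ℝ), -1 ≤ x → 0 ≤ C' → C' ≤ Ca + Cb →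
        (∀ s : ℂ, s.re = x → ‖f s‖ ≤ C' * (1 + ‖s‖) ^ n) →
        ∀ s : ℂ, s.re = x → ‖f s / (s + 2) ^ n‖ ≤ D := by
      intro x C' hx hC' hCC h s hs
      have h1 := hs2 s (by linarith)
      rw [norm_div, norm_pow, div_le_iff₀ (by positivity)]
      calc ‖f s‖ ≤ C' * (1 + ‖s‖) ^ n := h s hs
        _ ≤ (Ca + Cb) * (4 * ‖s + 2‖) ^ n := by
            gcongr
            exact one_add_norm_le (by linarith)
        _ = _ := by rw [mul_pow, hD]; ring
    intro s hs1 hs2'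
    refine PhragmenLindelof.vertical_strip (f := fun s => f s / (s + 2) ^ n) (a := -1) (b := 2)
      ?_ ⟨1, ?_, ?_⟩ (hline (-1) Ca le_rfl hCa (by linarith) ha)
      (hline 2 Cb (by norm_num) hCb (by linarith) hb) hs1 hs2'
    · refine DifferentiableOn.diffContOnCl fun z hz => ?_
      have hz' : -1 ≤ z.re := by
        have h1 := closure_mono (Set.preimage_mono (f := Complex.re) (Set.Ioo_subset_Icc_self
          (a := (-1 : ℝ)) (b := 2))) hz
        rw [(isClosed_Icc.preimage Complex.continuous_re).closure_eq] at h1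
        exact h1.1
      refine ((hf z).div (by fun_prop) ?_).differentiableWithinAt
      exact pow_ne_zero _ (norm_pos_iff.1 (by linarith [hs2 z hz']))
    · rw [lt_div_iff₀ (by norm_num)]
      linarith [Real.pi_gt_three]
    · refine ⟨A.factorial * Real.exp 2, ?_⟩
      refine Asymptotics.IsBigO.of_bound |Cf| ?_
      rw [Filter.eventually_inf_principal]
      refine Filter.Eventually.of_forall fun z hz => ?_
      have hz' : -1 < z.re ∧ z.re < 2 := hz
      have h1 := hs2 z hz'.1.le
      rw [norm_div, norm_pow, Real.norm_eq_abs, abs_of_pos (Real.exp_pos _)]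
      have h4 : ‖z‖ ≤ 2 + |z.im| := by
        refine (Complex.norm_le_abs_re_add_abs_im z).trans ?_
        have : |z.re| ≤ 2 := abs_le.2 ⟨by linarith, hz'.2.le⟩
        linarith
      have h5 : ‖z‖ ^ A ≤ A.factorial * Real.exp 2 * Real.exp (1 * |z.im|) := by
        have h6 := Real.pow_div_factorial_le_exp (2 + |z.im|) (by positivity) A
        rw [div_le_iff₀ (by positivity), Real.exp_add] at h6
        calc ‖z‖ ^ A ≤ (2 + |z.im|) ^ A := by gcongr
          _ ≤ _ := h6
          _ = _ := by ring_nf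
      calc ‖f z‖ / ‖z + 2‖ ^ n ≤ ‖f z‖ := div_le_self (norm_nonneg _) (one_le_pow₀ h1)
        _ ≤ Cf * Real.exp (‖z‖ ^ A) := hA z
        _ ≤ |Cf| * Real.exp (A.factorial * Real.exp 2 * Real.exp (1 * |z.im|)) := by
            gcongr
            exact le_abs_self _
  refine ⟨Real.exp K + D / c * 5 ^ n, max 1 t₃, n, by positivity, le_max_left _ _,
    fun s hs ht => ?_⟩
  have ht1 : 1 ≤ s.im := (le_max_left _ _).trans ht
  have ht3 : t₃ ≤ |s.im| := ((le_max_right _ _).trans ht).trans (le_abs_self _)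
  have hpow1 : 1 ≤ s.im ^ n := one_le_pow₀ ht1
  have hDc : 0 ≤ D / c * 5 ^ n := by positivity
  rcases le_total 2 s.re with h2 | h2
  · calc _ ≤ Real.exp K := hL2 s h2
      _ ≤ Real.exp K * s.im ^ n := le_mul_of_one_le_right (Real.exp_pos _).le hpow1
      _ ≤ _ := by gcongr; linarith
  · have h4 := hPL s (by linarith) h2
    have h5 := hs2 s (by linarith)
    rw [norm_div, norm_pow, div_le_iff₀ (by positivity), hfL s ht3, norm_mul] at h4
    have h6 : ‖s + 2‖ ≤ 5 * s.im := by
      refine (Complex.norm_le_abs_re_add_abs_im _).trans ?_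
      have h7 : |(s + 2).re| ≤ 4 := by
        rw [Complex.add_re, abs_le]
        constructor <;> simp <;> linarith
      have h8 : |(s + 2).im| = s.im := by
        simp; linarith
      linarith
    have h7 : ‖F.L j s‖ * c ≤ D * (5 * s.im) ^ n := by
      calc _ ≤ ‖F.L j s‖ * ‖P.eval s‖ := by gcongr; exact h₃ s ht3
        _ ≤ _ := h4
        _ ≤ _ := by gcongr
    rw [← le_div_iff₀ hc] at h7
    calc _ ≤ _ := h7
      _ = D / c * 5 ^ n * s.im ^ n := by rw [mul_pow]; ring
      _ ≤ _ := by gcongr; linarith [Real.exp_pos K]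

end LFunctionFamily

/-! ### A smoothed Perron formula on a rectangle -/

theorem integral_inv_eq_log_sub {z d : ℂ} {a b : ℝ}
    (h : ∀ x ∈ Set.uIcc a b, z + x * d ∈ Complex.slitPlane) :
    d * ∫ x in a..b, (z + x * d)⁻¹ = Complex.log (z + b * d) - Complex.log (z + a * d) := by
  rw [← intervalIntegral.integral_const_mul (r := d) (f := fun x : ℝ => (z + x * d)⁻¹)]
  refine intervalIntegral.integral_eq_sub_of_hasDerivAt
    (f := fun x : ℝ => Complex.log (z + x * d)) (fun x hx => ?_) ?_
  · have h1 : HasDerivAt (fun x : ℝ => z + (x : ℂ) * d) d x := by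
      simpa using ((Complex.ofRealCLM.hasDerivAt (x := x)).mul_const d).const_add z
    have := h1.clog_real (h x hx)
    rwa [div_eq_mul_inv] at this
  · refine ContinuousOn.intervalIntegrable (continuousOn_const.mul (ContinuousOn.inv₀ ?_ ?_))
    · fun_prop
    · exact fun x hx => Complex.slitPlane_ne_zero (h x hx)

theorem log_neg_sub_log {z : ℂ} (hz : z.im < 0) :
    Complex.log (-z) - Complex.log z = Real.pi * Complex.I := by
  rw [Complex.log, Complex.log, norm_neg, Complex.arg_neg_eq_arg_add_pi_of_im_neg hz]
  push_cast
  ring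

/-- The integral of `1/w` along the boundary of a rectangle around the origin. The primitive `log w`
serves on three sides and `log (-w)` on the left one; the two corners at which they meet
contribute `πi` each. -/
theorem integral_boundary_rect_inv {a c H : ℝ} (ha : 0 < a) (hc : 0 < c) (hH : 0 < H) :
    (∫ x : ℝ in -a..c, ((x : ℂ) + (-H : ℝ) * Complex.I)⁻¹)
      - (∫ x : ℝ in -a..c, ((x : ℂ) + H * Complex.I)⁻¹)
      + Complex.I * (∫ y : ℝ in -H..H, ((c : ℂ) + y * Complex.I)⁻¹)
      - Complex.I * (∫ y : ℝ in -H..H, (((-a : ℝ) : ℂ) + y * Complex.I)⁻¹)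
      = 2 * Real.pi * Complex.I := by
  have h1 := integral_inv_eq_log_sub (z := (-H : ℝ) * Complex.I) (d := 1) (a := -a) (b := c)
    (fun x _ => Or.inr (by simp [hH.ne']))
  have h2 := integral_inv_eq_log_sub (z := H * Complex.I) (d := 1) (a := -a) (b := c)
    (fun x _ => Or.inr (by simp [hH.ne']))
  have h3 := integral_inv_eq_log_sub (z := c) (d := Complex.I) (a := -H) (b := H)
    (fun x _ => Or.inl (by simp [hc]))
  have h4 := integral_inv_eq_log_sub (z := a) (d := -Complex.I) (a := -H) (b := H)
    (fun x _ => Or.inl (by simp [ha]))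
  have h5 : ∀ y : ℝ, (((-a : ℝ) : ℂ) + y * Complex.I)⁻¹ = -((a : ℂ) + y * -Complex.I)⁻¹ := by
    intro y
    rw [← inv_neg]
    congr 1
    push_cast
    ring
  have h6 := log_neg_sub_log (z := (a : ℂ) + H * -Complex.I) (by simp [hH])
  have h7 := log_neg_sub_log (z := (-a : ℂ) + H * -Complex.I) (by simp [hH])
  simp only [mul_one, one_mul] at h1 h2
  simp_rw [h5]
  rw [intervalIntegral.integral_neg]
  have e1 : ∀ x : ℝ, ((x : ℂ) + (-H : ℝ) * Complex.I)⁻¹ = ((-H : ℝ) * Complex.I + x)⁻¹ :=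
    fun x => by rw [add_comm]
  have e2 : ∀ x : ℝ, ((x : ℂ) + H * Complex.I)⁻¹ = (H * Complex.I + x)⁻¹ :=
    fun x => by rw [add_comm]
  simp_rw [e1, e2]
  rw [h1, h2, h3]
  have h8 : Complex.I * -∫ x in -H..H, ((a : ℂ) + x * -Complex.I)⁻¹
      = Complex.log (a + H * -Complex.I) - Complex.log (a + (-H : ℝ) * -Complex.I) := by
    rw [← h4]; ring
  rw [h8]
  have g1 : (-((a : ℂ) + H * -Complex.I)) = H * Complex.I + (-a : ℝ) := by push_cast; ring
  have g2 : (-((-a : ℂ) + H * -Complex.I)) = a + (-H : ℝ) * -Complex.I := by push_cast; ring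
  have g3 : ((-a : ℂ) + H * -Complex.I) = (-H : ℝ) * Complex.I + (-a : ℝ) := by push_cast; ring
  have g4 : (-H : ℝ) * Complex.I + (c : ℂ) = c + (-H : ℝ) * Complex.I := add_comm _ _
  have g5 : H * Complex.I + (c : ℂ) = c + H * Complex.I := add_comm _ _
  rw [g1] at h6
  rw [g2, g3] at h7
  rw [g4, g5]
  linear_combination h6 + h7

/-- The residue theorem for a simple pole at the origin, inside a rectangle. -/
theorem integral_boundary_rect_div {g : ℂ → ℂ} {U : Set ℂ} (hU : IsOpen U)
    (hg : DifferentiableOn ℂ g U) {a c H : ℝ} (ha : 0 < a) (hc : 0 < c) (hH : 0 < H)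
    (hsub : Set.Icc (-a) c ×ℂ Set.Icc (-H) H ⊆ U) :
    (∫ x : ℝ in -a..c, g (x + (-H : ℝ) * Complex.I) / ((x : ℂ) + (-H : ℝ) * Complex.I))
      - (∫ x : ℝ in -a..c, g (x + H * Complex.I) / ((x : ℂ) + H * Complex.I))
      + Complex.I * (∫ y : ℝ in -H..H, g (c + y * Complex.I) / ((c : ℂ) + y * Complex.I))
      - Complex.I * (∫ y : ℝ in -H..H,
          g ((-a : ℝ) + y * Complex.I) / (((-a : ℝ) : ℂ) + y * Complex.I))
      = 2 * Real.pi * Complex.I * g 0 := by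
  have h0 : (0 : ℂ) ∈ U := hsub (by
    rw [Complex.mem_reProdIm]; simp [ha.le, hc.le, hH.le])
  have hd : DifferentiableOn ℂ (dslope g 0) U :=
    (Complex.differentiableOn_dslope (hU.mem_nhds h0)).2 hg
  have hrect := Complex.integral_boundary_rect_eq_zero_of_differentiableOn (dslope g 0)
    (((-a : ℝ) : ℂ) + (-H : ℝ) * Complex.I) ((c : ℂ) + H * Complex.I) (hd.mono (by
      simpa [Set.uIcc_of_le (by linarith : -a ≤ c), Set.uIcc_of_le (by linarith : -H ≤ H)]
        using hsub))
  have hsplit : ∀ (z d : ℂ) (l u : ℝ), l ≤ u →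
      (∀ x ∈ Set.Icc l u, z + x * d ∈ U ∧ z + x * d ≠ 0) →
      ∫ x in l..u, dslope g 0 (z + x * d)
        = (∫ x in l..u, g (z + x * d) / (z + x * d)) - g 0 * ∫ x in l..u, (z + x * d)⁻¹ := by
    intro z d l u hlu h
    have hc1 : ContinuousOn (fun x : ℝ => z + (x : ℂ) * d) (Set.uIcc l u) := by fun_prop
    have hc2 : ContinuousOn (fun x : ℝ => (z + (x : ℂ) * d)⁻¹) (Set.uIcc l u) :=
      hc1.inv₀ fun x hx => (h x (by rwa [Set.uIcc_of_le hlu] at hx)).2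
    have hc3 : ContinuousOn (fun x : ℝ => g (z + (x : ℂ) * d)) (Set.uIcc l u) :=
      hg.continuousOn.comp hc1 fun x hx => (h x (by rwa [Set.uIcc_of_le hlu] at hx)).1
    rw [← intervalIntegral.integral_const_mul, ← intervalIntegral.integral_sub]
    · refine intervalIntegral.integral_congr fun x hx => ?_
      rw [dslope_of_ne _ (h x (by rwa [Set.uIcc_of_le hlu] at hx)).2, slope_def_field]
      ring
    · simp_rw [div_eq_mul_inv]
      exact (hc3.mul hc2).intervalIntegrable
    · exact (continuousOn_const.mul hc2).intervalIntegrable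
  have hmem : ∀ x y : ℝ, x ∈ Set.Icc (-a) c → y ∈ Set.Icc (-H) H →
      (x : ℂ) + y * Complex.I ∈ U := fun x y hx hy =>
    hsub (by rw [Complex.mem_reProdIm]; simpa using ⟨hx, hy⟩)
  have hac : -a ≤ c := by linarith
  have hHH : -H ≤ H := by linarith
  have s1 := hsplit ((-H : ℝ) * Complex.I) 1 (-a) c hac (fun x hx => by
    rw [mul_one, add_comm]
    exact ⟨hmem x (-H) hx ⟨le_rfl, hHH⟩, fun h => by simpa [hH.ne'] using congrArg Complex.im h⟩)
  have s2 := hsplit (H * Complex.I) 1 (-a) c hac (fun x hx => by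
    rw [mul_one, add_comm]
    exact ⟨hmem x H hx ⟨hHH, le_rfl⟩, fun h => by simpa [hH.ne'] using congrArg Complex.im h⟩)
  have s3 := hsplit c Complex.I (-H) H hHH (fun y hy =>
    ⟨hmem c y ⟨hac, le_rfl⟩ hy, fun h => by simpa [hc.ne'] using congrArg Complex.re h⟩)
  have s4 := hsplit (-a : ℝ) Complex.I (-H) H hHH (fun y hy =>
    ⟨hmem (-a) y ⟨le_rfl, hac⟩ hy, fun h => by simpa [ha.ne'] using congrArg Complex.re h⟩)
  simp only [mul_one] at s1 s2
  have hres := integral_boundary_rect_inv ha hc hH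
  simp only [add_comm _ (_ * Complex.I)] at s1 s2 s3 s4 hrect hres ⊢
  simp only [Complex.add_re, Complex.add_im, Complex.mul_re, Complex.mul_im, Complex.ofReal_re,
    Complex.ofReal_im, Complex.I_re, Complex.I_im, mul_zero, mul_one, sub_zero, zero_add,
    add_zero, smul_eq_mul] at hrect
  rw [s1, s2, s3, s4] at hrect
  linear_combination hrect + g 0 * hres

/-- The kernel `e^{wy + w²}`, which decays rapidly in vertical strips. -/
noncomputable def gaussKernel (y : ℝ) (w : ℂ) : ℂ := Complex.exp (w * y + w ^ 2)

theorem norm_gaussKernel (y x v : ℝ) : ‖gaussKernel y (x + v * Complex.I)‖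
    = Real.exp (x * y + x ^ 2) * Real.exp (-v ^ 2) := by
  rw [gaussKernel, Complex.norm_exp, ← Real.exp_add]
  congr 1
  simp [sq]
  ring

theorem differentiable_gaussKernel (y : ℝ) : Differentiable ℂ (gaussKernel y) := by
  unfold gaussKernel
  fun_prop

/-- A smooth cutoff: the truncation at height `H` of `(2πi)⁻¹ ∫ e^{wy + w²} dw / w` over the line
`Re w = 1`. It is close to `1` for `y` large and close to `0` for `-y` large. -/
noncomputable def smoothCutoff (H y : ℝ) : ℂ :=
  (2 * Real.pi : ℂ)⁻¹ * ∫ v in -H..H,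
    gaussKernel y ((1 : ℝ) + v * Complex.I) / ((1 : ℝ) + v * Complex.I)

/-- The constant `2` exceeds the Gaussian integral `√π`. -/
theorem norm_integral_gauss_le {f : ℝ → ℂ} {H B : ℝ} (hH : 0 ≤ H) (hB : 0 ≤ B)
    (hf : ∀ v ∈ Set.Icc (-H) H, ‖f v‖ ≤ B * Real.exp (-v ^ 2)) :
    ‖∫ v in -H..H, f v‖ ≤ 2 * B := by
  have hint : Integrable fun v : ℝ => B * Real.exp (-v ^ 2) := by
    have := (integrable_exp_neg_mul_sq (b := 1) one_pos).const_mul B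
    simpa using this
  have h1 : ‖∫ v in -H..H, f v‖ ≤ ∫ v in -H..H, B * Real.exp (-v ^ 2) :=
    intervalIntegral.norm_integral_le_of_norm_le (by linarith)
      (ae_of_all _ fun v hv => hf v (Set.Ioc_subset_Icc_self hv)) hint.intervalIntegrable
  have h2 : ∫ v in -H..H, B * Real.exp (-v ^ 2) ≤ ∫ v, B * Real.exp (-v ^ 2) := by
    rw [intervalIntegral.integral_of_le (by linarith)]
    exact setIntegral_le_integral hint (ae_of_all _ fun v => by positivity)
  have h3 : ∫ v : ℝ, Real.exp (-v ^ 2) = √Real.pi := by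
    simpa using integral_gaussian 1
  rw [integral_const_mul, h3] at h2
  have h4 : √Real.pi ≤ 2 := by
    rw [Real.sqrt_le_left (by norm_num)]
    linarith [Real.pi_le_four]
  nlinarith

theorem norm_inv_two_pi : ‖(2 * Real.pi : ℂ)⁻¹‖ = (2 * Real.pi)⁻¹ := by
  rw [norm_inv, norm_mul, Complex.norm_real, Complex.norm_ofNat, Real.norm_eq_abs,
    abs_of_pos Real.pi_pos]

/-- Shifting the contour: the smoothed integral over `Re w = 1` recovers `g 0`. -/
theorem norm_sub_integral_gaussKernel_le {g : ℂ → ℂ} {U : Set ℂ} (hU : IsOpen U)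
    (hg : DifferentiableOn ℂ g U) {δ H y B : ℝ} (hδ : 0 < δ) (hδ1 : δ ≤ 1) (hH : 1 ≤ H)
    (hy : 0 ≤ y) (hsub : Set.Icc (-δ) 1 ×ℂ Set.Icc (-H) H ⊆ U) (hB : 0 ≤ B)
    (hgB : ∀ w ∈ Set.Icc (-δ) 1 ×ℂ Set.Icc (-H) H, ‖g w‖ ≤ B) :
    ‖g 0 - (2 * Real.pi : ℂ)⁻¹ * ∫ v in -H..H, g ((1 : ℝ) + v * Complex.I) *
        gaussKernel y ((1 : ℝ) + v * Complex.I) / ((1 : ℝ) + v * Complex.I)‖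
      ≤ B * (Real.exp (-δ * y) / δ + Real.exp (y + 1 - H ^ 2)) := by
  have hres := integral_boundary_rect_div hU (hg.mul (differentiable_gaussKernel y).differentiableOn)
    hδ one_pos (by linarith : 0 < H) hsub
  simp only [Pi.mul_apply] at hres
  have hK0 : gaussKernel y 0 = 1 := by simp [gaussKernel]
  rw [hK0, mul_one] at hres
  have hmem : ∀ x v : ℝ, x ∈ Set.Icc (-δ) 1 → v ∈ Set.Icc (-H) H →
      ‖g (x + v * Complex.I)‖ ≤ B := fun x v hx hv =>
    hgB _ (by rw [Complex.mem_reProdIm]; simpa using ⟨hx, hv⟩)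
  have hH0 : 0 < H := by linarith
  -- the horizontal edges
  have hedge : ∀ h : ℝ, |h| = H → ‖∫ x : ℝ in -δ..1, g (x + h * Complex.I) *
      gaussKernel y (x + h * Complex.I) / ((x : ℂ) + h * Complex.I)‖
        ≤ 2 * (B * Real.exp (y + 1 - H ^ 2)) := by
    intro h hh
    have hhI : h ∈ Set.Icc (-H) H := abs_le.1 hh.le
    have h1 := intervalIntegral.norm_integral_le_of_norm_le_const (a := -δ) (b := 1)
      (C := B * Real.exp (y + 1 - H ^ 2)) (f := fun x : ℝ => g (x + h * Complex.I) *
      gaussKernel y (x + h * Complex.I) / ((x : ℂ) + h * Complex.I)) (fun x hx => by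
        rw [Set.uIoc_of_le (by linarith)] at hx
        have hx' : x ∈ Set.Icc (-δ) 1 := Set.Ioc_subset_Icc_self hx
        have hden : 1 ≤ ‖(x : ℂ) + h * Complex.I‖ := by
          have := Complex.abs_im_le_norm ((x : ℂ) + h * Complex.I)
          simp only [Complex.add_im, Complex.ofReal_im, Complex.mul_im, Complex.ofReal_re,
            Complex.I_im, Complex.I_re, mul_zero, mul_one, add_zero, zero_add, hh] at this
          linarith
        rw [norm_div, norm_mul, norm_gaussKernel, div_le_iff₀ (by linarith), ← Real.exp_add]
        have hx2 : x ^ 2 ≤ 1 := by nlinarith [hx'.1, hx'.2]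
        have hhh : h ^ 2 = H ^ 2 := by rw [← sq_abs, hh]
        calc _ ≤ B * Real.exp (y + 1 - H ^ 2) := by
              gcongr
              · exact hmem x h hx' hhI
              · nlinarith [hx'.2]
          _ ≤ _ := le_mul_of_one_le_right (by positivity) hden)
    refine h1.trans ?_
    rw [abs_of_pos (by linarith), mul_comm]
    have : 0 ≤ B * Real.exp (y + 1 - H ^ 2) := by positivity
    nlinarith
  have hleft : ‖∫ v in -H..H, g ((-δ : ℝ) + v * Complex.I) *
      gaussKernel y ((-δ : ℝ) + v * Complex.I) / (((-δ : ℝ) : ℂ) + v * Complex.I)‖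
        ≤ 2 * (B * (Real.exp 1 * Real.exp (-δ * y) / δ)) := by
    refine norm_integral_gauss_le hH0.le (by positivity) fun v hv => ?_
    have hden : δ ≤ ‖((-δ : ℝ) : ℂ) + v * Complex.I‖ := by
      have := Complex.abs_re_le_norm (((-δ : ℝ) : ℂ) + v * Complex.I)
      simpa [abs_of_pos hδ] using this
    rw [norm_div, norm_mul, norm_gaussKernel]
    have h1 := hmem (-δ) v ⟨le_rfl, by linarith⟩ hv
    have h2 : Real.exp (-δ * y + (-δ) ^ 2) ≤ Real.exp 1 * Real.exp (-δ * y) := by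
      rw [← Real.exp_add 1]
      exact Real.exp_le_exp.2 (by nlinarith)
    calc _ ≤ B * (Real.exp (-δ * y + (-δ) ^ 2) * Real.exp (-v ^ 2)) / δ := by gcongr
      _ ≤ B * ((Real.exp 1 * Real.exp (-δ * y)) * Real.exp (-v ^ 2)) / δ := by gcongr
      _ = _ := by ring
  have h1 := hedge H (abs_of_pos hH0)
  have h2 := hedge (-H) (by rw [abs_neg, abs_of_pos hH0])
  set I₁ := ∫ x : ℝ in -δ..1, g (x + (-H : ℝ) * Complex.I) *
      gaussKernel y (x + (-H : ℝ) * Complex.I) / ((x : ℂ) + (-H : ℝ) * Complex.I) with hI₁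
  set I₂ := ∫ x : ℝ in -δ..1, g (x + H * Complex.I) *
      gaussKernel y (x + H * Complex.I) / ((x : ℂ) + H * Complex.I) with hI₂
  set I₃ := ∫ v in -H..H, g ((1 : ℝ) + v * Complex.I) *
        gaussKernel y ((1 : ℝ) + v * Complex.I) / ((1 : ℝ) + v * Complex.I) with hI₃
  set I₄ := ∫ v in -H..H, g ((-δ : ℝ) + v * Complex.I) *
      gaussKernel y ((-δ : ℝ) + v * Complex.I) / (((-δ : ℝ) : ℂ) + v * Complex.I) with hI₄
  have hpi : (2 * Real.pi : ℂ) ≠ 0 := by simp [Real.pi_ne_zero]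
  have heq : g 0 - (2 * Real.pi : ℂ)⁻¹ * I₃
      = (2 * Real.pi : ℂ)⁻¹ * (-Complex.I * I₁ + Complex.I * I₂ - I₄) := by
    field_simp
    linear_combination Complex.I * hres + (2 * Real.pi * g 0 - I₃ + I₄) * Complex.I_sq
  rw [heq, norm_mul, norm_inv_two_pi, inv_mul_le_iff₀ (by positivity)]
  have he : Real.exp 1 ≤ 3 := by linarith [Real.exp_one_lt_d9]
  have hp := Real.pi_gt_three
  set E := B * Real.exp (y + 1 - H ^ 2) with hE
  set D := B * (Real.exp (-δ * y) / δ) with hD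
  have hE0 : 0 ≤ E := by positivity
  have hD0 : 0 ≤ D := by positivity
  have h3 : B * (Real.exp 1 * Real.exp (-δ * y) / δ) ≤ 3 * D := by
    calc _ = Real.exp 1 * D := by rw [hD]; ring
      _ ≤ _ := by gcongr
  calc ‖-Complex.I * I₁ + Complex.I * I₂ - I₄‖ ≤ ‖I₁‖ + ‖I₂‖ + ‖I₄‖ := by
        refine (norm_sub_le _ _).trans (add_le_add_left ((norm_add_le _ _).trans ?_) _)
        simp
    _ ≤ 2 * E + 2 * E + 2 * (3 * D) := by linarith
    _ ≤ 2 * Real.pi * (D + E) := by nlinarith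
    _ = _ := by rw [hD, hE]; ring

theorem norm_smoothCutoff_le_exp {H y : ℝ} (hH : 0 ≤ H) : ‖smoothCutoff H y‖ ≤ Real.exp y := by
  have h1 : ‖∫ v in -H..H, gaussKernel y ((1 : ℝ) + v * Complex.I) / ((1 : ℝ) + v * Complex.I)‖
      ≤ 2 * (Real.exp 1 * Real.exp y) := by
    refine norm_integral_gauss_le hH (by positivity) fun v hv => ?_
    have hden : 1 ≤ ‖((1 : ℝ) : ℂ) + v * Complex.I‖ := by
      have := Complex.abs_re_le_norm (((1 : ℝ) : ℂ) + v * Complex.I)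
      simpa using this
    rw [norm_div, norm_gaussKernel, ← Real.exp_add 1]
    have h2 : (1 : ℝ) * y + 1 ^ 2 = 1 + y := by ring
    rw [h2]
    exact div_le_self (by positivity) hden
  rw [smoothCutoff, norm_mul, norm_inv_two_pi, inv_mul_le_iff₀ (by positivity)]
  refine h1.trans ?_
  have he : Real.exp 1 ≤ 3 := by linarith [Real.exp_one_lt_d9]
  have hp := Real.pi_gt_three
  rw [← mul_assoc]
  gcongr
  linarith

/-- Shifting the contour to `Re w = -1` picks up the residue `1` at the origin. -/
theorem norm_smoothCutoff_sub_one_le {H y : ℝ} (hy : 0 ≤ y) (hH : 1 ≤ H)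
    (hyH : 2 * y + 1 ≤ H ^ 2) : ‖smoothCutoff H y - 1‖ ≤ 2 * Real.exp (-y) := by
  have h := norm_sub_integral_gaussKernel_le (g := fun _ => 1) isOpen_univ
    (differentiableOn_const 1) (δ := 1) one_pos le_rfl hH hy (Set.subset_univ _) zero_le_one
    (fun w _ => by simp)
  simp only [one_mul] at h
  rw [norm_sub_rev, smoothCutoff]
  refine h.trans ?_
  have : Real.exp (y + 1 - H ^ 2) ≤ Real.exp (-y) := Real.exp_le_exp.2 (by linarith)
  rw [neg_one_mul, div_one]
  linarith

theorem norm_smoothCutoff_le {H y : ℝ} (hH : 1 ≤ H) (hyH : 2 * y + 1 ≤ H ^ 2) :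
    ‖smoothCutoff H y‖ ≤ 3 := by
  rcases le_total 0 y with hy | hy
  · have h1 := norm_smoothCutoff_sub_one_le hy hH hyH
    have h2 : Real.exp (-y) ≤ 1 := Real.exp_le_one_iff.2 (by linarith)
    have h3 := norm_le_norm_sub_add (smoothCutoff H y) 1
    rw [norm_one] at h3
    linarith
  · have := norm_smoothCutoff_le_exp (H := H) (y := y) (by linarith)
    have h2 : Real.exp y ≤ 1 := Real.exp_le_one_iff.2 hy
    linarith

/-! ### Smoothed prime polynomials -/

theorem logTerm_add {d : ℕ} (α : Fin d → Nat.Primes → ℂ) (s w : ℂ) (x : Nat.Primes × ℕ) :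
    logTerm α (s + w) x
      = logTerm α s x * Complex.exp (-(((x.2 + 1) * Real.log (x.1 : ℕ) : ℝ) : ℂ) * w) := by
  rw [logTerm, logTerm, mul_add, Complex.cpow_add _ _ x.1.cast_ne_zero, div_mul_eq_div_div,
    div_eq_mul_inv _ (_ ^ (((x.2 : ℂ) + 1) * w)), Complex.cpow_def_of_ne_zero x.1.cast_ne_zero (((x.2 : ℂ) + 1) * w),
    ← Complex.exp_neg, ← Complex.natCast_log]
  congr 2
  push_cast
  ring

/-- With `logTerm_add`: a Dirichlet series term at `s + w` times the kernel is the term at `s` times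
the kernel at a shifted argument. -/
theorem gaussKernel_sub (Y L : ℝ) (w : ℂ) :
    gaussKernel (Y - L) w = gaussKernel Y w * Complex.exp (-(L : ℂ) * w) := by
  rw [gaussKernel, gaussKernel, ← Complex.exp_add]
  congr 1
  push_cast
  ring

/-- The part of the smoothed Dirichlet series of the logarithm that is supported on the powers
`p^(k+1)` of the primes `p ≤ e^{4Y}`. -/
noncomputable def smoothPrimePoly {d : ℕ} (α : Fin d → Nat.Primes → ℂ) (H Y : ℝ) (k : ℕ) (s : ℂ) :
    ℂ :=
  ∑ p ∈ primesUpTo (Real.exp (4 * Y)),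
    logTerm α s (p, k) * smoothCutoff H (Y - (k + 1) * Real.log (p : ℕ))

theorem smoothPrimePoly_add_mul_I {d : ℕ} (α : Fin d → Nat.Primes → ℂ) (H Y : ℝ) (k : ℕ) (s : ℂ)
    (t : ℝ) : smoothPrimePoly α H Y k (s + t * Complex.I)
      = ∑ p ∈ primesUpTo (Real.exp (4 * Y)),
          logTerm α s (p, k) * smoothCutoff H (Y - (k + 1) * Real.log (p : ℕ)) *
            Complex.exp (((-((k + 1 : ℝ) * Real.log (p : ℕ)) * t : ℝ) : ℂ) * Complex.I) := by
  refine Finset.sum_congr rfl fun p _ => ?_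
  rw [logTerm_add, mul_right_comm]
  congr 2
  push_cast
  ring

namespace LFunctionFamily

variable {J : ℕ} (F : LFunctionFamily J) (j : Fin J)

/-- The smoothed integral of the logarithm over `Re w = 1` as a smoothed Dirichlet series. -/
theorem hasSum_logTerm_mul_smoothCutoff {s : ℂ} (hs : 1 / 2 ≤ s.re) {H : ℝ} (hH : 0 ≤ H) (Y : ℝ) :
    HasSum (fun x : Nat.Primes × ℕ =>
        logTerm (F.α j) s x * smoothCutoff H (Y - (x.2 + 1) * Real.log (x.1 : ℕ)))
      ((2 * Real.pi : ℂ)⁻¹ * ∫ v in -H..H,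
        logDirichletSeries (F.α j) (s + ((1 : ℝ) + v * Complex.I)) *
          gaussKernel Y ((1 : ℝ) + v * Complex.I) / ((1 : ℝ) + v * Complex.I)) := by
  have hHH : -H ≤ H := by linarith
  have hden : ∀ v : ℝ, 1 ≤ ‖((1 : ℝ) : ℂ) + v * Complex.I‖ := fun v => by
    have := Complex.abs_re_le_norm (((1 : ℝ) : ℂ) + v * Complex.I)
    simpa using this
  have hden0 : ∀ v : ℝ, ((1 : ℝ) : ℂ) + v * Complex.I ≠ 0 := fun v =>
    norm_pos_iff.1 (by linarith [hden v])
  set f : Nat.Primes × ℕ → ℝ → ℂ := fun x v => logTerm (F.α j) s x *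
    (gaussKernel (Y - (x.2 + 1) * Real.log (x.1 : ℕ)) ((1 : ℝ) + v * Complex.I) /
      ((1 : ℝ) + v * Complex.I)) with hf
  have hf' : ∀ x v, f x v = logTerm (F.α j) (s + ((1 : ℝ) + v * Complex.I)) x *
      (gaussKernel Y ((1 : ℝ) + v * Complex.I) / ((1 : ℝ) + v * Complex.I)) := by
    intro x v
    simp only [hf]
    rw [logTerm_add, gaussKernel_sub]
    ring
  have hcont : ∀ x, Continuous (f x) := fun x => by
    refine continuous_const.mul (Continuous.div ?_ (by fun_prop) hden0)
    exact (differentiable_gaussKernel _).continuous.comp (by fun_prop)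
  have hsum := F.summable_primePowerCoeff j (c := 5 / 4) (by norm_num)
  have hfbound : ∀ x v, ‖f x v‖ ≤ ‖primePowerCoeff (F.α j) x.1 (x.2 + 1)‖ *
      ((x.1 : ℕ) : ℝ) ^ (-((x.2 + 1) * (5 / 4 : ℝ))) * Real.exp (Y + 1) := by
    intro x v
    rw [hf', norm_mul, norm_div, norm_gaussKernel]
    have hre : 5 / 4 ≤ (s + ((1 : ℝ) + v * Complex.I)).re := by
      have : (s + ((1 : ℝ) + v * Complex.I)).re = s.re + 1 := by simp
      rw [this]; linarith
    gcongr
    · exact norm_logTerm_le _ hre x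
    · refine (div_le_self (by positivity) (hden v)).trans ?_
      rw [← Real.exp_add]
      exact Real.exp_le_exp.2 (by nlinarith [sq_nonneg v])
  have hS : HasSum (fun x => ∫ v in Set.Ioc (-H) H, f x v)
      (∫ v in Set.Ioc (-H) H, ∑' x, f x v) := by
    refine hasSum_integral_of_summable_integral_norm
      (fun x => (hcont x).integrableOn_Ioc) ?_
    refine Summable.of_nonneg_of_le (fun x => integral_nonneg fun v => norm_nonneg _) (fun x => ?_)
      ((hsum.mul_right (Real.exp (Y + 1))).mul_right (2 * H))
    calc ∫ v in Set.Ioc (-H) H, ‖f x v‖ ≤ ∫ v in Set.Ioc (-H) H,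
          (‖primePowerCoeff (F.α j) x.1 (x.2 + 1)‖ *
            ((x.1 : ℕ) : ℝ) ^ (-((x.2 + 1) * (5 / 4 : ℝ))) * Real.exp (Y + 1)) :=
          setIntegral_mono (hcont x).norm.integrableOn_Ioc continuous_const.integrableOn_Ioc
            (hfbound x)
      _ = _ := by
          rw [setIntegral_const, Measure.real, Real.volume_Ioc, ENNReal.toReal_ofReal (by linarith),
            smul_eq_mul]
          ring
  have hS2 := hS.mul_left ((2 * Real.pi : ℂ)⁻¹)
  have hval : (∫ v in Set.Ioc (-H) H, ∑' x, f x v) = ∫ v in -H..H,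
        logDirichletSeries (F.α j) (s + ((1 : ℝ) + v * Complex.I)) *
          gaussKernel Y ((1 : ℝ) + v * Complex.I) / ((1 : ℝ) + v * Complex.I) := by
    rw [intervalIntegral.integral_of_le hHH]
    refine setIntegral_congr_fun measurableSet_Ioc fun v _ => ?_
    have hre : 1 < (s + ((1 : ℝ) + v * Complex.I)).re := by
      have : (s + ((1 : ℝ) + v * Complex.I)).re = s.re + 1 := by simp
      rw [this]; linarith
    simp only [hf', tsum_mul_right]
    rw [F.logDirichletSeries_eq_tsum j hre, mul_div_assoc]
  rw [hval] at hS2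
  refine hS2.congr_fun fun x => ?_
  rw [smoothCutoff, intervalIntegral.integral_of_le hHH]
  simp only [hf]
  rw [integral_const_mul]
  ring

/-- The index `k = x.2` stands for the exponent `k + 1`, so that the sum is over cubes and higher
powers. -/
theorem summable_indicator_primePowerCoeff :
    Summable fun x : Nat.Primes × ℕ => if 2 ≤ x.2 then ‖primePowerCoeff (F.α j) x.1 (x.2 + 1)‖ *
      ((x.1 : ℕ) : ℝ) ^ (-((x.2 + 1) * (1 / 2 : ℝ))) else 0 := by
  have hinj : Function.Injective (fun x : Nat.Primes × ℕ => (x.1, x.2 + 2)) := by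
    rintro ⟨p, k⟩ ⟨q, l⟩ h
    simp only [Prod.mk.injEq, Nat.add_right_cancel_iff] at h
    exact Prod.ext h.1 h.2
  rw [← hinj.summable_iff]
  · refine (F.summable_primePowerCoeff_add_three j).congr fun x => ?_
    simp only [Function.comp]
    rw [if_pos (by omega)]
    push_cast
    congr 3
    ring
  · rintro ⟨p, k⟩ hx
    refine if_neg fun h => hx ⟨(p, k - 2), ?_⟩
    simp only [Prod.mk.injEq, true_and]
    simp only at h
    omega

/-- The smoothed Dirichlet series is carried by the primes and the squares of primes `p ≤ e^{4Y}`, up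
to a bounded error. Beyond `e^{4Y}` the cutoff at `Y - (k+1) log p` saves `p^{-3(k+1)/4}`, which
moves the term from the line `1/2` to the line `5/4`. -/
theorem exists_norm_sub_smoothPrimePoly_le : ∃ D : ℝ, 0 ≤ D ∧ ∀ (s : ℂ) (H Y : ℝ), 1 / 2 ≤ s.re →
    1 ≤ H → 0 ≤ Y → 2 * Y + 1 ≤ H ^ 2 → ∀ V : ℂ,
    HasSum (fun x : Nat.Primes × ℕ =>
        logTerm (F.α j) s x * smoothCutoff H (Y - (x.2 + 1) * Real.log (x.1 : ℕ))) V →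
    ‖V - (smoothPrimePoly (F.α j) H Y 0 s + smoothPrimePoly (F.α j) H Y 1 s)‖ ≤ D := by
  classical
  obtain ⟨D₁, hD₁⟩ := F.summable_primePowerCoeff j (c := 5 / 4) (by norm_num)
  obtain ⟨D₂, hD₂⟩ := F.summable_indicator_primePowerCoeff j
  have hM := hD₁.add (hD₂.mul_left 3)
  refine ⟨D₁ + 3 * D₂, hM.nonneg fun x => ?_, fun s H Y hs hH hY hYH V hV => ?_⟩
  · split_ifs <;> positivity
  set f : Nat.Primes × ℕ → ℂ := fun x =>
    logTerm (F.α j) s x * smoothCutoff H (Y - (x.2 + 1) * Real.log (x.1 : ℕ)) with hf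
  set A := primesUpTo (Real.exp (4 * Y)) ×ˢ Finset.range 2 with hA
  have h1 : HasSum (fun x => if x ∈ A then f x else 0) (∑ x ∈ A, f x) := by
    have : HasSum (fun x => if x ∈ A then f x else 0) (∑ x ∈ A, if x ∈ A then f x else 0) :=
      hasSum_sum_of_ne_finset_zero fun x hx => if_neg hx
    rwa [Finset.sum_congr rfl fun x hx => if_pos hx] at this
  have h2 : ∑ x ∈ A, f x
      = smoothPrimePoly (F.α j) H Y 0 s + smoothPrimePoly (F.α j) H Y 1 s := by
    rw [hA, Finset.sum_product, smoothPrimePoly, smoothPrimePoly, ← Finset.sum_add_distrib]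
    refine Finset.sum_congr rfl fun p _ => ?_
    rw [Finset.sum_range_succ, Finset.sum_range_one]
  rw [← h2]
  refine (hV.sub h1).norm_le_of_bounded hM fun x => ?_
  obtain ⟨p, k⟩ := x
  have hp := p.cast_pos
  have hp1 : 1 ≤ ((p : ℕ) : ℝ) := by linarith [p.two_le_cast]
  have hlogp : 0 ≤ Real.log (p : ℕ) := Real.log_nonneg hp1
  have hterm := norm_logTerm_le (F.α j) hs (p, k)
  simp only at hterm ⊢
  have hnn1 : 0 ≤ ‖primePowerCoeff (F.α j) p (k + 1)‖ *
      ((p : ℕ) : ℝ) ^ (-((k + 1) * (5 / 4 : ℝ))) := by positivity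
  have hnn2 : 0 ≤ ‖primePowerCoeff (F.α j) p (k + 1)‖ *
      ((p : ℕ) : ℝ) ^ (-((k + 1) * (1 / 2 : ℝ))) := by positivity
  split_ifs with hmem hk hk
  · rw [sub_self, norm_zero]; positivity
  · rw [sub_self, norm_zero]; positivity
  · rw [sub_zero, norm_mul]
    have hω : ‖smoothCutoff H (Y - (k + 1) * Real.log (p : ℕ))‖ ≤ 3 := by
      refine norm_smoothCutoff_le hH ?_
      have : 0 ≤ ((k : ℝ) + 1) * Real.log (p : ℕ) := by positivity
      linarith
    calc _ ≤ (‖primePowerCoeff (F.α j) p (k + 1)‖ *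
          ((p : ℕ) : ℝ) ^ (-((k + 1) * (1 / 2 : ℝ)))) * 3 := by gcongr
      _ ≤ _ := by linarith
  · rw [sub_zero, norm_mul, mul_zero, add_zero]
    have hpY : 4 * Y < Real.log (p : ℕ) := by
      rw [Real.lt_log_iff_exp_lt hp]
      by_contra hcon
      refine hmem (Finset.mem_product.2 ⟨?_, Finset.mem_range.2 (by omega)⟩)
      rw [mem_primesUpTo (Real.exp_pos _).le]
      exact not_lt.1 hcon
    have hω : ‖smoothCutoff H (Y - (k + 1) * Real.log (p : ℕ))‖
        ≤ ((p : ℕ) : ℝ) ^ (-((k + 1) * (3 / 4 : ℝ))) := by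
      refine (norm_smoothCutoff_le_exp (by linarith)).trans ?_
      rw [Real.rpow_def_of_pos hp]
      apply Real.exp_le_exp.2
      have : 0 ≤ (k : ℝ) * Real.log (p : ℕ) := by positivity
      nlinarith
    calc _ ≤ (‖primePowerCoeff (F.α j) p (k + 1)‖ *
          ((p : ℕ) : ℝ) ^ (-((k + 1) * (1 / 2 : ℝ)))) *
            ((p : ℕ) : ℝ) ^ (-((k + 1) * (3 / 4 : ℝ))) := by gcongr
      _ = _ := by
          rw [mul_assoc, ← Real.rpow_add hp]
          congr 2
          ring

/-- Moments of the polynomial over the primes, whose variance is `ξ log Y + O(1)`. -/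
theorem exists_integral_norm_smoothPrimePoly_zero_le : ∃ C Y₀ : ℝ, ∀ (σ H Y T : ℝ) (k : ℕ),
    1 / 2 ≤ σ → 1 ≤ H → Y₀ ≤ Y → 0 ≤ Y → 2 * Y + 1 ≤ H ^ 2 → Real.exp (4 * Y) ^ (2 * k) ≤ T →
    ∫ t in T..2 * T, ‖smoothPrimePoly (F.α j) H Y 0 (σ + t * Complex.I)‖ ^ (2 * k)
      ≤ 3 * T * k.factorial * (F.ξ j * Real.log Y + C) ^ k := by
  obtain ⟨C, Y₀, h⟩ := F.exists_sum_weighted_sq_primePowerCoeff_le j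
  refine ⟨C, Y₀, fun σ H Y T k hσ hH hY hY0 hYH hT => ?_⟩
  simp_rw [smoothPrimePoly_add_mul_I]
  have hT0 : 0 ≤ T := le_trans (by positivity) hT
  refine (integral_norm_pow_primePolynomial_le _ (fun p => logTerm (F.α j) σ (p, 0) *
    smoothCutoff H (Y - ((0 : ℕ) + 1) * Real.log (p : ℕ))) (r := (0 : ℕ) + 1) (by simp)
    (Real.one_le_exp (by linarith))
    (fun p hp => (mem_primesUpTo (Real.exp_pos _).le).1 hp) hT).trans ?_
  gcongr
  refine le_trans (Finset.sum_le_sum fun p hp => ?_)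
    (h Y hY (fun p => ‖smoothCutoff H (Y - Real.log (p : ℕ))‖ ^ 2) (fun p => ?_) fun p hp => ?_)
  · have hp1 : 1 ≤ ((p : ℕ) : ℝ) := by linarith [p.two_le_cast]
    have h1 := norm_logTerm_le (F.α j) (s := (σ : ℂ)) (c := 1 / 2) hσ (p, 0)
    simp only [Nat.cast_zero, zero_add, one_mul] at h1 ⊢
    rw [norm_mul, mul_pow]
    gcongr
    calc ‖logTerm (F.α j) σ (p, 0)‖ ^ 2
        ≤ (‖primePowerCoeff (F.α j) p 1‖ * ((p : ℕ) : ℝ) ^ (-(1 / 2 : ℝ))) ^ 2 := by gcongr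
      _ = _ := by
          rw [mul_pow, ← Real.rpow_mul_natCast p.cast_pos.le, div_eq_mul_inv]
          norm_num [Real.rpow_neg_one]
          rfl
  · have hlogp : 0 ≤ Real.log (p : ℕ) := Real.log_nonneg (by linarith [p.two_le_cast])
    have := norm_smoothCutoff_le (H := H) (y := Y - Real.log (p : ℕ)) hH (by linarith)
    nlinarith [norm_nonneg (smoothCutoff H (Y - Real.log (p : ℕ)))]
  · have hlogp : 0 ≤ Real.log (p : ℕ) := Real.log_nonneg (by linarith [p.two_le_cast])
    have h1 := norm_smoothCutoff_sub_one_le (H := H) (y := Y - Real.log (p : ℕ)) (by linarith) hH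
      (by linarith)
    have h2 := norm_le_norm_sub_add (smoothCutoff H (Y - Real.log (p : ℕ))) 1
    rw [norm_one] at h2
    have h3 : Real.exp (-(Y - Real.log (p : ℕ))) ≤ Real.exp (-(Y / 2)) :=
      Real.exp_le_exp.2 (by linarith)
    have h4 : Real.exp (-(Y / 2)) ≤ 1 := Real.exp_le_one_iff.2 (by linarith)
    have h5 : ‖smoothCutoff H (Y - Real.log (p : ℕ))‖ ≤ 1 + 2 * Real.exp (-(Y / 2)) := by linarith
    have h6 := Real.exp_pos (-(Y / 2))
    calc _ ≤ (1 + 2 * Real.exp (-(Y / 2))) ^ 2 := by gcongr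
      _ ≤ _ := by nlinarith

/-- Moments of the polynomial over the squares of primes, whose variance is bounded. -/
theorem exists_integral_norm_smoothPrimePoly_one_le : ∃ C : ℝ, 0 ≤ C ∧ ∀ (σ H Y T : ℝ) (k : ℕ),
    1 / 2 ≤ σ → 1 ≤ H → 0 ≤ Y → 2 * Y + 1 ≤ H ^ 2 → Real.exp (4 * Y) ^ (2 * k) ≤ T →
    ∫ t in T..2 * T, ‖smoothPrimePoly (F.α j) H Y 1 (σ + t * Complex.I)‖ ^ (2 * k)
      ≤ 3 * T * k.factorial * C ^ k := by
  obtain ⟨C, hC⟩ := (F.summable_sq_primePowerCoeff_two j).mul_left 9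
  refine ⟨C, hC.nonneg fun p => by positivity, fun σ H Y T k hσ hH hY0 hYH hT => ?_⟩
  simp_rw [smoothPrimePoly_add_mul_I]
  have hT0 : 0 ≤ T := le_trans (by positivity) hT
  refine (integral_norm_pow_primePolynomial_le _ (fun p => logTerm (F.α j) σ (p, 1) *
    smoothCutoff H (Y - ((1 : ℕ) + 1) * Real.log (p : ℕ))) (r := (1 : ℕ) + 1) (by norm_num)
    (Real.one_le_exp (by linarith))
    (fun p hp => (mem_primesUpTo (Real.exp_pos _).le).1 hp) hT).trans ?_
  gcongr
  refine le_trans (Finset.sum_le_sum fun p hp => ?_)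
    (sum_le_hasSum _ (fun p _ => by positivity) hC)
  have hp1 : 1 ≤ ((p : ℕ) : ℝ) := by linarith [p.two_le_cast]
  have hlogp : 0 ≤ Real.log (p : ℕ) := Real.log_nonneg hp1
  have h1 := norm_logTerm_le (F.α j) (s := (σ : ℂ)) (c := 1 / 2) hσ (p, 1)
  have h2 := norm_smoothCutoff_le (H := H) (y := Y - ((1 : ℕ) + 1) * Real.log (p : ℕ)) hH
    (by push_cast; linarith)
  rw [norm_mul, mul_pow]
  have h3 : ‖logTerm (F.α j) σ (p, 1)‖
      ≤ ‖primePowerCoeff (F.α j) p 2‖ * ((p : ℕ) : ℝ) ^ (-1 : ℝ) := by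
    refine h1.trans (le_of_eq ?_)
    norm_num
  calc _ ≤ (‖primePowerCoeff (F.α j) p 2‖ * ((p : ℕ) : ℝ) ^ (-1 : ℝ)) ^ 2 * 3 ^ 2 := by gcongr
    _ = _ := by
        rw [mul_pow, ← Real.rpow_mul_natCast p.cast_pos.le]
        norm_num
        ring

end LFunctionFamily

/-! ### The logarithm in a zero-free disc -/

/-- Two holomorphic logarithms on a connected open set agree if they agree at a point. -/
theorem eqOn_of_exp_eq {U : Set ℂ} (hU : IsOpen U) (hU' : IsPreconnected U) {f g : ℂ → ℂ}
    (hf : DifferentiableOn ℂ f U) (hg : DifferentiableOn ℂ g U)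
    (h : ∀ z ∈ U, Complex.exp (f z) = Complex.exp (g z)) {z₀ : ℂ} (hz₀ : z₀ ∈ U)
    (h₀ : f z₀ = g z₀) : Set.EqOn f g U := by
  refine hU.eqOn_of_deriv_eq hU' hf hg (fun z hz => ?_) hz₀ h₀
  have hfz := (hf.differentiableAt (hU.mem_nhds hz)).hasDerivAt.cexp
  have hgz := (hg.differentiableAt (hU.mem_nhds hz)).hasDerivAt.cexp
  have h1 := hfz.congr_of_eventuallyEq (f₁ := fun x => Complex.exp (g x)) (by
    filter_upwards [hU.mem_nhds hz] with x hx using (h x hx).symm)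
  have h2 := h1.unique hgz
  rw [h z hz] at h2
  exact mul_left_cancel₀ (Complex.exp_ne_zero _) h2

/-- A nonvanishing holomorphic function on a disc has a holomorphic logarithm with a prescribed
value at the centre. -/
theorem exists_log_on_ball {L : ℂ → ℂ} {z₀ w₀ : ℂ} {R : ℝ} (hR : 0 < R)
    (hL : DifferentiableOn ℂ L (Metric.ball z₀ R)) (hL0 : ∀ z ∈ Metric.ball z₀ R, L z ≠ 0)
    (hw₀ : Complex.exp w₀ = L z₀) :
    ∃ f : ℂ → ℂ, DifferentiableOn ℂ f (Metric.ball z₀ R) ∧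
      (∀ z ∈ Metric.ball z₀ R, Complex.exp (f z) = L z) ∧ f z₀ = w₀ := by
  have hz₀ : z₀ ∈ Metric.ball z₀ R := Metric.mem_ball_self hR
  obtain ⟨g, hg⟩ := ((hL.deriv Metric.isOpen_ball).div hL hL0).isExactOn_ball
  set f : ℂ → ℂ := fun z => g z - g z₀ + w₀ with hf
  have hfd : ∀ z ∈ Metric.ball z₀ R, HasDerivAt f (deriv L z / L z) z := fun z hz =>
    ((hg z hz).sub_const _).add_const _
  have hfD : DifferentiableOn ℂ f (Metric.ball z₀ R) := fun z hz =>
    (hfd z hz).differentiableAt.differentiableWithinAt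
  have hf₀ : f z₀ = w₀ := by simp [hf]
  refine ⟨f, hfD, fun z hz => ?_, hf₀⟩
  have hq : ∀ z ∈ Metric.ball z₀ R, HasDerivAt (fun z => Complex.exp (f z) / L z) 0 z := by
    intro z hz
    have hLz := (hL.differentiableAt (Metric.isOpen_ball.mem_nhds hz)).hasDerivAt
    have h1 := (hfd z hz).cexp.div hLz (hL0 z hz)
    rwa [mul_assoc, div_mul_cancel₀ _ (hL0 z hz), sub_self, zero_div] at h1
  have hconst := Metric.isOpen_ball.is_const_of_deriv_eq_zero
    (convex_ball z₀ R).isPreconnected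
    (fun z hz => (hq z hz).differentiableAt.differentiableWithinAt)
    (fun z hz => (hq z hz).deriv) hz hz₀
  rw [hf₀, hw₀, div_self (hL0 z₀ hz₀), div_eq_one_iff_eq (hL0 z hz)] at hconst
  exact hconst

namespace LFunctionFamily

variable {J : ℕ} (F : LFunctionFamily J) (j : Fin J)

/-- If `L` has no zeros in a large disc that reaches slightly to the left of `s = 1/2 + 4δ + it`,
then `log L(s)` is defined, and it is a prime polynomial up to a bounded error. The disc has centre
`s + H²/δ` and radius `H²/δ + 2δ`; a slightly smaller one still contains the rectangle
`s + [-δ, 1] × [-iH, iH]` on which the contour is shifted. -/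
theorem exists_hasLogValue : ∃ D K t₀ : ℝ, 0 ≤ D ∧ 0 ≤ K ∧ ∀ δ t H Y M : ℝ, 0 < δ → δ ≤ 1 / 2 →
    1 ≤ H → 0 ≤ Y → 2 * Y + 1 ≤ H ^ 2 → 0 < M → t₀ ≤ t - (H ^ 2 / δ + 2 * δ) →
    (∀ z : ℂ, 1 / 2 + 2 * δ ≤ z.re → |z.im - t| ≤ H ^ 2 / δ + 2 * δ → F.L j z ≠ 0) →
    (∀ z : ℂ, 1 / 2 ≤ z.re → |z.im - t| ≤ H ^ 2 / δ + 2 * δ → ‖F.L j z‖ ≤ Real.exp M) →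
    8 * (M + K) * H ^ 2 / δ ^ 2 * (Real.exp (-δ * Y) / δ + Real.exp (Y + 1 - H ^ 2)) ≤ 1 →
    ∃ w : ℂ, HasLogValue (F.L j) (F.α j) (((1 / 2 + 4 * δ : ℝ) : ℂ) + t * Complex.I) w ∧
      ‖w - (smoothPrimePoly (F.α j) H Y 0 (((1 / 2 + 4 * δ : ℝ) : ℂ) + t * Complex.I)
        + smoothPrimePoly (F.α j) H Y 1 (((1 / 2 + 4 * δ : ℝ) : ℂ) + t * Complex.I))‖ ≤ D := by
  obtain ⟨D, hD0, hD⟩ := F.exists_norm_sub_smoothPrimePoly_le j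
  obtain ⟨K, hK0, hK⟩ := F.exists_norm_logDirichletSeries_le j
  obtain ⟨t₀, ht₀⟩ := F.exists_differentiableAt j
  refine ⟨D + 1, K, t₀, by linarith, hK0,
    fun δ t H Y M hδ hδ2 hH hY hYH hM htt hzero hLM hsmall => ?_⟩
  set s : ℂ := ((1 / 2 + 4 * δ : ℝ) : ℂ) + t * Complex.I with hs
  have hsre : s.re = 1 / 2 + 4 * δ := by simp [hs]
  have hsim : s.im = t := by simp [hs]
  set R₀ := H ^ 2 / δ with hR₀
  have hR₀δ : R₀ * δ = H ^ 2 := div_mul_cancel₀ _ hδ.ne'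
  have hH2 : 1 ≤ H ^ 2 := one_le_pow₀ hH
  have hR₀2 : 2 ≤ R₀ := by rw [hR₀, le_div_iff₀ hδ]; linarith
  set R := R₀ + 2 * δ with hR
  set r := R₀ + 3 / 2 * δ with hr
  have hR0 : 0 < R := by linarith
  set z₀ : ℂ := s + R₀ with hz₀
  have hz₀re : z₀.re = 1 / 2 + 4 * δ + R₀ := by rw [hz₀, Complex.add_re, hsre, Complex.ofReal_re]
  have hz₀im : z₀.im = t := by rw [hz₀, Complex.add_im, hsim, Complex.ofReal_im, add_zero]
  have hball : ∀ z ∈ Metric.ball z₀ R, 1 / 2 + 2 * δ ≤ z.re ∧ |z.im - t| ≤ R := by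
    intro z hz
    rw [Metric.mem_ball, dist_eq_norm] at hz
    have h1 := Complex.abs_re_le_norm (z - z₀)
    have h2 := Complex.abs_im_le_norm (z - z₀)
    rw [Complex.sub_re, hz₀re] at h1
    rw [Complex.sub_im, hz₀im] at h2
    exact ⟨by linarith [(abs_le.1 h1).1], by linarith⟩
  have hLd : DifferentiableOn ℂ (F.L j) (Metric.ball z₀ R) := fun z hz => by
    refine (ht₀ z ?_).1.differentiableWithinAt
    have := (abs_le.1 (hball z hz).2).1
    exact le_trans (by linarith) (le_abs_self _)
  have hz₀1 : 1 < z₀.re := by rw [hz₀re]; linarith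
  obtain ⟨f, hfd, hfexp, hfz₀⟩ := exists_log_on_ball hR0 hLd
    (fun z hz => hzero z (hball z hz).1 (hball z hz).2) (F.exp_logDirichletSeries j hz₀1)
  have hz₀mem : z₀ ∈ Metric.ball z₀ R := Metric.mem_ball_self hR0
  have hopen1 : IsOpen {z : ℂ | 1 < z.re} := isOpen_lt continuous_const Complex.continuous_re
  -- the two logarithms agree where both are defined
  have hfeq : Set.EqOn f (logDirichletSeries (F.α j)) (Metric.ball z₀ R ∩ {z : ℂ | 1 < z.re}) := by
    refine eqOn_of_exp_eq (Metric.isOpen_ball.inter hopen1)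
      ((convex_ball z₀ R).inter (convex_halfSpace_re_gt 1)).isPreconnected
      (hfd.mono Set.inter_subset_left)
      ((F.differentiableOn_logDirichletSeries j).mono Set.inter_subset_right) (fun z hz => ?_)
      ⟨hz₀mem, hz₀1⟩ hfz₀
    rw [hfexp z hz.1, F.exp_logDirichletSeries j hz.2]
  -- the Borel–Carathéodory bound
  have hBC : ∀ z : ℂ, ‖z - z₀‖ ≤ r → ‖f z‖ ≤ 8 * (M + K) * H ^ 2 / δ ^ 2 := by
    intro z hz
    have hzR : z - z₀ ∈ Metric.ball (0 : ℂ) R := by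
      rw [mem_ball_zero_iff]; exact hz.trans_lt (by rw [hr, hR]; linarith)
    have hmaps : ∀ u ∈ Metric.ball (0 : ℂ) R, z₀ + u ∈ Metric.ball z₀ R := fun u hu => by
      rw [Metric.mem_ball, dist_eq_norm, add_sub_cancel_left]
      exact mem_ball_zero_iff.1 hu
    have h1 := Complex.borelCaratheodory (f := fun u => f (z₀ + u)) (M := M) hM
      (hfd.comp (by fun_prop) hmaps) (fun u hu => ?_) hR0 hzR
    · simp only [add_sub_cancel, add_zero] at h1
      have h2 : ‖f z₀‖ ≤ K := by
        rw [hfz₀]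
        exact hK _ (by rw [hz₀re]; linarith)
      have hRr : δ / 2 ≤ R - ‖z - z₀‖ := by
        have : R - r = δ / 2 := by rw [hR, hr]; ring
        linarith
      have hz2 : ‖z - z₀‖ ≤ 2 * R₀ := hz.trans (by rw [hr]; linarith)
      have hR2 : R ≤ 2 * R₀ := by rw [hR]; linarith
      have hR00 : 0 ≤ R₀ := by linarith
      calc ‖f z‖ ≤ _ := h1
        _ ≤ 2 * M * (2 * R₀) / (δ / 2) + K * (2 * R₀ + 2 * R₀) / (δ / 2) := by gcongr
        _ = _ := by rw [hR₀]; field_simp; ring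
    · show (f (z₀ + u)).re ≤ M
      have h3 := hball _ (hmaps u hu)
      have h4 := hLM _ (by linarith [h3.1]) h3.2
      rw [← hfexp _ (hmaps u hu), Complex.norm_exp] at h4
      exact Real.exp_le_exp.1 h4
  -- the disc is so large that its boundary is nearly straight at heights up to `H`
  have hrect : ∀ w ∈ Set.Icc (-δ) 1 ×ℂ Set.Icc (-H) H, ‖s + w - z₀‖ ≤ r := by
    intro w hw
    rw [Complex.mem_reProdIm] at hw
    obtain ⟨⟨h1, h2⟩, h3, h4⟩ := hw
    have hr0 : 0 ≤ r := by rw [hr]; linarith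
    rw [← sq_le_sq₀ (norm_nonneg _) hr0, Complex.sq_norm, Complex.normSq_apply]
    have e1 : (s + w - z₀).re = w.re - R₀ := by
      rw [hz₀]; simp
    have e2 : (s + w - z₀).im = w.im := by
      rw [hz₀]; simp
    rw [e1, e2, hr]
    have h5 : (w.re - R₀) * (w.re - R₀) ≤ (R₀ + δ) * (R₀ + δ) := by nlinarith
    have h6 : w.im * w.im ≤ H ^ 2 := by nlinarith
    nlinarith
  have hrectball : ∀ w ∈ Set.Icc (-δ) 1 ×ℂ Set.Icc (-H) H, s + w ∈ Metric.ball z₀ R := by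
    intro w hw
    rw [Metric.mem_ball, dist_eq_norm]
    exact (hrect w hw).trans_lt (by rw [hr, hR]; linarith)
  have hsball : s ∈ Metric.ball z₀ R := by
    have := hrectball 0 (by
      rw [Complex.mem_reProdIm]
      simp only [Complex.zero_re, Complex.zero_im, Set.mem_Icc]
      exact ⟨⟨by linarith, by linarith⟩, by linarith, by linarith⟩)
    simpa using this
  refine ⟨f s, ?_, ?_⟩
  -- the continuation along the ray: `f` in the disc, the Dirichlet series outside of it
  · classical
    set g : ℂ → ℂ := fun z => if z ∈ Metric.ball z₀ R then f z else logDirichletSeries (F.α j) z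
      with hg
    have hg1 : ∀ z ∈ Metric.ball z₀ R, g z = f z := fun z hz => if_pos hz
    have hg2 : ∀ z : ℂ, 1 < z.re → g z = logDirichletSeries (F.α j) z := by
      intro z hz
      by_cases hzb : z ∈ Metric.ball z₀ R
      · rw [hg1 z hzb]; exact hfeq ⟨hzb, hz⟩
      · exact if_neg hzb
    have hline : ∀ u : ℝ, s.re ≤ u →
        ((u : ℂ) + (s.im : ℂ) * Complex.I) ∈ Metric.ball z₀ R ∨ 1 < u := by
      intro u hu
      rcases lt_or_ge 1 u with h | h
      · exact Or.inr h
      · left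
        rw [Metric.mem_ball, dist_eq_norm]
        have e1 : (u : ℂ) + (s.im : ℂ) * Complex.I - z₀ = ((u - (1 / 2 + 4 * δ + R₀) : ℝ) : ℂ) := by
          rw [hz₀, hsim, hs]; push_cast; ring
        rw [e1, Complex.norm_real, Real.norm_eq_abs, abs_lt]
        rw [hsre] at hu
        constructor <;> rw [hR] <;> linarith
    refine ⟨fun u => g ((u : ℂ) + (s.im : ℂ) * Complex.I), fun u hu => ?_, fun u hu => ?_,
      fun u hu h1 => hg2 _ (by simpa using h1), ?_⟩
    · refine ContinuousAt.continuousWithinAt (ContinuousAt.comp (g := g) ?_ (by fun_prop))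
      rcases hline u hu with h | h
      · have hn := Metric.isOpen_ball.mem_nhds h
        refine ((hfd.differentiableAt hn).continuousAt).congr ?_
        filter_upwards [hn] with z hz using (hg1 z hz).symm
      · have hn := hopen1.mem_nhds
          (show (u : ℂ) + (s.im : ℂ) * Complex.I ∈ {z : ℂ | 1 < z.re} by simpa using h)
        refine (((F.differentiableOn_logDirichletSeries j).differentiableAt hn).continuousAt).congr ?_
        filter_upwards [hn] with z hz using (hg2 z hz).symm
    · rcases hline u hu with h | h
      · show Complex.exp (g ((u : ℂ) + (s.im : ℂ) * Complex.I)) = _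
        rw [hg1 _ h, hfexp _ h]
      · show Complex.exp (g ((u : ℂ) + (s.im : ℂ) * Complex.I)) = _
        rw [hg2 ((u : ℂ) + (s.im : ℂ) * Complex.I) (by simpa using h), F.exp_logDirichletSeries j (by simpa using h)]
    · simp only
      rw [Complex.re_add_im, hg1 s hsball]
  · have hUopen : IsOpen {w : ℂ | s + w ∈ Metric.ball z₀ R} :=
      Metric.isOpen_ball.preimage (by fun_prop)
    have hB0 : 0 ≤ 8 * (M + K) * H ^ 2 / δ ^ 2 := by positivity
    have happ := norm_sub_integral_gaussKernel_le (g := fun w => f (s + w)) hUopen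
      (hfd.comp (by fun_prop) fun w hw => hw) hδ (by linarith) hH hY hrectball hB0
      (fun w hw => hBC _ (hrect w hw))
    have hV := F.hasSum_logTerm_mul_smoothCutoff j (s := s) (by rw [hsre]; linarith)
      (by linarith : 0 ≤ H) Y
    have hint : ∫ v in -H..H, f (s + ((1 : ℝ) + v * Complex.I)) *
          gaussKernel Y ((1 : ℝ) + v * Complex.I) / ((1 : ℝ) + v * Complex.I)
        = ∫ v in -H..H, logDirichletSeries (F.α j) (s + ((1 : ℝ) + v * Complex.I)) *
          gaussKernel Y ((1 : ℝ) + v * Complex.I) / ((1 : ℝ) + v * Complex.I) := by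
      refine intervalIntegral.integral_congr fun v hv => ?_
      rw [Set.uIcc_of_le (by linarith)] at hv
      rw [hfeq ⟨hrectball _ ?_, ?_⟩]
      · rw [Complex.mem_reProdIm]
        simp only [Complex.add_re, Complex.ofReal_re, Complex.mul_re, Complex.I_re, mul_zero,
          Complex.ofReal_im, Complex.I_im, sub_zero, add_zero, Complex.add_im,
          Complex.mul_im, mul_one, zero_add]
        exact ⟨⟨by linarith, le_rfl⟩, hv⟩
      · show 1 < (s + ((1 : ℝ) + v * Complex.I)).re
        have : (s + ((1 : ℝ) + v * Complex.I)).re = s.re + 1 := by simp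
        rw [this, hsre]
        linarith
    simp only [add_zero] at happ
    rw [hint] at happ
    have hD' := hD s H Y (by rw [hsre]; linarith) hH hY hYH _ hV
    have := (norm_sub_le_norm_sub_add_norm_sub _ _ _).trans (add_le_add happ hD')
    linarith

end LFunctionFamily

/-! ### Ordinates close to a zero off the critical line -/

/-- The points within distance `R` of the ordinate of a zero are covered by one interval of length
`2R` for each zero. -/
theorem volume_near_zeros_le {L : ℂ → ℂ} {σ T : ℝ} (R : ℝ)
    (hL : ∀ z : ℂ, T ≤ z.im → AnalyticAt ℂ L z) (hfin : zeroCount L σ T ≠ ⊤) :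
    volume {t : ℝ | ∃ z : ℂ, σ ≤ z.re ∧ T ≤ z.im ∧ z.im ≤ 2 * T ∧ |z.im - t| ≤ R ∧ L z = 0} ≤
      ENNReal.ofReal (2 * R) * zeroCount L σ T := by
  set S := {z : ℂ | σ ≤ z.re ∧ T ≤ z.im ∧ z.im ≤ 2 * T} with hS
  set N : S → ℝ≥0∞ := fun z => ((analyticOrderAt L (z : ℂ) : ℕ∞) : ℝ≥0∞) with hN
  set I : Set S := {z | 1 ≤ N z} with hI
  have hIfin : I.Finite := ENNReal.finite_const_le_of_tsum_ne_top hfin one_ne_zero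
  have hsub : {t : ℝ | ∃ z : ℂ, σ ≤ z.re ∧ T ≤ z.im ∧ z.im ≤ 2 * T ∧ |z.im - t| ≤ R ∧ L z = 0} ⊆
      ⋃ z ∈ I, Set.Icc ((z : ℂ).im - R) ((z : ℂ).im + R) := by
    rintro t ⟨z, h1, h2, h3, h4, h5⟩
    simp only [Set.mem_iUnion]
    refine ⟨⟨z, h1, h2, h3⟩, ?_, ?_⟩
    · have : analyticOrderAt L z ≠ 0 := (hL z h2).analyticOrderAt_ne_zero.2 h5
      have h6 : (1 : ℕ∞) ≤ analyticOrderAt L z := Order.one_le_iff_ne_zero.2 this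
      show (1 : ℝ≥0∞) ≤ ((analyticOrderAt L z : ℕ∞) : ℝ≥0∞)
      exact_mod_cast ENat.toENNReal_le.2 h6
    · obtain ⟨h6, h7⟩ := abs_le.1 h4
      exact ⟨by simp only; linarith, by simp only; linarith⟩
  calc _ ≤ volume (⋃ z ∈ I, Set.Icc ((z : ℂ).im - R) ((z : ℂ).im + R)) := measure_mono hsub
    _ ≤ ∑' z : I, volume (Set.Icc ((z : ℂ).im - R) ((z : ℂ).im + R)) :=
        measure_biUnion_le _ hIfin.countable _
    _ ≤ ∑' z : I, ENNReal.ofReal (2 * R) * N z := by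
        refine ENNReal.tsum_le_tsum fun z => ?_
        rw [Real.volume_Icc, show (z : ℂ).im + R - ((z : ℂ).im - R) = 2 * R by ring]
        exact le_mul_of_one_le_right' z.2
    _ = ENNReal.ofReal (2 * R) * ∑' z : I, N z := ENNReal.tsum_mul_left
    _ ≤ ENNReal.ofReal (2 * R) * ∑' z, N z := by
        gcongr
        exact ENNReal.tsum_comp_le_tsum_of_injective Subtype.val_injective N

namespace LFunctionFamily

variable {J : ℕ} (F : LFunctionFamily J) (j : Fin J)

/-- The zeros that are relevant for `t ∈ [T, 2T]` have heights in `[T/2, 4T]`, which is the union of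
three dyadic blocks. -/
theorem exists_volume_near_zeros_le : ∃ a b C T₁ : ℝ, 0 < a ∧ 0 < b ∧ 0 ≤ C ∧ 1 ≤ T₁ ∧
    ∀ σ R T : ℝ, 1 / 2 ≤ σ → a * (σ - 1 / 2) ≤ 1 → 0 ≤ R → R ≤ T / 2 → T₁ ≤ T →
    volume.real {t : ℝ | t ∈ Set.Icc T (2 * T) ∧
        ∃ z : ℂ, σ ≤ z.re ∧ |z.im - t| ≤ R ∧ F.L j z = 0} ≤
      C * R * T ^ (1 - a * (σ - 1 / 2)) * Real.log T ^ b := by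
  obtain ⟨a, b, ha, hb, C, T₀, hC⟩ := F.zero_density
  obtain ⟨t₀, ht₀⟩ := F.exists_differentiableAt j
  refine ⟨a, b, 12 * |C| * 2 ^ b, max 4 (2 * max T₀ t₀), ha, hb, by positivity,
    le_max_of_le_left (by norm_num), fun σ R T hσ haσ hR hRT hT => ?_⟩
  have hT4 : 4 ≤ T := (le_max_left _ _).trans hT
  have hT0 : 2 * max T₀ t₀ ≤ T := (le_max_right _ _).trans hT
  have h0 := le_max_left T₀ t₀
  have h1 := le_max_right T₀ t₀
  set e := 1 - a * (σ - 1 / 2) with he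
  have he0 : 0 ≤ e := by linarith
  have he1 : e ≤ 1 := by
    have : 0 ≤ a * (σ - 1 / 2) := mul_nonneg ha.le (by linarith)
    linarith
  have hlogT : 1 ≤ Real.log T := by
    rw [Real.le_log_iff_exp_le (by linarith)]
    exact Real.exp_one_lt_d9.le.trans (by linarith)
  set B := 2 * |C| * 2 ^ b * T ^ e * Real.log T ^ b with hB
  have hB0 : 0 ≤ B := by positivity
  have hN : ∀ T', T / 2 ≤ T' → T' ≤ 2 * T →
      volume {t : ℝ | ∃ z : ℂ, σ ≤ z.re ∧ T' ≤ z.im ∧ z.im ≤ 2 * T' ∧ |z.im - t| ≤ R ∧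
        F.L j z = 0} ≤ ENNReal.ofReal (2 * R * B) := by
    intro T' h2 h3
    have hzc := hC j σ T' hσ (by linarith)
    have hle : C * T' ^ e * Real.log T' ^ b ≤ B := by
      have hT'0 : 0 < T' := by linarith
      have hlog' : 0 ≤ Real.log T' := Real.log_nonneg (by linarith)
      have h4 : T' ^ e ≤ 2 * T ^ e := by
        calc T' ^ e ≤ (2 * T) ^ e := Real.rpow_le_rpow hT'0.le h3 he0
          _ = 2 ^ e * T ^ e := Real.mul_rpow (by norm_num) (by linarith)
          _ ≤ 2 * T ^ e := by
            gcongr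
            calc (2 : ℝ) ^ e ≤ 2 ^ (1 : ℝ) := Real.rpow_le_rpow_of_exponent_le (by norm_num) he1
              _ = 2 := Real.rpow_one 2
      have h5 : Real.log T' ≤ 2 * Real.log T := by
        calc Real.log T' ≤ Real.log (2 * T) := Real.log_le_log hT'0 h3
          _ = Real.log 2 + Real.log T := Real.log_mul (by norm_num) (by linarith)
          _ ≤ _ := by linarith [Real.log_two_lt_d9]
      have h6 : Real.log T' ^ b ≤ 2 ^ b * Real.log T ^ b := by
        calc Real.log T' ^ b ≤ (2 * Real.log T) ^ b := Real.rpow_le_rpow hlog' h5 hb.le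
          _ = _ := Real.mul_rpow (by norm_num) (by linarith)
      calc C * T' ^ e * Real.log T' ^ b ≤ |C| * (2 * T ^ e) * (2 ^ b * Real.log T ^ b) := by
            gcongr
            exact le_abs_self C
        _ = B := by rw [hB]; ring
    have hzc' : zeroCount (F.L j) σ T' ≤ ENNReal.ofReal B :=
      hzc.trans (ENNReal.ofReal_le_ofReal hle)
    refine (volume_near_zeros_le R (fun z hz => (ht₀ z ?_).2)
      (ne_top_of_le_ne_top ENNReal.ofReal_ne_top hzc')).trans ?_
    · exact le_trans (by linarith) (le_abs_self _)
    · rw [ENNReal.ofReal_mul (p := 2 * R) (by linarith)]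
      exact mul_le_mul' le_rfl hzc'
  have hsub : {t : ℝ | t ∈ Set.Icc T (2 * T) ∧ ∃ z : ℂ, σ ≤ z.re ∧ |z.im - t| ≤ R ∧
        F.L j z = 0} ⊆
      {t : ℝ | ∃ z : ℂ, σ ≤ z.re ∧ T / 2 ≤ z.im ∧ z.im ≤ 2 * (T / 2) ∧ |z.im - t| ≤ R ∧
        F.L j z = 0} ∪
      ({t : ℝ | ∃ z : ℂ, σ ≤ z.re ∧ T ≤ z.im ∧ z.im ≤ 2 * T ∧ |z.im - t| ≤ R ∧ F.L j z = 0} ∪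
      {t : ℝ | ∃ z : ℂ, σ ≤ z.re ∧ 2 * T ≤ z.im ∧ z.im ≤ 2 * (2 * T) ∧ |z.im - t| ≤ R ∧
        F.L j z = 0}) := by
    rintro t ⟨⟨ht1, ht2⟩, z, h2, h3, h4⟩
    obtain ⟨h5, h6⟩ := abs_le.1 h3
    rcases le_total z.im T with h7 | h7
    · exact Or.inl ⟨z, h2, by linarith, by linarith, h3, h4⟩
    rcases le_total z.im (2 * T) with h8 | h8
    · exact Or.inr (Or.inl ⟨z, h2, h7, h8, h3, h4⟩)
    · exact Or.inr (Or.inr ⟨z, h2, h8, by linarith, h3, h4⟩)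
  refine ENNReal.toReal_le_of_le_ofReal (by positivity) ?_
  refine (measure_mono hsub).trans ((measure_union_le _ _).trans
    ((add_le_add_right (measure_union_le _ _) _).trans ((add_le_add (hN _ le_rfl (by linarith))
    (add_le_add (hN _ (by linarith) (by linarith)) (hN _ (by linarith) le_rfl))).trans ?_)))
  rw [← ENNReal.ofReal_add (by positivity) (by positivity),
    ← ENNReal.ofReal_add (by positivity) (by positivity)]
  refine ENNReal.ofReal_le_ofReal (le_of_eq ?_)
  rw [hB]; ring

/-- The ordinates close to a zero to the right of `1/2 + 1/(2G)` form a set whose measure is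
negligible compared with every Gaussian that occurs. -/
theorem eventually_volume_near_zeros_le {ξ : ℝ} (hξ : 0 < ξ) : ∀ᶠ T in atTop, ∀ G : ℝ,
    Real.log (Real.log T) ≤ G → G ≤ √(Real.log T / Real.log (Real.log T)) →
    volume.real {t : ℝ | t ∈ Set.Icc T (2 * T) ∧
        ∃ z : ℂ, 1 / 2 + 2 * (1 / (4 * G)) ≤ z.re ∧
          |z.im - t| ≤ Real.log T ^ 2 / (1 / (4 * G)) + 2 * (1 / (4 * G)) ∧ F.L j z = 0} ≤
      T * Real.exp (-Real.log (Real.log T) ^ 4 / ξ) := by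
  obtain ⟨a, b, C, T₁, ha, hb, hC, hT₁, h⟩ := F.exists_volume_near_zeros_le j
  have hll : Tendsto (fun T : ℝ => Real.log (Real.log T)) atTop atTop :=
    Real.tendsto_log_atTop.comp Real.tendsto_log_atTop
  have e1 : ∀ᶠ l : ℝ in atTop, (4 + b + 1 / ξ) * l ^ 4 ≤ a / 2 * Real.exp (1 / 2 * l) := by
    have := (isLittleO_pow_exp_pos_mul_atTop (k := 4) (b := 1 / 2) (by norm_num)).bound
      (c := a / 2 / (4 + b + 1 / ξ)) (by positivity)
    filter_upwards [this] with l hl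
    rw [Real.norm_eq_abs, abs_of_nonneg (by positivity : (0 : ℝ) ≤ l ^ 4), Real.norm_eq_abs,
      Real.abs_exp, div_mul_eq_mul_div, le_div_iff₀ (by positivity)] at hl
    linarith
  have e2 : ∀ᶠ l : ℝ in atTop, 5 * C ≤ Real.exp l :=
    Real.tendsto_exp_atTop.eventually_ge_atTop _
  have e3 : ∀ᶠ T : ℝ in atTop, 5 * Real.log T ^ 3 ≤ T / 2 := by
    have := (Real.isLittleO_pow_log_id_atTop (n := 3)).bound (c := 1 / 10) (by norm_num)
    filter_upwards [this, eventually_ge_atTop 1] with T hT hT1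
    rw [Real.norm_eq_abs, abs_of_nonneg (pow_nonneg (Real.log_nonneg hT1) 3), Real.norm_eq_abs,
      id, abs_of_nonneg (by linarith)] at hT
    linarith
  filter_upwards [hll.eventually e1, hll.eventually e2, e3, hll.eventually_ge_atTop 1,
    hll.eventually_ge_atTop (a / 2), eventually_ge_atTop T₁, eventually_gt_atTop 1]
    with T h1 h2 h3 hl1 hla hTT hT1 G hG1 hG2
  set l := Real.log (Real.log T) with hl
  have hLpos : 0 < Real.log T := Real.log_pos hT1
  have hL : Real.log T = Real.exp l := (Real.exp_log hLpos).symm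
  have hLge : 1 ≤ Real.log T := by rw [hL]; exact Real.one_le_exp (by linarith)
  have hG0 : 1 ≤ G := hl1.trans hG1
  have hGs : G ≤ √(Real.log T) :=
    hG2.trans (Real.sqrt_le_sqrt (div_le_self hLpos.le hl1))
  have hsL : √(Real.log T) ≤ Real.log T := Real.sqrt_le_self_iff.2 (Or.inr hLge)
  have hsqrt : √(Real.log T) = Real.exp (1 / 2 * l) := by
    rw [hL, Real.sqrt_eq_rpow, ← Real.exp_mul]; ring_nf
  set L := Real.log T with hLdef
  have hR : L ^ 2 / (1 / (4 * G)) + 2 * (1 / (4 * G)) ≤ 5 * L ^ 3 := by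
    have h4 : L ^ 2 / (1 / (4 * G)) = 4 * (L ^ 2 * G) := by field_simp
    have h5 : 2 * (1 / (4 * G)) ≤ 1 := by
      rw [mul_one_div, div_le_one (by linarith)]; linarith
    have h6 : L ^ 2 * G ≤ L ^ 2 * L := by gcongr; linarith
    have h7 : 1 ≤ L ^ 3 := one_le_pow₀ hLge
    rw [h4]; nlinarith
  have hR0 : 0 ≤ L ^ 2 / (1 / (4 * G)) + 2 * (1 / (4 * G)) := by positivity
  have haG : a * (1 / 2 + 2 * (1 / (4 * G)) - 1 / 2) = a / 2 / G := by field_simp; ring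
  refine (h (1 / 2 + 2 * (1 / (4 * G))) _ T (by
    have : 0 ≤ 2 * (1 / (4 * G)) := by positivity
    linarith) (by rw [haG, div_le_one (by linarith)]; linarith) hR0 (by linarith) hTT).trans ?_
  rw [haG, sub_eq_add_neg, Real.rpow_add (by linarith), Real.rpow_one]
  -- the saving in the zero density estimate, as `G ≤ √(log T)`
  have h8 : T ^ (-(a / 2 / G)) ≤ Real.exp (-(a / 2 * Real.exp (1 / 2 * l))) := by
    rw [Real.rpow_def_of_pos (by linarith)]
    refine Real.exp_le_exp.2 ?_
    rw [mul_neg, neg_le_neg_iff, ← hsqrt]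
    have h9 : √L * G ≤ L := by
      calc √L * G ≤ √L * √L := by gcongr
        _ = L := Real.mul_self_sqrt hLpos.le
    rw [← hLdef, mul_div_assoc', le_div_iff₀ (by linarith)]
    nlinarith
  have h9 : L ^ b = Real.exp (b * l) := by rw [hL, ← Real.exp_mul, mul_comm]
  have h10 : L ^ 3 = Real.exp (3 * l) := by rw [hL, ← Real.exp_nat_mul]; norm_num
  rw [h9]
  calc C * (L ^ 2 / (1 / (4 * G)) + 2 * (1 / (4 * G))) * (T * T ^ (-(a / 2 / G))) * Real.exp (b * l)
      ≤ C * (5 * L ^ 3) * (T * Real.exp (-(a / 2 * Real.exp (1 / 2 * l)))) * Real.exp (b * l) := by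
        gcongr
    _ = T * (5 * C * Real.exp (3 * l) * Real.exp (-(a / 2 * Real.exp (1 / 2 * l))) *
          Real.exp (b * l)) := by rw [h10]; ring
    _ ≤ T * (Real.exp l * Real.exp (3 * l) * Real.exp (-(a / 2 * Real.exp (1 / 2 * l))) *
          Real.exp (b * l)) := by gcongr
    _ = T * Real.exp (l + 3 * l - a / 2 * Real.exp (1 / 2 * l) + b * l) := by
        rw [← Real.exp_add, ← Real.exp_add, ← Real.exp_add, ← sub_eq_add_neg]
    _ ≤ _ := by
        gcongr
        have h11 : l ≤ l ^ 4 := le_self_pow₀ hl1 (by norm_num)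
        have h12 : -l ^ 4 / ξ = -(1 / ξ * l ^ 4) := by ring
        rw [h12]
        have h13 : (4 + b) * l ≤ (4 + b) * l ^ 4 := by gcongr
        nlinarith

end LFunctionFamily

/-! ### The distribution of `log L(σ + it)` -/

/-- A bounded shift and an error `O(M)` in the variance only change the error in the variance. -/
theorem exists_sq_sqrt_add_le {ξ C E : ℝ} (hξ : 0 < ξ) (hC : 0 ≤ C) (hE : 0 ≤ E) :
    ∃ c : ℝ, 0 < c ∧ ∀ x M : ℝ, 0 ≤ x → √x ≤ M → 1 ≤ M →
      (√(ξ * x + C * M) + E) ^ 2 ≤ ξ * x + c * M := by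
  refine ⟨C + 2 * E * (√ξ + √C) + E ^ 2 + 1, by positivity, fun x M hx hxM hM => ?_⟩
  have h1 : √(ξ * x + C * M) ≤ (√ξ + √C) * M := by
    have h2 : √(ξ * x) ≤ √ξ * M := by
      rw [Real.sqrt_mul hξ.le]; gcongr
    have h3 : √(C * M) ≤ √C * M := by
      rw [Real.sqrt_mul hC]
      gcongr
      exact Real.sqrt_le_self_iff.2 (Or.inr hM)
    have h4 : √(ξ * x + C * M) ≤ √(ξ * x) + √(C * M) := by
      refine Real.sqrt_le_iff.2 ⟨by positivity, ?_⟩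
      rw [add_sq, Real.sq_sqrt (by positivity), Real.sq_sqrt (by positivity)]
      linarith [mul_nonneg (Real.sqrt_nonneg (ξ * x)) (Real.sqrt_nonneg (C * M))]
    linarith
  have h2 : √(ξ * x + C * M) ^ 2 = ξ * x + C * M := Real.sq_sqrt (by positivity)
  have h3 : E ^ 2 ≤ E ^ 2 * M := le_mul_of_one_le_right (by positivity) hM
  have h4 : 2 * E * √(ξ * x + C * M) ≤ 2 * E * ((√ξ + √C) * M) := by gcongr
  nlinarith

/-- A sum of two functions with Gaussian moments and of a bounded function has a Gaussian tail, in
the range of `τ` that is accessible to the moments. -/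
theorem measureReal_le_gaussian {α : Type*} [MeasurableSpace α] {μ : Measure α}
    [IsFiniteMeasure μ] {x y z : α → ℝ} {A B D K E τ v W : ℝ} (hv : 0 < v) (hE : 1 ≤ E)
    (hvW : v ≤ E * W) (hτ : √v ≤ τ)
    (hx : ∀ a, 0 ≤ x a) (hy : ∀ a, 0 ≤ y a) (hz : ∀ a, 0 ≤ z a) (hzD : ∀ a, z a ≤ D)
    (hA : 0 < A) (hB : 0 < B) (hD : 0 < D) (hK : 0 < K) (hμ : μ.real Set.univ ≤ K)
    (hW : (A + B + D) ^ 2 ≤ W)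
    (hxi : ∀ k : ℕ, Integrable (fun a => x a ^ (2 * k)) μ)
    (hyi : ∀ k : ℕ, Integrable (fun a => y a ^ (2 * k)) μ)
    (hxm : ∀ k : ℕ, k * W ≤ τ ^ 2 →
      ∫ a, x a ^ (2 * k) ∂μ ≤ K * k.factorial * (A ^ 2) ^ k)
    (hym : ∀ k : ℕ, k * W ≤ τ ^ 2 →
      ∫ a, y a ^ (2 * k) ∂μ ≤ K * k.factorial * (B ^ 2) ^ k) :
    μ.real {a | τ ≤ x a + y a + z a} ≤
      K * Real.exp 2 * E * (τ / √v) * Real.exp (-τ ^ 2 / W) := by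
  have hτ0 : 0 < τ := (Real.sqrt_pos.2 hv).trans_le hτ
  refine tail_le_of_moments hv hK hE hvW hτ ((measureReal_mono (Set.subset_univ _)).trans hμ)
    fun k _ hk => ?_
  refine (measureReal_le_of_moments hτ0 hx hy hz hzD hA hB hD hμ (hxi k) (hyi k) (hxm k hk)
    (hym k hk)).trans ?_
  gcongr

theorem largeDeviationBound_mono {ξ c c' T G τ : ℝ} (hξ : 0 < ξ) (hc : 0 ≤ c) (hcc : c ≤ c')
    (hG : 0 < Real.log G) (hτ : 0 ≤ τ) :
    largeDeviationBound ξ c T G τ ≤ largeDeviationBound ξ c' T G τ := by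
  have hM : 0 ≤ max (√(Real.log G)) (Real.log (Real.log (Real.log T))) :=
    le_max_of_le_left (Real.sqrt_nonneg _)
  unfold largeDeviationBound
  rw [neg_div, neg_div]
  gcongr

theorem continuous_smoothPrimePoly {d : ℕ} (α : Fin d → Nat.Primes → ℂ) (H Y : ℝ) (k : ℕ) (s : ℂ) :
    Continuous fun t : ℝ => smoothPrimePoly α H Y k (s + t * Complex.I) := by
  simp_rw [smoothPrimePoly_add_mul_I]
  fun_prop

theorem tendsto_log_log_atTop : Tendsto (fun T : ℝ => Real.log (Real.log T)) atTop atTop :=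
  Real.tendsto_log_atTop.comp Real.tendsto_log_atTop

/-- The iterated logarithms that occur are at least `1`, so that `G₀ ≥ 1`. -/
theorem eventually_one_le_log : ∀ᶠ T in atTop, ∀ G : ℝ, Real.log (Real.log T) ≤ G →
    1 ≤ Real.log (Real.log T) ∧ 1 ≤ Real.log (Real.log (Real.log T)) ∧ 1 ≤ Real.log G := by
  filter_upwards [tendsto_log_log_atTop.eventually_ge_atTop (Real.exp 1)] with T hT G hG
  have h := Real.exp_pos 1
  have h1 : 1 ≤ Real.log (Real.log (Real.log T)) := by
    rwa [Real.le_log_iff_exp_le (by linarith)]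
  exact ⟨(Real.one_le_exp zero_le_one).trans hT, h1,
    h1.trans (Real.log_le_log (by linarith) hG)⟩

/-- The choice `H = log T`, `δ = 1/(4G)` and `Y = 40 G log log T` of the parameters of the smoothing
is admissible for all large `T`. Here `e^{-δY} = (log T)^{-10}` makes the error on the shifted
contour small, and `Y ≤ 40 √(log T) log log T` makes all moments up to `k ≤ (log log T)⁴ / ξ`
accessible. -/
theorem eventually_parameters {ξ : ℝ} (hξ : 0 < ξ) (A Y₀ : ℝ) : ∀ᶠ T in atTop, ∀ G : ℝ,
    Real.log (Real.log T) ≤ G → G ≤ √(Real.log T / Real.log (Real.log T)) →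
    Real.log T ^ 2 / (1 / (4 * G)) + 2 * (1 / (4 * G)) ≤ T / 2 ∧
    2 * (40 * G * Real.log (Real.log T)) + 1 ≤ Real.log T ^ 2 ∧
    Y₀ ≤ 40 * G * Real.log (Real.log T) ∧
    8 * (A * Real.log T) * Real.log T ^ 2 / (1 / (4 * G)) ^ 2 *
      (Real.exp (-(1 / (4 * G)) * (40 * G * Real.log (Real.log T))) / (1 / (4 * G)) +
        Real.exp (40 * G * Real.log (Real.log T) + 1 - Real.log T ^ 2)) ≤ 1 ∧
    ∀ k : ℕ, k * ξ ≤ Real.log (Real.log T) ^ 4 →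
      Real.exp (4 * (40 * G * Real.log (Real.log T))) ^ (2 * k) ≤ T := by
  have e3 : ∀ᶠ T : ℝ in atTop, 5 * Real.log T ^ 3 ≤ T / 2 := by
    have := (Real.isLittleO_pow_log_id_atTop (n := 3)).bound (c := 1 / 10) (by norm_num)
    filter_upwards [this, eventually_ge_atTop 1] with T hT hT1
    rw [Real.norm_eq_abs, abs_of_nonneg (pow_nonneg (Real.log_nonneg hT1) 3), Real.norm_eq_abs,
      id, abs_of_nonneg (by linarith)] at hT
    linarith
  have e5 : ∀ᶠ l : ℝ in atTop, 320 / ξ * l ^ 5 ≤ Real.exp (1 / 2 * l) := by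
    have := (isLittleO_pow_exp_pos_mul_atTop (k := 5) (b := 1 / 2) (by norm_num)).bound
      (c := 1 / (320 / ξ)) (by positivity)
    filter_upwards [this, eventually_ge_atTop 0] with l hl hl0
    rw [Real.norm_eq_abs, abs_of_nonneg (by positivity : (0 : ℝ) ≤ l ^ 5), Real.norm_eq_abs,
      Real.abs_exp, div_mul_eq_mul_div, le_div_iff₀ (by positivity)] at hl
    linarith
  filter_upwards [e3, tendsto_log_log_atTop.eventually e5,
    tendsto_log_log_atTop.eventually_ge_atTop 1, tendsto_log_log_atTop.eventually_ge_atTop Y₀,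
    Real.tendsto_log_atTop.eventually_ge_atTop 81,
    Real.tendsto_log_atTop.eventually_ge_atTop (640 * A), eventually_gt_atTop 1]
    with T h3 h5 hl1 hlY hL81 hLA hT1 G hG1 hG2
  set l := Real.log (Real.log T) with hl
  have hLpos : 0 < Real.log T := Real.log_pos hT1
  have hL : Real.log T = Real.exp l := (Real.exp_log hLpos).symm
  set L := Real.log T with hLdef
  have hG0 : 1 ≤ G := hl1.trans hG1
  have hGs : G ≤ √L := hG2.trans (Real.sqrt_le_sqrt (div_le_self hLpos.le hl1))
  have hsL : √L ≤ L := Real.sqrt_le_self_iff.2 (Or.inr (by linarith))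
  have hGL : G ≤ L := hGs.trans hsL
  have hsqrt : √L = Real.exp (1 / 2 * l) := by
    rw [hL, Real.sqrt_eq_rpow, ← Real.exp_mul]; ring_nf
  have hlL : l ≤ L := by rw [hL]; linarith [Real.add_one_le_exp l]
  have hGl : G * l ≤ L := by
    calc G * l ≤ √(L / l) * √(L / l) * l := by
          have : 1 ≤ √(L / l) := hG0.trans hG2
          have h6 : G ≤ √(L / l) * √(L / l) := by nlinarith
          gcongr
      _ = L := by
          rw [Real.mul_self_sqrt (by positivity), div_mul_cancel₀ _ (by linarith)]
  have hdiv : ∀ x : ℝ, x / (1 / (4 * G)) = 4 * (x * G) := fun x => by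
    rw [div_div_eq_mul_div, div_one]; ring
  have hYL : 2 * (40 * G * l) + 1 ≤ L ^ 2 := by nlinarith
  have hlGl : l ≤ G * l := le_mul_of_one_le_left (by linarith) hG0
  refine ⟨?_, hYL, by nlinarith, ?_, fun k hk => ?_⟩
  · have h5 : 2 * (1 / (4 * G)) ≤ 1 := by
      rw [mul_one_div, div_le_one (by linarith)]; linarith
    have h6 : L ^ 2 * G ≤ L ^ 2 * L := by gcongr
    have h7 : 1 ≤ L ^ 3 := one_le_pow₀ (by linarith)
    rw [hdiv]; nlinarith
  · rcases le_or_gt A 0 with hA | hA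
    · refine le_trans (mul_nonpos_of_nonpos_of_nonneg ?_ (by positivity)) zero_le_one
      refine div_nonpos_of_nonpos_of_nonneg ?_ (by positivity)
      exact mul_nonpos_of_nonpos_of_nonneg
        (by nlinarith [mul_nonpos_of_nonpos_of_nonneg hA hLpos.le]) (by positivity)
    have e1 : -(1 / (4 * G)) * (40 * G * l) = -(10 * l) := by
      field_simp; norm_num
    have h10 : Real.exp (-(10 * l)) * L ^ 10 = 1 := by
      rw [hL, ← Real.exp_nat_mul, ← Real.exp_add]; norm_num
    have h11 : Real.exp (40 * G * l + 1 - L ^ 2) ≤ Real.exp (-(10 * l)) := by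
      refine Real.exp_le_exp.2 ?_
      nlinarith
    have e2 : 8 * (A * L) * L ^ 2 / (1 / (4 * G)) ^ 2 = 128 * A * L ^ 3 * G ^ 2 := by
      field_simp; norm_num
    rw [e1, hdiv, e2]
    have hE := Real.exp_pos (-(10 * l))
    calc 128 * A * L ^ 3 * G ^ 2 *
          (4 * (Real.exp (-(10 * l)) * G) + Real.exp (40 * G * l + 1 - L ^ 2))
        ≤ 128 * A * L ^ 3 * L ^ 2 * (4 * (Real.exp (-(10 * l)) * L) + Real.exp (-(10 * l)) * L) := by
          gcongr
          exact h11.trans (le_mul_of_one_le_right hE.le (by linarith))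
      _ = 640 * A * (L ^ 6 * Real.exp (-(10 * l))) := by ring
      _ ≤ L * (L ^ 6 * Real.exp (-(10 * l))) := by gcongr
      _ = L ^ 7 * Real.exp (-(10 * l)) := by ring
      _ ≤ L ^ 10 * Real.exp (-(10 * l)) := by
          gcongr
          · linarith
          · norm_num
      _ = 1 := by rw [mul_comm, h10]
  · rw [← Real.exp_nat_mul, ← Real.le_log_iff_exp_le (by linarith), ← hLdef]
    have hk' : (k : ℝ) ≤ l ^ 4 / ξ := by rwa [le_div_iff₀ hξ]
    push_cast
    calc 2 * (k : ℝ) * (4 * (40 * G * l)) = 320 * k * (G * l) := by ring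
      _ ≤ 320 * (l ^ 4 / ξ) * (√L * l) := by gcongr
      _ = 320 / ξ * l ^ 5 * √L := by ring
      _ ≤ √L * √L := by
          gcongr
          rwa [hsqrt]
      _ = L := Real.mul_self_sqrt hLpos.le

namespace LFunctionFamily

variable {J : ℕ} (F : LFunctionFamily J) (j : Fin J)

/-- For `t` outside the neighbourhoods of the zeros, `log L(σ + it)` is defined and bounded by the
prime polynomials. -/
theorem exists_eventually_hasLogValue : ∃ D : ℝ, 0 < D ∧ ∀ᶠ T in atTop, ∀ G : ℝ,
    Real.log (Real.log T) ≤ G → G ≤ √(Real.log T / Real.log (Real.log T)) →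
    ∀ t ∈ Set.Icc T (2 * T), (¬ ∃ z : ℂ, 1 / 2 + 2 * (1 / (4 * G)) ≤ z.re ∧
        |z.im - t| ≤ Real.log T ^ 2 / (1 / (4 * G)) + 2 * (1 / (4 * G)) ∧ F.L j z = 0) →
    ∃ w : ℂ, HasLogValue (F.L j) (F.α j) (((1 / 2 + 1 / G : ℝ) : ℂ) + t * Complex.I) w ∧
      ‖w‖ ≤ ‖smoothPrimePoly (F.α j) (Real.log T) (40 * G * Real.log (Real.log T)) 0
          (((1 / 2 + 1 / G : ℝ) : ℂ) + t * Complex.I)‖ +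
        ‖smoothPrimePoly (F.α j) (Real.log T) (40 * G * Real.log (Real.log T)) 1
          (((1 / 2 + 1 / G : ℝ) : ℂ) + t * Complex.I)‖ + D := by
  obtain ⟨D, K, t₀, hD, hK, h⟩ := F.exists_hasLogValue j
  obtain ⟨C, t₁, n, hC, ht₁, hCn⟩ := F.exists_norm_le_im_pow j
  refine ⟨D + 1, by linarith, ?_⟩
  filter_upwards [eventually_parameters one_pos (|Real.log C| + 3 * n + 1 + K) 0,
    eventually_one_le_log, eventually_ge_atTop (2 * t₀), eventually_ge_atTop (2 * t₁),
    eventually_ge_atTop 3] with T hpar hlog hT0 hT1 hT3 G hG1 hG2 t ht hzero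
  obtain ⟨hR, hYH, hY, hsmall, -⟩ := hpar G hG1 hG2
  obtain ⟨hl, hll, -⟩ := hlog G hG1
  have hG : 1 ≤ G := hl.trans hG1
  have hLT : 1 ≤ Real.log T := by
    rw [Real.le_log_iff_exp_le (by linarith)]
    linarith [Real.exp_one_lt_d9]
  set M := |Real.log C| + n * Real.log (3 * T) + 1 with hM
  have hl3 : 0 ≤ Real.log (3 * T) := Real.log_nonneg (by linarith)
  have hM0 : 0 < M := by positivity
  have h4 : 4 * (1 / (4 * G)) = 1 / G := by field_simp
  have hδ : 1 / (4 * G) ≤ 1 / 2 := by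
    gcongr; linarith
  have hgrow : ∀ z : ℂ, 1 / 2 ≤ z.re →
      |z.im - t| ≤ Real.log T ^ 2 / (1 / (4 * G)) + 2 * (1 / (4 * G)) →
      ‖F.L j z‖ ≤ Real.exp M := by
    intro z hz hzt
    obtain ⟨h5, h6⟩ := abs_le.1 hzt
    have h7 : t₁ ≤ z.im := by linarith [ht.1]
    have h8 : z.im ≤ 3 * T := by linarith [ht.2]
    refine (hCn z hz h7).trans ?_
    calc C * z.im ^ n ≤ C * (3 * T) ^ n := by
          gcongr
          linarith
      _ = Real.exp (Real.log C + n * Real.log (3 * T)) := by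
          rw [Real.exp_add, Real.exp_log hC, Real.exp_nat_mul, Real.exp_log (by linarith)]
      _ ≤ Real.exp M := by
          refine Real.exp_le_exp.2 ?_
          rw [hM]
          linarith [le_abs_self (Real.log C)]
  have hM2 : M + K ≤ (|Real.log C| + 3 * n + 1 + K) * Real.log T := by
    have h5 : Real.log (3 * T) ≤ 3 * Real.log T := by
      rw [Real.log_mul (by norm_num) (by linarith)]
      have : Real.log 3 ≤ Real.log T := Real.log_le_log (by norm_num) hT3
      linarith
    have h6 : n * Real.log (3 * T) ≤ n * (3 * Real.log T) := by gcongr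
    have h7 : |Real.log C| + 1 + K ≤ (|Real.log C| + 1 + K) * Real.log T :=
      le_mul_of_one_le_right (by positivity) hLT
    rw [hM]
    linarith
  obtain ⟨w, hw, hwD⟩ := h (1 / (4 * G)) t (Real.log T) (40 * G * Real.log (Real.log T)) M
    (by positivity) hδ hLT hY hYH hM0 (by linarith [ht.1])
    (fun z hz hzt h0 => hzero ⟨z, hz, hzt, h0⟩) hgrow (le_trans (by gcongr) hsmall)
  rw [h4] at hw hwD
  refine ⟨w, hw, ?_⟩
  set P₀ := smoothPrimePoly (F.α j) (Real.log T) (40 * G * Real.log (Real.log T)) 0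
        (((1 / 2 + 1 / G : ℝ) : ℂ) + t * Complex.I)
  set P₁ := smoothPrimePoly (F.α j) (Real.log T) (40 * G * Real.log (Real.log T)) 1
        (((1 / 2 + 1 / G : ℝ) : ℂ) + t * Complex.I)
  have h5 : w = P₀ + P₁ + (w - (P₀ + P₁)) := by ring
  calc ‖w‖ = ‖P₀ + P₁ + (w - (P₀ + P₁))‖ := by rw [← h5]
    _ ≤ ‖P₀‖ + ‖P₁‖ + ‖w - (P₀ + P₁)‖ := norm_add₃_le
    _ ≤ _ := by linarith

end LFunctionFamily

/-- The smallest value of the Gaussian bound in the range `√x ≤ τ ≤ l²`. -/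
theorem exp_le_mul_exp {ξ x V l τ : ℝ} (hξ : 0 < ξ) (hx : 1 ≤ x) (hτ : √x ≤ τ)
    (hτl : τ ≤ l ^ 2) (hV : ξ * x ≤ V) :
    Real.exp (-l ^ 4 / ξ) ≤ τ / √x * Real.exp (-τ ^ 2 / V) := by
  have hsx : 0 < √x := Real.sqrt_pos.2 (by linarith)
  have h1 : 1 ≤ τ / √x := (one_le_div hsx).2 hτ
  have hξV : ξ ≤ V := (le_mul_of_one_le_right hξ.le hx).trans hV
  have h2 : τ ^ 2 / V ≤ l ^ 4 / ξ := by
    have h3 : τ ^ 2 ≤ l ^ 4 := by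
      calc τ ^ 2 ≤ (l ^ 2) ^ 2 := by
            have : 0 ≤ τ := hsx.le.trans hτ
            gcongr
        _ = l ^ 4 := by ring
    gcongr
  calc Real.exp (-l ^ 4 / ξ) ≤ Real.exp (-τ ^ 2 / V) := by
        refine Real.exp_le_exp.2 ?_
        rw [neg_div, neg_div]
        linarith
    _ ≤ _ := le_mul_of_one_le_left (Real.exp_pos _).le h1

namespace LFunctionFamily

variable {J : ℕ} (F : LFunctionFamily J) (j : Fin J)

/-- The tail of `log L(σ + it)`; the points at which it is not defined are among those that are close
to a zero. -/
theorem exists_eventually_measure_logValue_le : ∃ c₁ C : ℝ, 0 < c₁ ∧ 0 < C ∧ ∀ᶠ T in atTop,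
    ∀ G τ : ℝ, Real.log (Real.log T) ≤ G → G ≤ √(Real.log T / Real.log (Real.log T)) →
      √(Real.log G) ≤ τ → τ ≤ Real.log (Real.log T) ^ 2 →
    1 / T * volume.real {t : ℝ | t ∈ Set.Icc T (2 * T) ∧
        ∀ w : ℂ, HasLogValue (F.L j) (F.α j)
          (((1 / 2 + 1 / G : ℝ) : ℂ) + (t : ℂ) * Complex.I) w → τ ≤ ‖w‖}
      ≤ C * largeDeviationBound (F.ξ j) c₁ T G τ := by
  have hξ := F.ξ_pos j
  obtain ⟨D, hD, hlogV⟩ := F.exists_eventually_hasLogValue j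
  obtain ⟨C₀, Y₀, hC₀⟩ := F.exists_integral_norm_smoothPrimePoly_zero_le j
  obtain ⟨B, hB, hB'⟩ := F.exists_integral_norm_smoothPrimePoly_one_le j
  have hC' : 0 ≤ F.ξ j * (Real.log 40 + 1) + |C₀| := by
    have := Real.log_nonneg (show (1 : ℝ) ≤ 40 by norm_num)
    positivity
  obtain ⟨c₁, hc₁, hc⟩ := exists_sq_sqrt_add_le (E := √B + 1 + D) hξ hC' (by positivity)
  set E : ℝ := max 1 (1 / F.ξ j) with hE
  have hE1 : 1 ≤ E := le_max_left _ _
  refine ⟨c₁, 1 + 3 * Real.exp 2 * E, hc₁, by positivity, ?_⟩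
  filter_upwards [hlogV, F.eventually_volume_near_zeros_le j hξ, eventually_parameters hξ 0 Y₀,
    eventually_one_le_log, eventually_ge_atTop 3]
    with T hlogT hbad hpar hlog hT3 G τ hG1 hG2 hτ1 hτ2
  obtain ⟨-, hYH, hY₀, -, hk⟩ := hpar G hG1 hG2
  obtain ⟨hl, hll, hlG⟩ := hlog G hG1
  have hT : 0 < T := by linarith
  have hG : 1 ≤ G := hl.trans hG1
  have hLT : 1 ≤ Real.log T := by
    rw [Real.le_log_iff_exp_le (by linarith)]
    linarith [Real.exp_one_lt_d9]
  set l := Real.log (Real.log T) with hldef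
  set Y := 40 * G * l with hY
  have hY0 : 0 ≤ Y := by positivity
  set x := Real.log G with hx
  set M := max (√x) (Real.log l) with hM
  have hsx : 1 ≤ √x := Real.one_le_sqrt.2 hlG
  have hM1 : 1 ≤ M := hsx.trans (le_max_left _ _)
  set W := F.ξ j * x + c₁ * M with hW
  have hξW : F.ξ j * x ≤ W := by rw [hW]; linarith [mul_nonneg hc₁.le (zero_le_one.trans hM1)]
  set C' := F.ξ j * (Real.log 40 + 1) + |C₀| with hC'def
  set V := F.ξ j * x + C' * M with hV
  have hx0 : 0 < x := by linarith
  have hV0 : 0 < V := by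
    have := mul_nonneg hC' (zero_le_one.trans hM1)
    have := mul_pos hξ hx0
    linarith
  -- `log Y = log 40 + log G + log log log T`, and the last term is at most `G₀`
  have hYV : |F.ξ j * Real.log Y + C₀| ≤ V := by
    have h1 : Real.log Y = Real.log 40 + x + Real.log l := by
      rw [hY, Real.log_mul (by positivity) (by positivity), Real.log_mul (by norm_num)
        (by positivity)]
    have h40 : 0 ≤ Real.log 40 := Real.log_nonneg (by norm_num)
    have h2 : Real.log 40 ≤ Real.log 40 * M := le_mul_of_one_le_right h40 hM1
    have h3 : Real.log l ≤ M := le_max_right _ _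
    have h4 : |C₀| ≤ |C₀| * M := le_mul_of_one_le_right (abs_nonneg _) hM1
    have h5 : F.ξ j * (Real.log 40 + Real.log l) ≤ F.ξ j * (Real.log 40 * M + M) := by gcongr
    refine (abs_add_le _ _).trans ?_
    rw [abs_of_nonneg (by rw [h1]; positivity), h1, hV, hC'def]
    linarith
  set P : ℕ → ℝ → ℂ := fun k t => smoothPrimePoly (F.α j) (Real.log T) Y k
    (((1 / 2 + 1 / G : ℝ) : ℂ) + t * Complex.I) with hP
  have hPc : ∀ k, Continuous (P k) := fun k => continuous_smoothPrimePoly _ _ _ _ _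
  have hPi : ∀ k n, Integrable (fun t => ‖P k t‖ ^ (2 * n)) (volume.restrict (Set.Icc T (2 * T))) :=
    fun k n => ((hPc k).norm.pow _).integrableOn_Icc
  have hT2 : T ≤ 2 * T := by linarith
  have hσ : 1 / 2 ≤ 1 / 2 + 1 / G := by
    have : 0 ≤ 1 / G := by positivity
    linarith
  have hkT : ∀ k : ℕ, k * W ≤ τ ^ 2 → Real.exp (4 * Y) ^ (2 * k) ≤ T := fun k hkW => by
    refine hk k ?_
    calc (k : ℝ) * F.ξ j ≤ k * W := by
          gcongr
          exact (le_mul_of_one_le_right hξ.le hlG).trans hξW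
      _ ≤ τ ^ 2 := hkW
      _ ≤ (l ^ 2) ^ 2 := by
          have : 0 ≤ τ := (Real.sqrt_nonneg _).trans hτ1
          gcongr
      _ = l ^ 4 := by ring
  have hE' : x ≤ E * W := by
    calc x = 1 / F.ξ j * (F.ξ j * x) := by field_simp
      _ ≤ E * W := by
        gcongr
        exact le_max_right _ _
  have hvol : (volume.restrict (Set.Icc T (2 * T))).real Set.univ = T := by
    rw [measureReal_restrict_apply MeasurableSet.univ, Set.univ_inter, Real.volume_real_Icc_of_le hT2]
    ring
  have hint : ∀ f : ℝ → ℝ, ∫ t in Set.Icc T (2 * T), f t = ∫ t in T..2 * T, f t := fun f => by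
    rw [integral_Icc_eq_integral_Ioc, intervalIntegral.integral_of_le hT2]
  have hmain := measureReal_le_gaussian (μ := volume.restrict (Set.Icc T (2 * T)))
    (x := fun t => ‖P 0 t‖) (y := fun t => ‖P 1 t‖) (z := fun _ => D) (A := √V) (B := √B + 1)
    (D := D) (K := 3 * T) (E := E) (τ := τ) (v := x) (W := W) hx0 hE1 hE' hτ1
    (fun _ => norm_nonneg _) (fun _ => norm_nonneg _) (fun _ => hD.le) (fun _ => le_rfl)
    (Real.sqrt_pos.2 hV0) (by positivity) hD (by positivity) (by rw [hvol]; linarith)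
    (by
      have := hc x M hx0.le (le_max_left _ _) hM1
      rwa [← add_assoc] at this) (hPi 0) (hPi 1)
    (fun k hkW => by
      rw [hint, Real.sq_sqrt hV0.le]
      refine (hC₀ _ _ _ _ k hσ hLT hY₀ hY0 hYH (hkT k hkW)).trans ?_
      refine mul_le_mul_of_nonneg_left ((le_abs_self _).trans ?_) (by positivity)
      rw [abs_pow]
      gcongr)
    (fun k hkW => by
      rw [hint]
      refine (hB' _ _ _ _ k hσ hLT hY0 hYH (hkT k hkW)).trans ?_
      have : B ≤ (√B + 1) ^ 2 := by
        nlinarith [Real.sq_sqrt hB, Real.sqrt_nonneg B]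
      gcongr)
  have hsub : {t : ℝ | t ∈ Set.Icc T (2 * T) ∧ ∀ w : ℂ, HasLogValue (F.L j) (F.α j)
      (((1 / 2 + 1 / G : ℝ) : ℂ) + (t : ℂ) * Complex.I) w → τ ≤ ‖w‖} ⊆
      {t : ℝ | t ∈ Set.Icc T (2 * T) ∧ ∃ z : ℂ, 1 / 2 + 2 * (1 / (4 * G)) ≤ z.re ∧
        |z.im - t| ≤ Real.log T ^ 2 / (1 / (4 * G)) + 2 * (1 / (4 * G)) ∧ F.L j z = 0} ∪
      ({t : ℝ | τ ≤ ‖P 0 t‖ + ‖P 1 t‖ + D} ∩ Set.Icc T (2 * T)) := by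
    rintro t ⟨ht, hw⟩
    by_cases hz : ∃ z : ℂ, 1 / 2 + 2 * (1 / (4 * G)) ≤ z.re ∧
        |z.im - t| ≤ Real.log T ^ 2 / (1 / (4 * G)) + 2 * (1 / (4 * G)) ∧ F.L j z = 0
    · exact Or.inl ⟨ht, hz⟩
    · obtain ⟨w, hw1, hw2⟩ := hlogT G hG1 hG2 t ht hz
      exact Or.inr ⟨(hw w hw1).trans hw2, ht⟩
  rw [measureReal_restrict_apply' measurableSet_Icc] at hmain
  have hfin : volume (Set.Icc T (2 * T)) ≠ ⊤ := measure_Icc_lt_top.ne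
  have hb := (hbad G hG1 hG2).trans
    (mul_le_mul_of_nonneg_left (exp_le_mul_exp hξ hlG hτ1 hτ2 hξW) hT.le)
  rw [one_div, inv_mul_le_iff₀ hT, largeDeviationBound]
  refine ((measureReal_mono hsub ?_).trans (measureReal_union_le _ _)).trans ?_
  · exact measure_ne_top_of_subset
      (Set.union_subset (fun t ht => ht.1) Set.inter_subset_right) hfin
  calc _ ≤ _ := add_le_add hb hmain
    _ = _ := by ring

end LFunctionFamily

/-! ### Almost sure convergence of the random series -/

/-- A series of independent centred real random variables with partial sums bounded in `L¹`
converges almost surely, by the martingale convergence theorem. -/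
theorem ae_exists_tendsto_sum_of_iIndepFun {Ω : Type*} [MeasurableSpace Ω] {μ : Measure Ω}
    [IsProbabilityMeasure μ] {g : ℕ → Ω → ℝ} (hg : ∀ i, StronglyMeasurable (g i))
    (hind : iIndepFun g μ) (hint : ∀ i, Integrable (g i) μ) (hmean : ∀ i, ∫ ω, g i ω ∂μ = 0)
    (R : NNReal) (hR : ∀ n, eLpNorm (fun ω => ∑ i ∈ Finset.range n, g i ω) 1 μ ≤ R) :
    ∀ᵐ ω ∂μ, ∃ c, Tendsto (fun n => ∑ i ∈ Finset.range n, g i ω) atTop (𝓝 c) := by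
  set f : ℕ → Ω → ℝ := fun n ω => ∑ i ∈ Finset.range (n + 1), g i ω with hf
  set ℱ := Filtration.natural g hg with hℱ
  have hadp : StronglyAdapted ℱ f := fun n => by
    refine Finset.stronglyMeasurable_fun_sum _ fun i hi => ?_
    exact (Filtration.stronglyAdapted_natural hg i).mono
      (ℱ.mono (Nat.lt_succ_iff.1 (Finset.mem_range.1 hi)))
  have hfint : ∀ n, Integrable (f n) μ := fun n => integrable_finsetSum _ fun i _ => hint i
  have hmart : Martingale f ℱ μ := by
    refine martingale_nat hadp hfint fun n => ?_
    have h1 : f (n + 1) = f n + g (n + 1) := by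
      ext ω
      exact Finset.sum_range_succ _ _
    rw [h1]
    have h2 := condExp_add (hfint n) (hint (n + 1)) (ℱ n)
    have h3 : μ[f n | ℱ n] = f n :=
      condExp_of_stronglyMeasurable (ℱ.le n) (hadp n) (hfint n)
    have h4 := hind.condExp_natural_ae_eq_of_lt hg n.lt_succ_self
    filter_upwards [h2, h4] with ω h2 h4
    rw [h2, Pi.add_apply, h3, h4, hmean, add_zero]
  filter_upwards [hmart.submartingale.exists_ae_tendsto_of_bdd (R := R) fun n => hR (n + 1)]
    with ω ⟨c, hc⟩
  exact ⟨c, (tendsto_add_atTop_iff_nat 1).1 hc⟩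

theorem sum_primesUpTo_eq_sum_range {M : Type*} [AddCommMonoid M] (f : Nat.Primes → M) (q : ℕ) :
    ∑ p ∈ primesUpTo q, f p =
      ∑ i ∈ Finset.range (Nat.count Nat.Prime (q + 1)),
        f ⟨Nat.nth Nat.Prime i, Nat.prime_nth_prime i⟩ := by
  symm
  refine Finset.sum_bij (fun i _ => ⟨Nat.nth Nat.Prime i, Nat.prime_nth_prime i⟩)
    (fun i hi => ?_) (fun i _ k _ h => ?_) (fun p hp => ?_) (fun i _ => rfl)
  · have := Nat.nth_lt_of_lt_count (Finset.mem_range.1 hi)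
    refine (mem_primesUpTo (Nat.cast_nonneg q)).2 (Nat.cast_le.2 (Nat.lt_succ_iff.1 this))
  · exact Nat.nth_injective Nat.infinite_setOfPred_prime (congrArg (fun p : Nat.Primes => (p : ℕ)) h)
  · have hp' := (mem_primesUpTo (Nat.cast_nonneg q)).1 hp
    have hpq : (p : ℕ) < q + 1 := Nat.lt_succ_iff.2 (by exact_mod_cast hp')
    refine ⟨Nat.count Nat.Prime p, ?_, ?_⟩
    · exact Finset.mem_range.2 (Nat.count_strict_mono p.2 hpq)
    · exact Subtype.ext (Nat.nth_count p.2)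

theorem tendsto_count_prime : Tendsto (fun q : ℕ => Nat.count Nat.Prime (q + 1)) atTop atTop := by
  refine tendsto_atTop.2 fun b => ?_
  filter_upwards [eventually_ge_atTop (Nat.nth Nat.Prime b)] with q hq
  calc b = Nat.count Nat.Prime (Nat.nth Nat.Prime b) :=
        (Nat.count_nth_of_infinite Nat.infinite_setOfPred_prime b).symm
    _ ≤ _ := Nat.count_monotone _ (by omega)

namespace IsUniformCircleSequence

variable {Ω : Type*} [MeasurableSpace Ω] {X : Nat.Primes → Ω → ℂ} {Pr : Measure Ω}
  [IsProbabilityMeasure Pr]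

/-- Almost sure convergence of a real linear functional, such as the real or the imaginary part, of
the random series. -/
theorem ae_exists_tendsto_real (h : IsUniformCircleSequence X Pr) (φ : ℂ →L[ℝ] ℝ)
    (hφ : ∀ z, |φ z| ≤ ‖z‖) (a : Nat.Primes → ℂ) (r : ℕ) (ha : Summable fun p => ‖a p‖ ^ 2) :
    ∀ᵐ ω ∂Pr, ∃ c : ℝ, Tendsto (fun q : ℕ => ∑ p ∈ primesUpTo q, φ (a p * X p ω ^ (r + 1)))
      atTop (𝓝 c) := by
  classical
  set e : ℕ → Nat.Primes := fun i => ⟨Nat.nth Nat.Prime i, Nat.prime_nth_prime i⟩ with he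
  have hinj : Function.Injective e := fun i k hik =>
    Nat.nth_injective Nat.infinite_setOfPred_prime (congrArg (fun p : Nat.Primes => (p : ℕ)) hik)
  set g : ℕ → Ω → ℝ := fun i ω => φ (a (e i) * X (e i) ω ^ (r + 1)) with hg
  have hXint : ∀ p, Integrable (fun ω => a p * X p ω ^ (r + 1)) Pr := fun p => by
    refine Integrable.of_bound
      (((h.measurable p).pow_const _).const_mul _).aestronglyMeasurable ‖a p‖ ?_
    filter_upwards [h.ae_norm_eq_one p] with ω hω
    rw [norm_mul, norm_pow, hω, one_pow, mul_one]
  have hgm : ∀ i, Measurable (g i) := fun i =>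
    φ.measurable.comp (((h.measurable (e i)).pow_const _).const_mul _)
  have hgi : ∀ i, Integrable (g i) Pr := fun i => φ.integrable_comp (hXint (e i))
  have hind : iIndepFun g Pr := (h.indep.precomp hinj).comp
    (fun i z => φ (a (e i) * z ^ (r + 1)))
    (fun i => φ.measurable.comp ((measurable_id.pow_const _).const_mul _))
  have hmean : ∀ i, ∫ ω, g i ω ∂Pr = 0 := fun i => by
    rw [φ.integral_comp_comm (hXint (e i)), integral_const_mul, h.integral_pow_succ, mul_zero,
      map_zero]
  obtain ⟨V, hV⟩ := ha
  have hV0 : 0 ≤ V := hV.nonneg fun p => by positivity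
  have hL1 : ∀ n, eLpNorm (fun ω => ∑ i ∈ Finset.range n, g i ω) 1 Pr ≤
      ((1 + V).toNNReal : ℝ≥0∞) := by
    intro n
    set s := (Finset.range n).image e with hs
    have hsum : ∀ ω, ∑ i ∈ Finset.range n, g i ω = φ (∑ p ∈ s, a p * X p ω ^ (r + 1)) :=
      fun ω => by
        rw [hs, Finset.sum_image fun i _ k _ hik => hinj hik, map_sum]
    have hmom := h.integral_norm_sum_pow_le s a (r := r + 1) (by simp) 1
    have hsV : ∑ p ∈ s, ‖a p‖ ^ 2 ≤ V := sum_le_hasSum _ (fun p _ => by positivity) hV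
    have hi2 := h.integrable_norm_sum_pow s a (r + 1) 2
    rw [eLpNorm_one_eq_lintegral_enorm, ← ofReal_integral_norm_eq_lintegral_enorm
      (integrable_finsetSum _ fun i _ => hgi i)]
    refine ENNReal.ofReal_le_ofReal ?_
    calc ∫ ω, ‖∑ i ∈ Finset.range n, g i ω‖ ∂Pr
        ≤ ∫ ω, (1 + ‖∑ p ∈ s, a p * X p ω ^ (r + 1)‖ ^ 2) ∂Pr := by
          refine integral_mono (integrable_finsetSum _ fun i _ => hgi i).norm
            ((integrable_const _).add hi2) fun ω => ?_
          simp only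
          rw [hsum ω, Real.norm_eq_abs]
          refine (hφ _).trans ?_
          nlinarith [sq_nonneg (‖∑ p ∈ s, a p * X p ω ^ (r + 1)‖ - 1)]
      _ = 1 + ∫ ω, ‖∑ p ∈ s, a p * X p ω ^ (r + 1)‖ ^ 2 ∂Pr := by
          rw [integral_add (integrable_const _) hi2]; simp
      _ ≤ 1 + V := by
          have : ∫ ω, ‖∑ p ∈ s, a p * X p ω ^ (r + 1)‖ ^ 2 ∂Pr ≤ ∑ p ∈ s, ‖a p‖ ^ 2 := by
            simpa using hmom
          linarith
  filter_upwards [ae_exists_tendsto_sum_of_iIndepFun (fun i => (hgm i).stronglyMeasurable) hind hgi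
    hmean _ hL1] with ω ⟨c, hc⟩
  refine ⟨c, ?_⟩
  simp_rw [sum_primesUpTo_eq_sum_range]
  exact hc.comp tendsto_count_prime

/-- `∑ a(p) X(p)^r` converges almost surely if `∑ |a(p)|² < ∞` and `r ≥ 1`. -/
theorem ae_exists_tendsto (h : IsUniformCircleSequence X Pr) (a : Nat.Primes → ℂ) (r : ℕ)
    (ha : Summable fun p => ‖a p‖ ^ 2) :
    ∀ᵐ ω ∂Pr, ∃ c : ℂ, Tendsto (fun q : ℕ => ∑ p ∈ primesUpTo q, a p * X p ω ^ (r + 1))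
      atTop (𝓝 c) := by
  filter_upwards [h.ae_exists_tendsto_real Complex.reCLM Complex.abs_re_le_norm a r ha,
    h.ae_exists_tendsto_real Complex.imCLM Complex.abs_im_le_norm a r ha] with ω ⟨c, hc⟩ ⟨d, hd⟩
  refine ⟨⟨c, d⟩, ?_⟩
  have := (Complex.continuous_ofReal.tendsto c).comp hc |>.add
    (((Complex.continuous_ofReal.tendsto d).comp hd).mul_const Complex.I)
  rw [← Complex.mk_eq_add_mul_I] at this
  refine this.congr fun q => ?_
  simp only [Function.comp_apply, Complex.reCLM_apply, Complex.imCLM_apply]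
  rw [← Complex.re_sum, ← Complex.im_sum, Complex.re_add_im]

end IsUniformCircleSequence

/-! ### The distribution of `log L(σ, X)` -/

theorem randomLogPartial_eq {d : ℕ} (α : Fin d → Nat.Primes → ℂ) (σ : ℝ) (x : Nat.Primes → ℂ)
    (q : ℕ) : randomLogPartial α σ x q =
      ∑ p ∈ primesUpTo q, ∑' k : ℕ, logTerm α σ (p, k) * x p ^ (k + 1) := by
  refine Finset.sum_congr rfl fun p _ => tsum_congr fun k => ?_
  rw [logTerm]
  exact mul_div_right_comm _ _ _

namespace LFunctionFamily

variable {J : ℕ} (F : LFunctionFamily J) (j : Fin J)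

/-- For unimodular `x(p)`, the powers `p^k` with `k ≥ 3` contribute an absolutely convergent
series to `log L(σ, x)`. -/
theorem exists_randomLogPartial_eq : ∃ D : ℝ, 0 < D ∧ ∀ (σ : ℝ) (x : Nat.Primes → ℂ), 1 / 2 ≤ σ →
    (∀ p, ‖x p‖ = 1) → ∃ r : Nat.Primes → ℂ, Summable r ∧
      (∀ s : Finset Nat.Primes, ‖∑ p ∈ s, r p‖ ≤ D) ∧
      ∀ q, randomLogPartial (F.α j) σ x q =
        ∑ p ∈ primesUpTo q, logTerm (F.α j) σ (p, 0) * x p ^ (0 + 1) +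
        ∑ p ∈ primesUpTo q, logTerm (F.α j) σ (p, 1) * x p ^ (1 + 1) +
        ∑ p ∈ primesUpTo q, r p := by
  have hu := F.summable_primePowerCoeff_add_three j
  set u : Nat.Primes × ℕ → ℝ := fun x => ‖primePowerCoeff (F.α j) x.1 (x.2 + 3)‖ *
      ((x.1 : ℕ) : ℝ) ^ (-((x.2 + 3) * (1 / 2 : ℝ))) with hudef
  have hu0 : ∀ x, 0 ≤ u x := fun x => by positivity
  have hup : ∀ p, Summable fun k => u (p, k) := fun p => hu.prod_factor p
  have hsum : Summable fun p => ∑' k, u (p, k) := hu.prod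
  refine ⟨∑' p, ∑' k, u (p, k) + 1, by
    have : 0 ≤ ∑' p, ∑' k, u (p, k) := tsum_nonneg fun p => tsum_nonneg fun k => hu0 _
    linarith, fun σ x hσ hx => ?_⟩
  have hterm : ∀ p k, ‖logTerm (F.α j) σ (p, k + 2) * x p ^ (k + 2 + 1)‖ ≤ u (p, k) := by
    intro p k
    rw [norm_mul, norm_pow, hx, one_pow, mul_one]
    refine (norm_logTerm_le (F.α j) (s := (σ : ℂ)) (c := 1 / 2) (by simpa using hσ) _).trans
      (le_of_eq ?_)
    simp only [hudef]
    push_cast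
    congr 3
    ring
  have htail : ∀ p, Summable fun k => logTerm (F.α j) σ (p, k + 2) * x p ^ (k + 2 + 1) :=
    fun p => Summable.of_norm_bounded (hup p) (hterm p)
  have hr : ∀ p, ‖∑' k, logTerm (F.α j) σ (p, k + 2) * x p ^ (k + 2 + 1)‖ ≤ ∑' k, u (p, k) :=
    fun p => tsum_of_norm_bounded (hup p).hasSum (hterm p)
  refine ⟨fun p => ∑' k, logTerm (F.α j) σ (p, k + 2) * x p ^ (k + 2 + 1),
    Summable.of_norm_bounded hsum hr, fun s => ?_, fun q => ?_⟩
  · refine (norm_sum_le_of_le _ fun p _ => hr p).trans ?_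
    have := hsum.sum_le_tsum s fun p _ => tsum_nonneg fun k => hu0 _
    linarith
  · rw [randomLogPartial_eq, ← Finset.sum_add_distrib, ← Finset.sum_add_distrib]
    refine Finset.sum_congr rfl fun p _ => ?_
    have hs : Summable fun k => logTerm (F.α j) σ (p, k) * x p ^ (k + 1) :=
      (summable_nat_add_iff 2).1 (htail p)
    rw [← hs.sum_add_tsum_nat_add 2, Finset.sum_range_succ, Finset.sum_range_one]

theorem tendsto_sum_primesUpTo {f : Nat.Primes → ℂ} (hf : Summable f) :
    Tendsto (fun q : ℕ => ∑ p ∈ primesUpTo q, f p) atTop (𝓝 (∑' p, f p)) := by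
  refine hf.hasSum.comp (tendsto_atTop.2 fun s => ?_)
  filter_upwards [eventually_ge_atTop (s.sup fun p => (p : ℕ))] with q hq p hp
  refine (mem_primesUpTo (Nat.cast_nonneg q)).2 (Nat.cast_le.2 ?_)
  exact (Finset.le_sup (f := fun p : Nat.Primes => (p : ℕ)) hp).trans hq

/-- The variance of the part of the random series that is linear in the `X(p)`. -/
theorem exists_sum_sq_logTerm_zero_le : ∃ C G₀ : ℝ, 1 ≤ G₀ ∧ ∀ G, G₀ ≤ G →
    ∀ s : Finset Nat.Primes, ∑ p ∈ s, ‖logTerm (F.α j) ((1 / 2 + 1 / G : ℝ) : ℂ) (p, 0)‖ ^ 2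
      ≤ F.ξ j * Real.log G + C := by
  obtain ⟨C, G₀, hG₀, h⟩ := F.exists_sum_sq_primePowerCoeff_le j
  refine ⟨C, G₀, hG₀, fun G hG s => (Finset.sum_le_sum fun p _ => ?_).trans (h G hG s)⟩
  rw [norm_logTerm, mul_pow, ← Real.rpow_mul_natCast (by positivity), Complex.ofReal_re]
  refine le_of_eq ?_
  push_cast
  congr 2
  ring

/-- The variance of the part of the random series that is quadratic in the `X(p)`. -/
theorem exists_sum_sq_logTerm_one_le : ∃ C : ℝ, 0 ≤ C ∧ ∀ σ : ℝ, 1 / 2 ≤ σ →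
    ∀ s : Finset Nat.Primes, ∑ p ∈ s, ‖logTerm (F.α j) (σ : ℂ) (p, 1)‖ ^ 2 ≤ C := by
  obtain ⟨C, hC⟩ := F.summable_sq_primePowerCoeff_two j
  refine ⟨C, hC.nonneg fun p => by positivity, fun σ hσ s => (Finset.sum_le_sum fun p _ => ?_).trans
    (sum_le_hasSum s (fun p _ => by positivity) hC)⟩
  have h := norm_logTerm_le (F.α j) (s := (σ : ℂ)) (c := 1 / 2) (by simpa using hσ) (p, 1)
  refine (pow_le_pow_left₀ (norm_nonneg _) h 2).trans (le_of_eq ?_)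
  rw [mul_pow, ← Real.rpow_mul_natCast (by positivity)]
  push_cast
  norm_num

variable {Ω : Type*} [MeasurableSpace Ω] {Pr : Measure Ω} [IsProbabilityMeasure Pr]
  {X : Nat.Primes → Ω → ℂ}

/-- The random series converges almost surely, provided that the variance of its linear part is
finite. -/
theorem ae_exists_hasRandomLogValue (hX : IsUniformCircleSequence X Pr) {σ : ℝ} (hσ : 1 / 2 ≤ σ)
    (h0 : Summable fun p => ‖logTerm (F.α j) (σ : ℂ) (p, 0)‖ ^ 2) :
    ∀ᵐ ω ∂Pr, ∃ w, HasRandomLogValue (F.α j) σ (fun p => X p ω) w := by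
  obtain ⟨D, -, hD⟩ := F.exists_randomLogPartial_eq j
  obtain ⟨C, -, hC⟩ := F.exists_sum_sq_logTerm_one_le j
  have h1 : Summable fun p => ‖logTerm (F.α j) (σ : ℂ) (p, 1)‖ ^ 2 :=
    summable_of_sum_le (fun p => by positivity) (hC σ hσ)
  filter_upwards [hX.ae_exists_tendsto _ 0 h0, hX.ae_exists_tendsto _ 1 h1,
    ae_all_iff.2 hX.ae_norm_eq_one] with ω ⟨a, ha⟩ ⟨b, hb⟩ hω
  obtain ⟨r, hr, -, hq⟩ := hD σ (fun p => X p ω) hσ hω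
  refine ⟨a + b + ∑' p, r p, ?_⟩
  exact ((ha.add hb).add (tendsto_sum_primesUpTo hr)).congr fun q => (hq q).symm

/-- The tail of `log L(σ, X)` is controlled by the tails of its partial sums. -/
theorem measureReal_randomLog_le (hX : IsUniformCircleSequence X Pr) {σ τ D B : ℝ}
    (hσ : 1 / 2 ≤ σ) (h0 : Summable fun p => ‖logTerm (F.α j) (σ : ℂ) (p, 0)‖ ^ 2)
    (hD : ∀ x : Nat.Primes → ℂ, (∀ p, ‖x p‖ = 1) → ∃ r : Nat.Primes → ℂ, Summable r ∧
      (∀ s : Finset Nat.Primes, ‖∑ p ∈ s, r p‖ ≤ D) ∧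
      ∀ q, randomLogPartial (F.α j) σ x q =
        ∑ p ∈ primesUpTo q, logTerm (F.α j) σ (p, 0) * x p ^ (0 + 1) +
        ∑ p ∈ primesUpTo q, logTerm (F.α j) σ (p, 1) * x p ^ (1 + 1) +
        ∑ p ∈ primesUpTo q, r p)
    (hB : ∀ q : ℕ, Pr.real {ω | τ ≤ ‖∑ p ∈ primesUpTo q, logTerm (F.α j) σ (p, 0) * X p ω ^ (0 + 1)‖ +
        ‖∑ p ∈ primesUpTo q, logTerm (F.α j) σ (p, 1) * X p ω ^ (1 + 1)‖ + D} ≤ B) :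
    Pr.real {ω : Ω | ∀ w : ℂ, HasRandomLogValue (F.α j) σ (fun p => X p ω) w → τ < ‖w‖} ≤ B := by
  set A : ℕ → Set Ω := fun q => {ω | τ ≤
    ‖∑ p ∈ primesUpTo q, logTerm (F.α j) σ (p, 0) * X p ω ^ (0 + 1)‖ +
        ‖∑ p ∈ primesUpTo q, logTerm (F.α j) σ (p, 1) * X p ω ^ (1 + 1)‖ + D} with hA
  set U : ℕ → Set Ω := fun N => ⋂ q ≥ N, A q with hU
  -- almost surely, `τ < ‖w‖` for the limit `w` implies membership in `A q` for all large `q`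
  have hUm : Monotone U := fun M N hMN =>
    Set.biInter_mono (fun q hq => hMN.trans hq) fun q _ => le_rfl
  have hB0 : 0 ≤ B := measureReal_nonneg.trans (hB 0)
  have hae : {ω : Ω | ∀ w : ℂ, HasRandomLogValue (F.α j) σ (fun p => X p ω) w → τ < ‖w‖} ≤ᵐ[Pr]
      ⋃ N, U N := by
    filter_upwards [F.ae_exists_hasRandomLogValue j hX hσ h0, ae_all_iff.2 hX.ae_norm_eq_one]
      with ω ⟨w, hw⟩ hω hmem
    obtain ⟨r, -, hr, hq⟩ := hD (fun p => X p ω) hω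
    have h1 : ∀ᶠ q in atTop, τ < ‖randomLogPartial (F.α j) σ (fun p => X p ω) q‖ :=
      hw.norm.eventually_const_lt (hmem w hw)
    obtain ⟨N, hN⟩ := eventually_atTop.1 h1
    refine Set.mem_iUnion.2 ⟨N, Set.mem_iInter₂.2 fun q hqN => ?_⟩
    have h2 := hN q hqN
    rw [hq] at h2
    exact (h2.le.trans norm_add₃_le).trans (add_le_add le_rfl (hr _))
  refine ENNReal.toReal_le_of_le_ofReal hB0 ((measure_mono_ae hae).trans ?_)
  rw [hUm.measure_iUnion]
  refine iSup_le fun N => (measure_mono (Set.biInter_subset_of_mem (le_refl N))).trans ?_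
  rw [← ofReal_measureReal]
  exact ENNReal.ofReal_le_ofReal (hB N)

end LFunctionFamily

namespace LFunctionFamily

variable {J : ℕ} (F : LFunctionFamily J) (j : Fin J)

/-- The tail of `log L(σ, X)`, uniformly in `T`, which occurs in the bound only through `G₀`. -/
theorem exists_measureReal_randomLog_le : ∃ c₁ C G₀ : ℝ, 0 < c₁ ∧ 0 < C ∧ ∀ T G τ : ℝ, G₀ ≤ G →
    1 ≤ Real.log G → √(Real.log G) ≤ τ →
    ∀ (Ω : Type*) [MeasurableSpace Ω] (Pr : Measure Ω) [IsProbabilityMeasure Pr]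
      (X : Nat.Primes → Ω → ℂ), IsUniformCircleSequence X Pr →
      Pr.real {ω : Ω | ∀ w : ℂ,
          HasRandomLogValue (F.α j) (1 / 2 + 1 / G) (fun p => X p ω) w → τ < ‖w‖}
        ≤ C * largeDeviationBound (F.ξ j) c₁ T G τ := by
  have hξ := F.ξ_pos j
  obtain ⟨D, hD, hDr⟩ := F.exists_randomLogPartial_eq j
  obtain ⟨C₀, G₀, hG₀, hC₀⟩ := F.exists_sum_sq_logTerm_zero_le j
  obtain ⟨B, hB, hB'⟩ := F.exists_sum_sq_logTerm_one_le j
  obtain ⟨c₁, hc₁, hc⟩ := exists_sq_sqrt_add_le (E := √B + 1 + D) hξ (abs_nonneg C₀) (by positivity)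
  set E : ℝ := max 1 (1 / F.ξ j) with hE
  have hE1 : 1 ≤ E := le_max_left _ _
  refine ⟨c₁, Real.exp 2 * E, G₀, hc₁, by positivity,
    fun T G τ hG hlG hτ Ω _ Pr _ X hX => ?_⟩
  have hG1 : 1 ≤ G := hG₀.trans hG
  have hσ : 1 / 2 ≤ 1 / 2 + 1 / G := by
    have : 0 ≤ 1 / G := by positivity
    linarith
  set x := Real.log G with hx
  have hx0 : 0 < x := by linarith
  set M := max (√x) (Real.log (Real.log (Real.log T))) with hM
  have hM1 : 1 ≤ M := (Real.one_le_sqrt.2 hlG).trans (le_max_left _ _)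
  set W := F.ξ j * x + c₁ * M with hW
  have hξW : F.ξ j * x ≤ W := by rw [hW]; linarith [mul_nonneg hc₁.le (zero_le_one.trans hM1)]
  set V := F.ξ j * x + |C₀| * M with hV
  have hV0 : 0 < V := by
    have := mul_nonneg (abs_nonneg C₀) (zero_le_one.trans hM1)
    have := mul_pos hξ hx0
    linarith
  have hCV : F.ξ j * x + C₀ ≤ V := by
    have := le_mul_of_one_le_right (abs_nonneg C₀) hM1
    rw [hV]
    linarith [le_abs_self C₀]
  have hE' : x ≤ E * W := by
    calc x = 1 / F.ξ j * (F.ξ j * x) := by field_simp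
      _ ≤ E * W := by
        gcongr
        exact le_max_right _ _
  refine (F.measureReal_randomLog_le j hX hσ
    (B := 1 * Real.exp 2 * E * (τ / √x) * Real.exp (-τ ^ 2 / W))
    (summable_of_sum_le (fun p => by positivity) (hC₀ G hG)) (fun x hx => hDr _ x hσ hx)
    fun q => ?_).trans (le_of_eq ?_)
  · refine measureReal_le_gaussian (z := fun _ => D) (A := √V) (B := √B + 1) hx0 hE1 hE' hτ
      (fun _ => norm_nonneg _) (fun _ => norm_nonneg _) (fun _ => hD.le) (fun _ => le_rfl)
      (Real.sqrt_pos.2 hV0) (by positivity) hD one_pos (by simp)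
      (by
        have := hc x M hx0.le (le_max_left _ _) hM1
        rwa [← add_assoc] at this)
      (fun k => hX.integrable_norm_sum_pow _ _ _ _) (fun k => hX.integrable_norm_sum_pow _ _ _ _)
      (fun k _ => ?_) fun k _ => ?_
    · refine (hX.integral_norm_sum_pow_le _ _ (by simp) k).trans ?_
      rw [one_mul, Real.sq_sqrt hV0.le]
      gcongr
      exact (hC₀ G hG _).trans hCV
    · refine (hX.integral_norm_sum_pow_le _ _ (by simp) k).trans ?_
      have : B ≤ (√B + 1) ^ 2 := by
        nlinarith [Real.sq_sqrt hB, Real.sqrt_nonneg B]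
      rw [one_mul]
      gcongr
      exact (hB' _ hσ _).trans this
  · rw [largeDeviationBound]
    ring

end LFunctionFamily

/-- The set of `t` (of `ω`) below also contains the points at which `log L_j(σ + it)`
(`log L_j(σ, X(ω))`) is not defined, so that the estimate says that they are rare as well. -/
theorem lemma2p6 {J : ℕ} (F : LFunctionFamily J) (j : Fin J) :
    ∃ c₀ : ℝ, 0 < c₀ ∧ ∃ c₁ : ℝ, 0 < c₁ ∧ ∃ C : ℝ, 0 < C ∧ ∃ T₀ : ℝ,
      ∀ T : ℝ, T₀ ≤ T → ∀ G : ℝ, Real.log (Real.log T) ≤ G →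
        G ≤ c₀ * √(Real.log T / Real.log (Real.log T)) →
      ∀ τ : ℝ, √(Real.log G) ≤ τ → τ ≤ Real.log (Real.log T) ^ 2 →
        (1 / T * volume.real {t : ℝ | t ∈ Set.Icc T (2 * T) ∧
            ∀ w : ℂ, HasLogValue (F.L j) (F.α j)
              (((1 / 2 + 1 / G : ℝ) : ℂ) + (t : ℂ) * Complex.I) w → τ ≤ ‖w‖}
          ≤ C * largeDeviationBound (F.ξ j) c₁ T G τ) ∧
        ∀ (Ω : Type*) [MeasurableSpace Ω] (Pr : Measure Ω) [IsProbabilityMeasure Pr]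
          (X : Nat.Primes → Ω → ℂ), IsUniformCircleSequence X Pr →
          Pr.real {ω : Ω | ∀ w : ℂ,
              HasRandomLogValue (F.α j) (1 / 2 + 1 / G) (fun p => X p ω) w → τ < ‖w‖}
            ≤ C * largeDeviationBound (F.ξ j) c₁ T G τ := by
  obtain ⟨c, C, hc, hC, hT⟩ := F.exists_eventually_measure_logValue_le j
  obtain ⟨c', C', G₀, hc', hC', hR⟩ := F.exists_measureReal_randomLog_le j
  obtain ⟨T₀, hT₀⟩ := eventually_atTop.1
    (hT.and (eventually_one_le_log.and (tendsto_log_log_atTop.eventually_ge_atTop G₀)))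
  refine ⟨1, one_pos, max c c', lt_max_of_lt_left hc, max C C', lt_max_of_lt_left hC, T₀,
    fun T hTT G hG1 hG2 τ hτ1 hτ2 => ?_⟩
  obtain ⟨h1, h2, h3⟩ := hT₀ T hTT
  obtain ⟨-, -, hlG⟩ := h2 G hG1
  have hτ0 : 0 ≤ τ := (Real.sqrt_nonneg _).trans hτ1
  have hmono : ∀ a A : ℝ, 0 ≤ a → 0 ≤ A → a ≤ max c c' → A ≤ max C C' →
      A * largeDeviationBound (F.ξ j) a T G τ ≤
        max C C' * largeDeviationBound (F.ξ j) (max c c') T G τ := fun a A ha hA hac hAC =>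
    mul_le_mul hAC (largeDeviationBound_mono (F.ξ_pos j) ha hac (by linarith) hτ0)
      (by unfold largeDeviationBound; positivity) (hA.trans hAC)
  rw [one_mul] at hG2
  exact ⟨(h1 G τ hG1 hG2 hτ1 hτ2).trans (hmono _ _ hc.le hC.le (le_max_left _ _) (le_max_left _ _)),
    fun Ω _ Pr _ X hX => (hR T G τ (h3.trans hG1) hlG hτ1 Ω Pr X hX).trans
      (hmono _ _ hc'.le hC'.le (le_max_right _ _) (le_max_right _ _))⟩
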